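/- Let $Z$ be a CAT(0) cube complex. Its hyperplanes are the classes of edges under parallelism, the equivalence relation generated by being opposite edges of a square. Removing the open carrier of a hyperplane $H$ (the union of the open cells whose closure contains an edge of $H$) leaves two components, the halfspaces of $H$; the carrier of $H$ is the union of the closed cells containing an edge of $H$; and $\mathrm{Sep}(A\mid B)$ is the set of hyperplanes having $A$ in one halfspace and $B$ in the other, where a hyperplane written in place of $A$ or $B$ stands for its carrier. Let a group $G$ act freely on $Z$ by combinatorial isometries, let $\mathfrak W$ be the set of hyperplanes of $Z$, and let $\mathcal H\subseteq\mathfrak W$ be a $G$-invariant family. The collapse of $\mathcal H$ is the $G$-equivariant cellular map $c\colon Z\to Y=X(Z^{(0)},\mathfrak W\setminus\mathcal H)$ to the cube complex given by Sageev's construction: a vertex of $Y$ is a choice of one halfspace for each hyperplane in $\mathfrak W\setminus\mathcal H$ such that the chosen halfspaces pairwise intersect and each vertex of $Z$ lies in all but finitely many of them; $2^k$ distinct vertices of $Y$ span a $k$-cube if and only if their choices agree for all hyperplanes except $k$; and $c$ sends a vertex of $Z$ to the choice of the halfspaces containing it and extends affinely to cubes. The collapse $c$ is strong if for all $H\in\mathcal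 H$ and $g\in G$ with $gH\neq H$, $\mathrm{Sep}(H\mid gH)\not\subseteq\mathcal H$. Then $c$ is strong if and only if both of the following hold: 1. the map $\bar c\colon Z/G\to Y/G$ induced by $c$ is a homotopy equivalence; 2. for every vertex $y$ of $Y/G$, any two edges of the subcomplex $C=\bar c^{-1}(y)$ of $Z/G$ that are parallel in $Z/G$ (joined by a finite sequence of edges in which consecutive ones are opposite edges of a square of $Z/G$) are parallel in $C$ (joined by such a sequence whose squares lie in $C$). -/

import Mathlib

open scoped Pointwise

universe u v w

/-! ### Cube complexes -/

/-- Let `φ` send the vertices of the `n`-cube `{0,1}ⁿ` to functions on a set `W` of coordinates.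
`φ` is a *face map* if there are `n` distinct coordinates such that the `i`-th of them records exactly
the `i`-th coordinate of the cube, all other coordinates being constant.
For `W = Fin m`, `P = Bool` these are the isometric embeddings of the vertex set of the `n`-cube
as that of a subcube of the `m`-cube (the symmetries of the cube for `m = n`). -/
def IsFaceMap {n : ℕ} {W : Type u} {P : Type v} (φ : (Fin n → Bool) → W → P) : Prop :=
  ∃ σ : Fin n ↪ W, (∀ i ε δ, φ ε (σ i) = φ δ (σ i) ↔ ε i = δ i) ∧
    ∀ w, w ∉ Set.range σ → ∀ ε δ, φ ε w = φ δ w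

/-- A cube complex with vertex set `V` all of whose closed cubes embed and are determined by their
vertex sets (every CAT(0) cube complex is of this kind). It is given by its parametrised cubes:
`IsCube n φ` says that `φ : {0,1}ⁿ → V` is (the restriction to vertices of) an isometric
parametrisation of a cube of the complex. All faces, and all reparametrisations by symmetries of
the cube, are included. -/
structure CubeComplex (V : Type u) where
  IsCube : ∀ n : ℕ, ((Fin n → Bool) → V) → Prop
  injective : ∀ {n : ℕ} {φ : (Fin n → Bool) → V}, IsCube n φ → Function.Injective φ
  vertex : ∀ v : V, IsCube 0 fun _ => v
  face : ∀ {m n : ℕ} {φ : (Fin n → Bool) → V} (f : (Fin m → Bool) → (Fin n → Bool)),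
    IsFaceMap f → IsCube n φ → IsCube m (φ ∘ f)
  unique : ∀ {n : ℕ} {φ ψ : (Fin n → Bool) → V}, IsCube n φ → IsCube n ψ →
    Set.range φ = Set.range ψ → ∃ f : (Fin n → Bool) → (Fin n → Bool), IsFaceMap f ∧ ψ = φ ∘ f

/-- The basepoint `(0,…,0)` of the cube. -/
def cubeOrigin (n : ℕ) : Fin n → Bool := fun _ => false

/-- The neighbour `(0,…,1,…,0)` of the basepoint of the cube. -/
def cubeUnit {n : ℕ} (i : Fin n) : Fin n → Bool := fun j => decide (j = i)

/-- The point with coordinates `x ∈ [0,1]ⁿ` of the cube with vertices `φ`, written as a formal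
convex combination of vertices, with the multiaffine weights. -/
noncomputable def cubePoint {V : Type u} {n : ℕ} (φ : (Fin n → Bool) → V)
    (x : Fin n → unitInterval) : V →₀ ℝ :=
  ∑ ε : Fin n → Bool, Finsupp.single (φ ε) (∏ i, if ε i then (x i : ℝ) else 1 - (x i : ℝ))

theorem mapDomain_cubePoint {V : Type u} {V' : Type v} {n : ℕ} (c : V → V')
    (φ : (Fin n → Bool) → V) (x : Fin n → unitInterval) :
    (cubePoint φ x).mapDomain c = cubePoint (c ∘ φ) x := by
  simp [cubePoint, Finsupp.mapDomain_finsetSum, Finsupp.mapDomain_single]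

namespace CubeComplex

variable {V : Type u} (Z : CubeComplex V)

/-- The underlying set of the cube complex: the union of its closed cubes. The weights of a point
determine its carrier (the cube spanned by the support) and its coordinates there, so two cubes are
glued exactly along their common faces. -/
def Realization : Type u :=
  {p : V →₀ ℝ // ∃ (n : ℕ) (φ : (Fin n → Bool) → V) (x : Fin n → unitInterval),
    Z.IsCube n φ ∧ p = cubePoint φ x}

/-- The characteristic map of a parametrised cube. -/
noncomputable def charMap {n : ℕ} (φ : {φ : (Fin n → Bool) → V // Z.IsCube n φ})
    (x : Fin n → unitInterval) : Z.Realization :=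
  ⟨cubePoint φ.1 x, n, φ.1, x, φ.2, rfl⟩

/-- The topology of a cell complex: a set is open if and only if its preimages under all
characteristic maps of cubes are open. -/
noncomputable instance : TopologicalSpace Z.Realization :=
  ⨆ (n : ℕ) (φ : {φ : (Fin n → Bool) → V // Z.IsCube n φ}),
    TopologicalSpace.coinduced (Z.charMap φ) inferInstance

/-- The `1`-skeleton. -/
def graph : SimpleGraph V where
  Adj a b := ∃ φ, Z.IsCube 1 φ ∧ φ (fun _ => false) = a ∧ φ (fun _ => true) = b
  symm := ⟨by
    rintro a b ⟨φ, hφ, rfl, rfl⟩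
    refine ⟨φ ∘ fun ε i => !(ε i), Z.face _ ⟨Function.Embedding.refl _, ?_, ?_⟩ hφ, rfl, rfl⟩
    · intro i ε δ
      simp
    · intro w hw
      exact absurd ⟨w, rfl⟩ hw⟩
  loopless := ⟨by
    rintro a ⟨φ, hφ, h0, h1⟩
    have h := congrFun (Z.injective hφ (h0.trans h1.symm)) 0
    simp at h⟩

/-- The (unoriented) edges. -/
abbrev Edge : Type u := Z.graph.edgeSet

theorem adj_update {n : ℕ} {φ : (Fin n → Bool) → V} (hφ : Z.IsCube n φ) (ε : Fin n → Bool)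
    (i : Fin n) : Z.graph.Adj (φ ε) (φ (Function.update ε i (!(ε i)))) := by
  refine ⟨φ ∘ fun t => Function.update ε i (xor (t 0) (ε i)),
    Z.face _ ⟨⟨fun _ => i, fun a b _ => Subsingleton.elim a b⟩, ?_, ?_⟩ hφ, ?_, ?_⟩
  · intro j s t
    obtain rfl : j = 0 := Subsingleton.elim _ _
    change Function.update ε i (s 0 ^^ ε i) i = Function.update ε i (t 0 ^^ ε i) i ↔ _
    simp
  · intro k hk s t
    have : k ≠ i := fun h => hk ⟨0, h.symm⟩
    simp [Function.update_of_ne this]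
  · simp
  · simp

/-- The parametrised squares. -/
abbrev Square : Type u := {φ : (Fin 2 → Bool) → V // Z.IsCube 2 φ}

variable {Z} in
/-- The edge of a square joining the vertices `(0,0)` and `(1,0)`. -/
def Square.bottom (q : Z.Square) : Z.Edge :=
  ⟨s(q.1 ![false, false], q.1 ![true, false]), by
    have h := Z.adj_update q.2 ![false, false] 0
    have e : Function.update ![false, false] (0 : Fin 2) (!(![false, false] (0 : Fin 2)))
        = ![true, false] := by decide
    rw [e] at h
    exact h⟩

variable {Z} in
/-- The opposite edge of the square, joining the vertices `(0,1)` and `(1,1)`. -/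
def Square.top (q : Z.Square) : Z.Edge :=
  ⟨s(q.1 ![false, true], q.1 ![true, true]), by
    have h := Z.adj_update q.2 ![false, true] 0
    have e : Function.update ![false, true] (0 : Fin 2) (!(![false, true] (0 : Fin 2)))
        = ![true, true] := by decide
    rw [e] at h
    exact h⟩

/-! ### CAT(0) cube complexes -/

/-- Homotopy of edge paths with fixed endpoints: the equivalence relation generated by inserting or
deleting a backtrack and by pushing a path across a square. -/
inductive PathHomotopic : ∀ {a b : V}, Z.graph.Walk a b → Z.graph.Walk a b → Prop
  | refl {a b : V} (p : Z.graph.Walk a b) : PathHomotopic p p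
  | symm {a b : V} {p q : Z.graph.Walk a b} : PathHomotopic p q → PathHomotopic q p
  | trans {a b : V} {p q r : Z.graph.Walk a b} :
      PathHomotopic p q → PathHomotopic q r → PathHomotopic p r
  | cons {a b c : V} (h : Z.graph.Adj a b) {p q : Z.graph.Walk b c} :
      PathHomotopic p q → PathHomotopic (.cons h p) (.cons h q)
  | backtrack {a b c : V} (h : Z.graph.Adj a b) (h' : Z.graph.Adj b a) (p : Z.graph.Walk a c) :
      PathHomotopic (.cons h (.cons h' p)) p
  | square {c : V} (φ : (Fin 2 → Bool) → V) (hφ : Z.IsCube 2 φ)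
      (h₁ : Z.graph.Adj (φ ![false, false]) (φ ![true, false]))
      (h₂ : Z.graph.Adj (φ ![true, false]) (φ ![true, true]))
      (h₃ : Z.graph.Adj (φ ![false, false]) (φ ![false, true]))
      (h₄ : Z.graph.Adj (φ ![false, true]) (φ ![true, true]))
      (p : Z.graph.Walk (φ ![true, true]) c) :
      PathHomotopic (.cons h₁ (.cons h₂ p)) (.cons h₃ (.cons h₄ p))

/-- A cube complex is CAT(0) if it is non-empty, connected, simply connected (every edge loop is
null-homotopic), and satisfies Gromov's link condition: vertex links are flag simplicial complexes. -/
structure IsCAT0 : Prop where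
  connected : Z.graph.Connected
  simplyConnected : ∀ (a : V) (p : Z.graph.Walk a a), Z.PathHomotopic p .nil
  /-- A simplex of a link is determined by its vertices. -/
  link_simplicial : ∀ (n : ℕ) (φ ψ : (Fin n → Bool) → V), Z.IsCube n φ → Z.IsCube n ψ →
    φ (cubeOrigin n) = ψ (cubeOrigin n) → (∀ i, φ (cubeUnit i) = ψ (cubeUnit i)) → φ = ψ
  /-- Pairwise adjacent vertices of a link span a simplex. -/
  link_flag : ∀ (n : ℕ) (a : V) (b : Fin n → V), Function.Injective b →
    (∀ i, Z.graph.Adj a (b i)) →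
    (∀ i j, i ≠ j → ∃ φ, Z.IsCube 2 φ ∧ φ (cubeOrigin 2) = a ∧
      φ (cubeUnit 0) = b i ∧ φ (cubeUnit 1) = b j) →
    ∃ φ, Z.IsCube n φ ∧ φ (cubeOrigin n) = a ∧ ∀ i, φ (cubeUnit i) = b i

/-! ### Hyperplanes -/

/-- Parallelism of edges: the equivalence relation generated by being opposite in a square. -/
def parallelSetoid : Setoid Z.Edge :=
  Relation.EqvGen.setoid fun e f => ∃ q : Z.Square, e = q.bottom ∧ f = q.top

/-- Hyperplanes are the parallelism classes of edges. -/
def Hyperplane : Type u := Quotient Z.parallelSetoid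

variable {Z}

/-- The edges dual to a hyperplane. -/
def Hyperplane.dual (H : Z.Hyperplane) : Set (Sym2 V) :=
  {e | ∃ he : e ∈ Z.graph.edgeSet, (Quotient.mk Z.parallelSetoid ⟨e, he⟩ : Z.Hyperplane) = H}

/-- The vertices of the carrier of a hyperplane, the union of the closed cubes having an edge dual
to it. -/
def Hyperplane.carrier (H : Z.Hyperplane) : Set V :=
  {a | ∃ (n : ℕ) (φ : (Fin n → Bool) → V), Z.IsCube n φ ∧ a ∈ Set.range φ ∧
    ∃ ε i, s(φ ε, φ (Function.update ε i (!(ε i)))) ∈ H.dual}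

/-- The set of vertices in the same component as `a` after removal of the open carrier of `H`. -/
def Hyperplane.side (H : Z.Hyperplane) (a : V) : Set V :=
  {b | (Z.graph.deleteEdges H.dual).Reachable a b}

/-- The halfspaces of a hyperplane (as sets of vertices): the components of the complement of its
open carrier. -/
def Hyperplane.halfspaces (H : Z.Hyperplane) : Set (Set V) := Set.range H.side

/-- The separator `Sep(A | B)`: the hyperplanes with `A` in one halfspace and `B` in the other. -/
def Sep (Z : CubeComplex V) (A B : Set V) : Set Z.Hyperplane :=
  {H | ∃ s ∈ H.halfspaces, ∃ t ∈ H.halfspaces, s ≠ t ∧ A ⊆ s ∧ B ⊆ t}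

end CubeComplex

/-! ### Group actions -/

/-- The action of `G` on vertices is an action by combinatorial isometries (cellular
automorphisms) of the cube complex `Z`. -/
class CubicalAction (G : Type w) [Group G] {V : Type u} [MulAction G V] (Z : CubeComplex V) :
    Prop where
  smul_isCube : ∀ (g : G) {n : ℕ} {φ : (Fin n → Bool) → V}, Z.IsCube n φ →
    Z.IsCube n fun ε => g • φ ε

namespace CubeComplex

section Action

variable {G : Type w} [Group G] {V : Type u} [MulAction G V] (Z : CubeComplex V)
  [CubicalAction G Z]

theorem smul_adj (g : G) {a b : V} (h : Z.graph.Adj a b) : Z.graph.Adj (g • a) (g • b) := by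
  obtain ⟨φ, hφ, rfl, rfl⟩ := h
  exact ⟨_, CubicalAction.smul_isCube g hφ, rfl, rfl⟩

/-- The induced action on the cube complex, given on each cube by the isometry extending the
action on vertices. -/
noncomputable instance : MulAction G Z.Realization where
  smul g p := ⟨p.1.mapDomain (g • ·), by
    obtain ⟨n, φ, x, hφ, hp⟩ := p.2
    exact ⟨n, _, x, CubicalAction.smul_isCube g hφ, by rw [hp, mapDomain_cubePoint]; rfl⟩⟩
  one_smul p := Subtype.ext (by
    change p.1.mapDomain (fun a => (1 : G) • a) = p.1
    simp only [one_smul]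
    exact Finsupp.mapDomain_id)
  mul_smul g h p := Subtype.ext (by
    change p.1.mapDomain (fun a => (g * h) • a) = (p.1.mapDomain (h • ·)).mapDomain (g • ·)
    rw [← Finsupp.mapDomain_comp]
    congr 1
    funext a
    exact mul_smul g h a)

instance : MulAction G Z.Edge where
  smul g e := ⟨e.1.map (g • ·), by
    obtain ⟨e, he⟩ := e
    induction e with
    | _ a b => exact Z.smul_adj g he⟩
  one_smul e := Subtype.ext (by
    change e.1.map (fun a => (1 : G) • a) = e.1
    simp)
  mul_smul g h e := Subtype.ext (by
    change e.1.map (fun a => (g * h) • a) = (e.1.map (h • ·)).map (g • ·)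
    rw [Sym2.map_map]
    congr 1
    funext a
    exact mul_smul g h a)

theorem smul_parallel (g : G) {e f : Z.Edge} (h : Z.parallelSetoid e f) :
    Z.parallelSetoid (g • e) (g • f) := by
  change Relation.EqvGen _ _ _
  change Relation.EqvGen _ _ _ at h
  induction h with
  | rel e f h =>
    obtain ⟨q, rfl, rfl⟩ := h
    exact .rel _ _ ⟨⟨_, CubicalAction.smul_isCube g q.2⟩, rfl, rfl⟩
  | refl e => exact .refl _
  | symm e f _ ih => exact .symm _ _ ih
  | trans e f k _ _ ih₁ ih₂ => exact .trans _ _ _ ih₁ ih₂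

instance : MulAction G Z.Hyperplane where
  smul g := Quotient.map (g • ·) fun _ _ h => Z.smul_parallel g h
  one_smul H := by
    induction H using Quotient.inductionOn with
    | _ e => exact congrArg (Quotient.mk _) (one_smul G e)
  mul_smul g h H := by
    induction H using Quotient.inductionOn with
    | _ e => exact congrArg (Quotient.mk _) (mul_smul g h e)

variable {Z}

theorem smul_mem_dual (g : G) {H : Z.Hyperplane} {e : Sym2 V} (he : e ∈ H.dual) :
    e.map (g • ·) ∈ (g • H).dual := by
  obtain ⟨h, rfl⟩ := he
  exact ⟨(g • (⟨e, h⟩ : Z.Edge)).2, rfl⟩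

theorem smul_reachable (g : G) {H : Z.Hyperplane} {a b : V}
    (h : (Z.graph.deleteEdges H.dual).Reachable a b) :
    (Z.graph.deleteEdges (g • H).dual).Reachable (g • a) (g • b) := by
  refine h.map ⟨(g • ·), ?_⟩
  intro a b hab
  rw [SimpleGraph.deleteEdges_adj] at hab ⊢
  refine ⟨Z.smul_adj g hab.1, fun hm => hab.2 ?_⟩
  have := smul_mem_dual g⁻¹ hm
  simpa using this

theorem smul_side (g : G) (H : Z.Hyperplane) (a : V) : g • H.side a = (g • H).side (g • a) := by
  ext b
  rw [Set.mem_smul_set_iff_inv_smul_mem]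
  constructor
  · intro h
    simpa [Hyperplane.side] using smul_reachable g h
  · intro h
    simpa [Hyperplane.side] using smul_reachable g⁻¹ h

end Action

end CubeComplex

/-! ### Sageev's construction -/

/-- Vertices of Sageev's cube complex `X(E, W)`, where `W` indexes a set of walls of `E` and
`parts K` consists of the two parts of the wall `K`: a choice of one part for each wall, such that
the chosen parts pairwise intersect and every element of `E` belongs to all but finitely many of
them. -/
@[ext]
structure SageevVertex {E : Type u} {W : Type v} (parts : W → Set (Set E)) where
  choice : W → Set E
  choice_mem : ∀ K, choice K ∈ parts K
  inter : ∀ K L, (choice K ∩ choice L).Nonempty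
  finite : ∀ x : E, {K | x ∉ choice K}.Finite

/-- Sageev's cube complex `X(E, W)`: the `n`-cubes are the sets of `2ⁿ` distinct vertices having the
same chosen parts for all walls except `n`, one vertex for each possible choice of parts for these
`n` walls. -/
def sageev {E : Type u} {W : Type v} (parts : W → Set (Set E)) :
    CubeComplex (SageevVertex parts) where
  IsCube _ φ := IsFaceMap fun ε => (φ ε).choice
  injective := by
    rintro n φ ⟨σ, h, -⟩ ε δ hεδ
    funext i
    refine (h i ε δ).1 ?_
    change (φ ε).choice (σ i) = (φ δ).choice (σ i)
    rw [hεδ]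
  vertex v := ⟨⟨Fin.elim0, fun i => i.elim0⟩, fun i => i.elim0, fun _ _ _ _ => rfl⟩
  face := by
    rintro m n φ f ⟨τ, hf, hf'⟩ ⟨σ, h, h'⟩
    refine ⟨τ.trans σ, ?_, ?_⟩
    · intro i ε δ
      rw [← hf i]
      exact h (τ i) (f ε) (f δ)
    · intro w hw ε δ
      by_cases hwσ : w ∈ Set.range σ
      · obtain ⟨j, rfl⟩ := hwσ
        refine (h j (f ε) (f δ)).2 (hf' j ?_ ε δ)
        rintro ⟨i, rfl⟩
        exact hw ⟨i, rfl⟩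
      · exact h' w hwσ (f ε) (f δ)
  unique := by
    classical
    rintro n φ ψ ⟨σ, h, h'⟩ ⟨τ, k, k'⟩ hr
    have hmem : ∀ ε, ∃ δ, φ δ = ψ ε := fun ε => by
      have : ψ ε ∈ Set.range φ := hr ▸ ⟨ε, rfl⟩
      exact this
    choose f hf using hmem
    -- the walls of the two parametrisations agree
    have hrange : ∀ i, ∃ j, σ j = τ i := by
      intro i
      by_contra hcon
      have hi : τ i ∉ Set.range σ := fun ⟨j, hj⟩ => hcon ⟨j, hj⟩
      have h1 := h' (τ i) hi (f fun _ => false) (f fun _ => true)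
      simp only [hf] at h1
      have h2 := (k i (fun _ => false) (fun _ => true)).1 h1
      simp at h2
    choose π hπ using hrange
    have hinj : Function.Injective π := fun i j hij => τ.injective (by rw [← hπ, ← hπ, hij])
    have hsurj : Function.Surjective π := Finite.injective_iff_surjective.1 hinj
    refine ⟨f, ⟨⟨π, hinj⟩, ?_, ?_⟩, ?_⟩
    · intro i ε δ
      have h1 := h (π i) (f ε) (f δ)
      simp only [hf, hπ] at h1
      exact h1.symm.trans (k i ε δ)
    · intro w hw
      exact absurd (hsurj w) hw
    · funext ε
      exact (hf ε).symm

/-- The system of walls is preserved by an action on `E` and an action on the walls. -/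
class EquivariantParts (G : Type w) [Group G] {E : Type u} {W : Type v} [MulAction G E]
    [MulAction G W] (parts : W → Set (Set E)) : Prop where
  smul_mem : ∀ (g : G) {K : W} {s : Set E}, s ∈ parts K → g • s ∈ parts (g • K)

section SageevAction

variable {G : Type w} [Group G] {E : Type u} {W : Type v} [MulAction G E] [MulAction G W]
  (parts : W → Set (Set E)) [EquivariantParts G parts]

/-- The induced action on choices of parts: the part chosen by `g • x` for the wall `g • K` is the
translate by `g` of the part chosen by `x` for `K`. -/
instance : MulAction G (SageevVertex parts) where
  smul g x :=
    { choice := fun K => g • x.choice (g⁻¹ • K)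
      choice_mem := fun K => by
        simpa using EquivariantParts.smul_mem g (x.choice_mem (g⁻¹ • K))
      inter := fun K L => by
        rw [← Set.smul_set_inter]
        exact (x.inter _ _).smul_set
      finite := fun a => by
        refine ((x.finite (g⁻¹ • a)).image (g • ·)).subset ?_
        intro K hK
        refine ⟨g⁻¹ • K, ?_, by simp⟩
        simpa [Set.mem_smul_set_iff_inv_smul_mem] using hK }
  one_smul x := by
    ext1
    funext K
    change (1 : G) • x.choice ((1 : G)⁻¹ • K) = x.choice K
    simp
  mul_smul g h x := by
    ext1
    funext K
    change (g * h) • x.choice ((g * h)⁻¹ • K) = g • h • x.choice (h⁻¹ • g⁻¹ • K)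
    simp [mul_smul]

instance : CubicalAction G (sageev parts) where
  smul_isCube := by
    rintro g n φ ⟨σ, h, h'⟩
    refine ⟨σ.trans (MulAction.toPerm g).toEmbedding, ?_, ?_⟩
    · intro i ε δ
      change g • (φ ε).choice (g⁻¹ • g • σ i) = g • (φ δ).choice (g⁻¹ • g • σ i) ↔ _
      simp [h i ε δ]
    · intro K hK ε δ
      change g • (φ ε).choice (g⁻¹ • K) = g • (φ δ).choice (g⁻¹ • K)
      refine congrArg (g • ·) (h' (g⁻¹ • K) ?_ ε δ)
      rintro ⟨i, hi⟩
      exact hK ⟨i, by simp [hi]⟩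

end SageevAction

/-! ### Collapses -/

namespace CubeComplex

section Collapse

variable {G : Type w} [Group G] {V : Type u} [MulAction G V] {Z : CubeComplex V}
  [CubicalAction G Z]

/-- The walls retained when the `G`-invariant family `𝓗` of hyperplanes is collapsed: the
partitions of the vertex set into the halfspaces of the hyperplanes not in `𝓗`. -/
def keptParts (𝓗 : SubMulAction G Z.Hyperplane) (K : ↥(𝓗ᶜ)) : Set (Set V) := K.1.halfspaces

instance (𝓗 : SubMulAction G Z.Hyperplane) : EquivariantParts G (keptParts 𝓗) where
  smul_mem := by
    rintro g K s ⟨a, rfl⟩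
    exact ⟨g • a, (smul_side g K.1 a).symm⟩

/-- The vertices of the range of the collapse of `𝓗`. -/
abbrev CollapseVertex (𝓗 : SubMulAction G Z.Hyperplane) : Type u := SageevVertex (keptParts 𝓗)

/-- The range of the collapse of `𝓗`, the restriction quotient `X(Z, 𝔚 ∖ 𝓗)`. -/
abbrev collapseRange (𝓗 : SubMulAction G Z.Hyperplane) : CubeComplex (CollapseVertex 𝓗) :=
  sageev (keptParts 𝓗)

theorem finite_sides (hZ : Z.graph.Connected) (a b : V) : {H : Z.Hyperplane | b ∉ H.side a}.Finite := by
  classical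
  obtain ⟨p⟩ := hZ.preconnected a b
  have hfin : {H : Z.Hyperplane | ∃ e ∈ p.edges, e ∈ H.dual}.Finite := by
    have : {H : Z.Hyperplane | ∃ e ∈ p.edges, e ∈ H.dual}
        = ⋃ e ∈ {e | e ∈ p.edges}, {H : Z.Hyperplane | e ∈ H.dual} := by
      ext H
      simp
    rw [this]
    refine (List.finite_toSet p.edges).biUnion fun e _ => Set.Subsingleton.finite ?_
    rintro H ⟨h, rfl⟩ K ⟨h', rfl⟩
    rfl
  refine hfin.subset fun H hH => ?_
  by_contra hcon
  simp only [Set.mem_ofPred_eq, not_exists, not_and] at hcon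
  exact hH ⟨p.toDeleteEdges _ hcon⟩

/-- The collapse of `𝓗` on vertices: a vertex is sent to the choice of the halfspaces containing
it. -/
def collapse (hZ : Z.IsCAT0) (𝓗 : SubMulAction G Z.Hyperplane) (a : V) : CollapseVertex 𝓗 where
  choice K := K.1.side a
  choice_mem _ := ⟨a, rfl⟩
  inter _ _ := ⟨a, SimpleGraph.Reachable.refl _, SimpleGraph.Reachable.refl _⟩
  finite b := (finite_sides hZ.connected a b).preimage Subtype.val_injective.injOn

/-- The collapse on all points: `q` is the image of `p` under the extension of `collapse hZ 𝓗`
to cubes, that is, `q` is obtained from `p` by applying the collapse to the vertices in the convex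
combination `p` (on each cube this is the orthogonal projection forgetting the coordinates dual
to `𝓗`). -/
def IsCollapseImage (hZ : Z.IsCAT0) (𝓗 : SubMulAction G Z.Hyperplane) (p : Z.Realization)
    (q : (collapseRange 𝓗).Realization) : Prop :=
  q.1 = p.1.mapDomain (collapse hZ 𝓗)

/-- `𝓗` is strongly collapsible: for `H ∈ 𝓗` and `g ∉ Stab(H)`, `Sep(H | gH)` is not contained
in `𝓗`. -/
def IsStronglyCollapsible (𝓗 : SubMulAction G Z.Hyperplane) : Prop :=
  ∀ H ∈ 𝓗, ∀ g : G, g ∉ MulAction.stabilizer G H →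
    ¬ Z.Sep H.carrier (g • H).carrier ⊆ (𝓗 : Set Z.Hyperplane)

/-- The collapse of `𝓗` induces a homotopy equivalence `Z/G → Y/G` of orbit spaces. -/
def InducesHomotopyEquiv (hZ : Z.IsCAT0) (𝓗 : SubMulAction G Z.Hyperplane) : Prop :=
  ∃ h : ContinuousMap.HomotopyEquiv (Quotient (MulAction.orbitRel G Z.Realization))
      (Quotient (MulAction.orbitRel G (collapseRange 𝓗).Realization)),
    ∀ p : Z.Realization, ∃ q : (collapseRange 𝓗).Realization, IsCollapseImage hZ 𝓗 p q ∧
      h.toFun (Quotient.mk _ p) = Quotient.mk _ q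

variable (G) in
/-- The equivalence relation on the edges of `Z/G` (the `G`-orbits of edges of `Z`) generated by
being opposite edges in a square of `Z/G` that is the image of a square of `Z` in `S`. -/
def QuotientParallel (S : Set Z.Square) :
    Quotient (MulAction.orbitRel G Z.Edge) → Quotient (MulAction.orbitRel G Z.Edge) → Prop :=
  Relation.EqvGen fun a b => ∃ q ∈ S, a = Quotient.mk _ q.bottom ∧ b = Quotient.mk _ q.top

/-- The edges of the preimage in `Z/G` of a vertex `y` of `Y/G`: the images of the edges of `Z`
that are collapsed to a vertex in the orbit `y`. -/
def preimageEdges (hZ : Z.IsCAT0) (𝓗 : SubMulAction G Z.Hyperplane)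
    (y : Quotient (MulAction.orbitRel G (CollapseVertex 𝓗))) :
    Set (Quotient (MulAction.orbitRel G Z.Edge)) :=
  {a | ∃ e : Z.Edge, Quotient.mk _ e = a ∧ ∃ x : CollapseVertex 𝓗, Quotient.mk _ x = y ∧
    ∀ b ∈ e.1, collapse hZ 𝓗 b = x}

/-- The squares of `Z` that are collapsed to a vertex in the orbit `y`; their images in `Z/G` are
the squares of the preimage of `y`. -/
def preimageSquares (hZ : Z.IsCAT0) (𝓗 : SubMulAction G Z.Hyperplane)
    (y : Quotient (MulAction.orbitRel G (CollapseVertex 𝓗))) : Set Z.Square :=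
  {q | ∃ x : CollapseVertex 𝓗, Quotient.mk _ x = y ∧ ∀ ε, collapse hZ 𝓗 (q.1 ε) = x}

end Collapse

end CubeComplex

/-!
The first condition says that `G` acts freely on the vertices of `Y`, which are the fibres of the
collapse on the vertices of `Z`.

If the collapse is strong and `g` fixes a vertex `y` of `Y`, then `g` fixes every hyperplane that
separates a vertex `z` over `y` from `g • z`. Hence `g • g • z = z`, so that `g` fixes a point of
`Z`, and `g = 1`. Likewise, edges of the same fibre whose hyperplanes are in the same `G`-orbit are
dual to the same hyperplane, and a hyperplane is connected within each fibre that it meets: this is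
the second condition. Conversely, let two distinct hyperplanes `H` and `g • H` in `𝓗` be separated
by hyperplanes in `𝓗` only. They are then dual to edges of a common fibre, and these have parallel
images in `Z/G`. By the second condition, the edge dual to `H` is parallel to a translate `l • f`
of the edge `f` dual to `g • H`, and `l` fixes the vertex of `Y`. If the action on the vertices of
`Y` is free, then `l = 1`, and `H = g • H`.

If `G` acts freely on the vertices of `Y`, choosing representatives of the orbits gives an
equivariant map from the vertices of `Y` to those of `Z`. Its extension to `Y` and the straight line
homotopies from the composites to the identities require an equivariant convexity structure. It is
obtained by retracting the simplex spanned by all vertices, that is, the finitely supported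
probability measures, onto the cube complex by formulas that depend on the walls only. Conversely, a
path in `Z` from `z` to `g • z` has a closed image in the contractible complex `Y` if `g` fixes the
image of `z`. Its image in `Z/G` is then a loop that becomes null-homotopic in `Y/G`. If the
induced map is a homotopy equivalence, the loop is null-homotopic in `Z/G`, so its lift to the
covering `Z` is closed, and `g = 1`.
-/

namespace CubeComplex

/-! ### Squares and the link condition -/

/-- The vertex of the `n`-cube adjacent to `ε` in the direction of the `i`-th coordinate. -/
def flipAt {n : ℕ} (ε : Fin n → Bool) (i : Fin n) : Fin n → Bool :=
  Function.update ε i (!(ε i))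

theorem flipAt_flipAt {n : ℕ} (ε : Fin n → Bool) (i : Fin n) : flipAt (flipAt ε i) i = ε := by
  simp [flipAt]

theorem flipAt_comm {n : ℕ} (ε : Fin n → Bool) {i j : Fin n} (h : i ≠ j) :
    flipAt (flipAt ε i) j = flipAt (flipAt ε j) i := by
  unfold flipAt
  rw [Function.update_of_ne h, Function.update_of_ne h.symm, Function.update_comm h]

theorem forall_of_flipAt {n : ℕ} {p : (Fin n → Bool) → Prop} (s : Finset (Fin n))
    (h : ∀ ε, ∀ i ∈ s, p ε → p (flipAt ε i)) (ε δ : Fin n → Bool)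
    (hs : ∀ i, i ∉ s → ε i = δ i) (hε : p ε) : p δ := by
  induction s using Finset.induction_on generalizing ε with
  | empty =>
    obtain rfl : ε = δ := funext fun i => hs i (by simp)
    exact hε
  | insert i s hi ih =>
    have ih' := ih (fun ε j hj => h ε j (Finset.mem_insert_of_mem hj))
    by_cases he : ε i = δ i
    · refine ih' ε (fun j hj => ?_) hε
      by_cases hji : j = i
      · rw [hji, he]
      · exact hs j (by simp [hji, hj])
    · refine ih' (flipAt ε i) (fun j hj => ?_) (h ε i (Finset.mem_insert_self i s) hε)
      by_cases hji : j = i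
      · subst hji
        simp only [flipAt, Function.update_self]
        revert he
        cases ε j <;> cases δ j <;> simp
      · rw [flipAt, Function.update_of_ne hji]
        exact hs j (by simp [hji, hj])

section CAT0

variable {V : Type u} (Z : CubeComplex V)

/-- `a, b, c, d` are the vertices, in cyclic order, of a square of `Z`. -/
def Sq (a b c d : V) : Prop :=
  ∃ φ, Z.IsCube 2 φ ∧ φ ![false, false] = a ∧ φ ![true, false] = b ∧ φ ![true, true] = c ∧
    φ ![false, true] = d

variable {Z}

theorem IsCube.sq {n : ℕ} {φ : (Fin n → Bool) → V} (hφ : Z.IsCube n φ) (ε : Fin n → Bool)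
    {i j : Fin n} (hij : i ≠ j) :
    Z.Sq (φ ε) (φ (flipAt ε i)) (φ (flipAt (flipAt ε i) j)) (φ (flipAt ε j)) := by
  refine ⟨φ ∘ fun t k => if k = i then xor (ε i) (t 0) else if k = j then xor (ε j) (t 1) else ε k,
    Z.face _ ⟨⟨![i, j], ?_⟩, ?_, ?_⟩ hφ, ?_, ?_, ?_, ?_⟩
  · intro a b hab
    fin_cases a <;> fin_cases b <;> simp_all
  · intro k s t
    fin_cases k
    · change ((if i = i then _ else _) = if i = i then _ else _) ↔ _
      simp
    · change ((if j = i then _ else if j = j then _ else _) =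
        if j = i then _ else if j = j then _ else _) ↔ _
      simp [hij.symm]
  · intro k hk s t
    have hki : k ≠ i := fun h => hk ⟨0, h.symm⟩
    have hkj : k ≠ j := fun h => hk ⟨1, h.symm⟩
    simp [hki, hkj]
  all_goals
    refine congrArg φ (funext fun k => ?_)
    by_cases hki : k = i
    · subst hki
      simp [flipAt, hij]
    · by_cases hkj : k = j
      · subst hkj
        simp [flipAt, hki]
      · simp [flipAt, hki, hkj]

theorem IsCube.sq_of_flipAt_eq {n : ℕ} {φ : (Fin n → Bool) → V} (hφ : Z.IsCube n φ)
    {i j : Fin n} (hij : i ≠ j) {ε δ ζ η : Fin n → Bool} (hδ : flipAt ε i = δ)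
    (hζ : flipAt δ j = ζ) (hη : flipAt ε j = η) : Z.Sq (φ ε) (φ δ) (φ ζ) (φ η) := by
  subst hδ hζ hη
  exact hφ.sq ε hij

theorem Sq.rotate {a b c d : V} (h : Z.Sq a b c d) : Z.Sq b c d a := by
  obtain ⟨φ, hφ, rfl, rfl, rfl, rfl⟩ := h
  exact hφ.sq_of_flipAt_eq (i := 1) (j := 0) (by decide) (by decide) (by decide) (by decide)

theorem Sq.reflect {a b c d : V} (h : Z.Sq a b c d) : Z.Sq a d c b := by
  obtain ⟨φ, hφ, rfl, rfl, rfl, rfl⟩ := h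
  exact hφ.sq_of_flipAt_eq (i := 1) (j := 0) (by decide) (by decide) (by decide) (by decide)

theorem Sq.adj {a b c d : V} (h : Z.Sq a b c d) : Z.graph.Adj a b := by
  obtain ⟨φ, hφ, rfl, rfl, rfl, rfl⟩ := h
  have hstep : flipAt ![false, false] (0 : Fin 2) = ![true, false] := by decide
  exact hstep ▸ Z.adj_update hφ ![false, false] 0

theorem Sq.ne {a b c d : V} (h : Z.Sq a b c d) : b ≠ d := by
  obtain ⟨φ, hφ, rfl, rfl, rfl, rfl⟩ := h
  exact fun h => absurd (Z.injective hφ h) (by decide)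

theorem Sq.exists_corner {a b c d : V} (h : Z.Sq a b c d) : ∃ φ, Z.IsCube 2 φ ∧
    φ (cubeOrigin 2) = a ∧ φ (cubeUnit 0) = b ∧ φ (cubeUnit 1) = d ∧ φ ![true, true] = c := by
  obtain ⟨φ, hφ, rfl, rfl, rfl, rfl⟩ := h
  exact ⟨φ, hφ, congrArg φ (by decide), congrArg φ (by decide), congrArg φ (by decide), rfl⟩

variable (Z) in
/-- Gromov's link condition: vertex links are flag simplicial complexes. This is the local part of
`IsCAT0`. -/
structure IsNonposCurved : Prop where
  link_simplicial : ∀ (n : ℕ) (φ ψ : (Fin n → Bool) → V), Z.IsCube n φ → Z.IsCube n ψ →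
    φ (cubeOrigin n) = ψ (cubeOrigin n) → (∀ i, φ (cubeUnit i) = ψ (cubeUnit i)) → φ = ψ
  link_flag : ∀ (n : ℕ) (a : V) (b : Fin n → V), Function.Injective b →
    (∀ i, Z.graph.Adj a (b i)) →
    (∀ i j, i ≠ j → ∃ φ, Z.IsCube 2 φ ∧ φ (cubeOrigin 2) = a ∧
      φ (cubeUnit 0) = b i ∧ φ (cubeUnit 1) = b j) →
    ∃ φ, Z.IsCube n φ ∧ φ (cubeOrigin n) = a ∧ ∀ i, φ (cubeUnit i) = b i

theorem IsCAT0.isNonposCurved (hZ : Z.IsCAT0) : Z.IsNonposCurved :=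
  ⟨hZ.link_simplicial, hZ.link_flag⟩

theorem Sq.unique (hZ : Z.IsNonposCurved) {a b c c' d : V} (h : Z.Sq a b c d)
    (h' : Z.Sq a b c' d) : c = c' := by
  obtain ⟨φ, hφ, hφa, hφb, hφd, rfl⟩ := h.exists_corner
  obtain ⟨ψ, hψ, hψa, hψb, hψd, rfl⟩ := h'.exists_corner
  have hunit : ∀ i : Fin 2, φ (cubeUnit i) = ψ (cubeUnit i) :=
    Fin.forall_fin_two.2 ⟨hφb.trans hψb.symm, hφd.trans hψd.symm⟩
  rw [hZ.link_simplicial 2 φ ψ hφ hψ (hφa.trans hψa.symm) hunit]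

theorem Sq.exists_cube_three (hZ : Z.IsNonposCurved) {a x y z p q r : V} (hxy : Z.Sq a x p y)
    (hyz : Z.Sq a y q z) (hzx : Z.Sq a z r x) :
    ∃ φ, Z.IsCube 3 φ ∧ φ ![false, false, false] = a ∧ φ ![true, false, false] = x ∧
      φ ![false, true, false] = y ∧ φ ![false, false, true] = z := by
  have hinj : Function.Injective ![x, y, z] := by
    have := hxy.ne
    have := hyz.ne
    have := hzx.ne
    intro i j hij
    fin_cases i <;> fin_cases j <;> simp_all
  have hadj : ∀ i, Z.graph.Adj a (![x, y, z] i) := by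
    intro i
    fin_cases i
    exacts [hxy.adj, hyz.adj, hzx.adj]
  have hcorner : ∀ i j, i ≠ j → ∃ c, Z.Sq a (![x, y, z] i) c (![x, y, z] j) := by
    intro i j hij
    fin_cases i <;> fin_cases j
    exacts [absurd rfl hij, ⟨p, hxy⟩, ⟨r, hzx.reflect⟩, ⟨p, hxy.reflect⟩, absurd rfl hij,
      ⟨q, hyz⟩, ⟨r, hzx⟩, ⟨q, hyz.reflect⟩, absurd rfl hij]
  obtain ⟨φ, hφ, ha, hunit⟩ := hZ.link_flag 3 a ![x, y, z] hinj hadj fun i j hij => by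
    obtain ⟨c, hc⟩ := hcorner i j hij
    obtain ⟨ψ, hψ, hψa, hψi, hψj, -⟩ := hc.exists_corner
    exact ⟨ψ, hψ, hψa, hψi, hψj⟩
  exact ⟨φ, hφ, (congrArg φ (by decide)).trans ha, (congrArg φ (by decide)).trans (hunit 0),
    (congrArg φ (by decide)).trans (hunit 1), (congrArg φ (by decide)).trans (hunit 2)⟩

theorem Sq.exists_opposite (hZ : Z.IsNonposCurved) {a x y z p q r : V} (hxy : Z.Sq a x p y)
    (hyz : Z.Sq a y q z) (hzx : Z.Sq a z r x) :
    ∃ t, Z.Sq x p t r ∧ Z.Sq y q t p ∧ Z.Sq z r t q := by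
  obtain ⟨φ, hφ, rfl, rfl, rfl, rfl⟩ := Sq.exists_cube_three hZ hxy hyz hzx
  obtain rfl : φ ![true, true, false] = p := Sq.unique hZ
    (hφ.sq_of_flipAt_eq (i := 0) (j := 1) (by decide) (by decide) (by decide) (by decide)) hxy
  obtain rfl : φ ![false, true, true] = q := Sq.unique hZ
    (hφ.sq_of_flipAt_eq (i := 1) (j := 2) (by decide) (by decide) (by decide) (by decide)) hyz
  obtain rfl : φ ![true, false, true] = r := Sq.unique hZ
    (hφ.sq_of_flipAt_eq (i := 2) (j := 0) (by decide) (by decide) (by decide) (by decide)) hzx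
  refine ⟨φ ![true, true, true], ?_, ?_, ?_⟩
  · exact hφ.sq_of_flipAt_eq (i := 1) (j := 2) (by decide) (by decide) (by decide) (by decide)
  · exact hφ.sq_of_flipAt_eq (i := 2) (j := 0) (by decide) (by decide) (by decide) (by decide)
  · exact hφ.sq_of_flipAt_eq (i := 0) (j := 1) (by decide) (by decide) (by decide) (by decide)

/-! ### Flips of edge paths -/

variable (Z) in
/-- Flip equivalence of edge paths: the equivalence relation generated by pushing a path across a
square. Unlike `PathHomotopic` it does not allow backtracks, so it preserves length. -/
inductive Flip : ∀ {a b : V}, Z.graph.Walk a b → Z.graph.Walk a b → Prop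
  | refl {a b : V} (p : Z.graph.Walk a b) : Flip p p
  | symm {a b : V} {p q : Z.graph.Walk a b} : Flip p q → Flip q p
  | trans {a b : V} {p q r : Z.graph.Walk a b} : Flip p q → Flip q r → Flip p r
  | cons {a b c : V} (h : Z.graph.Adj a b) {p q : Z.graph.Walk b c} :
      Flip p q → Flip (.cons h p) (.cons h q)
  | square {a b c d e : V} (s : Z.Sq a b c d) (h₁ : Z.graph.Adj a b) (h₂ : Z.graph.Adj b c)
      (h₃ : Z.graph.Adj a d) (h₄ : Z.graph.Adj d c) (p : Z.graph.Walk c e) :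
      Flip (.cons h₁ (.cons h₂ p)) (.cons h₃ (.cons h₄ p))

theorem Flip.length_eq {a b : V} {p q : Z.graph.Walk a b} (h : Z.Flip p q) :
    p.length = q.length := by
  induction h with
  | refl => rfl
  | symm _ ih => exact ih.symm
  | trans _ _ ih₁ ih₂ => exact ih₁.trans ih₂
  | cons h _ ih => simp [ih]
  | square => simp

/-- Two paths with the same endpoints either have flip equivalent tails after a common first step,
or their first steps span a square and their tails are flip equivalent to paths through the fourth
vertex of that square. -/
inductive Diamond : ∀ {a b : V}, Z.graph.Walk a b → Z.graph.Walk a b → Prop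
  | nil {a : V} : Diamond (.nil : Z.graph.Walk a a) .nil
  | tail {a b c : V} (h h' : Z.graph.Adj a b) {p q : Z.graph.Walk b c} (hpq : Z.Flip p q) :
      Diamond (.cons h p) (.cons h' q)
  | square {a b c d e : V} (s : Z.Sq a b c d) (h₁ : Z.graph.Adj a b) (h₂ : Z.graph.Adj b c)
      (h₃ : Z.graph.Adj a d) (h₄ : Z.graph.Adj d c) {p : Z.graph.Walk b e} {q : Z.graph.Walk d e}
      (r : Z.graph.Walk c e) (hp : Z.Flip p (.cons h₂ r)) (hq : Z.Flip q (.cons h₄ r)) :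
      Diamond (.cons h₁ p) (.cons h₃ q)

theorem Diamond.symm {a b : V} {p q : Z.graph.Walk a b} (h : Diamond p q) : Diamond q p := by
  cases h with
  | nil => exact .nil
  | tail h h' hpq => exact .tail h' h hpq.symm
  | square s h₁ h₂ h₃ h₄ r hp hq => exact .square s.reflect h₃ h₄ h₁ h₂ r hq hp

theorem Diamond.trans (hZ : Z.IsNonposCurved) {a e : V} {p q r : Z.graph.Walk a e}
    (ih : ∀ (b : V) (p' q' : Z.graph.Walk b e), p'.length < q.length → Z.Flip p' q' →
      Diamond p' q')
    (h : Diamond p q) (h' : Diamond q r) : Diamond p r := by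
  cases h with
  | nil => exact h'
  | @tail _ b k₁ k₂ p₀ q₀ hpq =>
    cases h' with
    | tail _ k₃ hqr => exact .tail k₁ k₃ (hpq.trans hqr)
    | square s _ h₂ h₃ h₄ t hq hr => exact .square s k₁ h₂ h₃ h₄ t (hpq.trans hq) hr
  | @square b c d _ s h₁ h₂ h₃ h₄ p₀ q₀ t hp hq =>
    cases h' with
    | tail _ k₃ hqr => exact .square s h₁ h₂ k₃ h₄ t hp (hqr.symm.trans hq)
    | @square _ c' d' _ s' _ k₂ k₃ k₄ _ r₀ t' hq' hr =>
      have hdi := ih d _ _ (by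
        have := hq.length_eq
        simp only [SimpleGraph.Walk.length_cons] at this ⊢
        omega) (hq.symm.trans hq')
      cases hdi with
      | tail _ _ htt =>
        obtain rfl : b = d' := Sq.unique hZ s.rotate.rotate.rotate s'.rotate.reflect
        exact .tail h₁ k₃ (hp.trans ((Flip.cons h₂ htt).trans hr.symm))
      | @square _ f _ _ s'' _ m₂ _ m₄ _ _ x hx hx' =>
        obtain ⟨y, y₁, y₂, y₃⟩ := Sq.exists_opposite hZ s.rotate.rotate.rotate s'' s'.rotate
        have hby := y₁.rotate.adj
        have hyf := y₂.rotate.adj.symm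
        have hd'y := y₃.rotate.adj
        refine .square y₁ h₁ hby k₃ hd'y (.cons hyf x) ?_ ?_
        · exact hp.trans ((Flip.cons h₂ hx).trans
            (.square y₂.rotate.rotate.rotate h₂ m₂ hby hyf x))
        · exact hr.trans ((Flip.cons k₄ hx').trans
            (.square y₃.reflect.rotate.rotate.rotate k₄ m₄ hd'y hyf x))

theorem Flip.diamond (hZ : Z.IsNonposCurved) {a e : V} {p q : Z.graph.Walk a e} (h : Z.Flip p q) :
    Diamond p q := by
  obtain ⟨n, hn⟩ : ∃ n, p.length = n := ⟨_, rfl⟩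
  induction n using Nat.strong_induction_on generalizing a e p q with
  | _ n ihn =>
    induction h with
    | refl p' =>
      cases p' with
      | nil => exact .nil
      | cons h p' => exact .tail h h (.refl _)
    | symm h ih => exact (ih (h.length_eq.trans hn)).symm
    | trans h₁ _ ih₁ ih₂ =>
      have hn' := h₁.length_eq.symm.trans hn
      exact Diamond.trans hZ (fun b p'' q'' hlt hf => ihn _ (hn' ▸ hlt) hf rfl) (ih₁ hn)
        (ih₂ hn')
    | cons h hpq _ => exact .tail h h hpq
    | square s h₁ h₂ h₃ h₄ p => exact .square s h₁ h₂ h₃ h₄ p (.refl _) (.refl _)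

theorem Flip.of_cons (hZ : Z.IsNonposCurved) {a b e : V} {h h' : Z.graph.Adj a b}
    {p q : Z.graph.Walk b e} (hpq : Z.Flip (.cons h p) (.cons h' q)) : Z.Flip p q := by
  cases hpq.diamond hZ with
  | tail _ _ hpq => exact hpq
  | square s => exact absurd rfl s.ne

theorem Flip.exists_square (hZ : Z.IsNonposCurved) {a b d e : V} {h₁ : Z.graph.Adj a b}
    {h₃ : Z.graph.Adj a d} {p : Z.graph.Walk b e} {q : Z.graph.Walk d e} (hbd : b ≠ d)
    (hpq : Z.Flip (.cons h₁ p) (.cons h₃ q)) :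
    ∃ c, Z.Sq a b c d ∧ ∃ (h₂ : Z.graph.Adj b c) (h₄ : Z.graph.Adj d c) (r : Z.graph.Walk c e),
      Z.Flip p (.cons h₂ r) ∧ Z.Flip q (.cons h₄ r) := by
  cases hpq.diamond hZ with
  | tail _ _ hpq => exact absurd rfl hbd
  | @square _ c _ _ s _ h₂ _ h₄ _ _ r hp hq => exact ⟨c, s, h₂, h₄, r, hp, hq⟩

/-- The path `p` is flip equivalent to a path with first edge `h`. -/
def StartsWith {a b e : V} (p : Z.graph.Walk a e) (h : Z.graph.Adj a b) : Prop :=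
  ∃ r : Z.graph.Walk b e, Z.Flip p (.cons h r)

theorem StartsWith.congr {a b e : V} {p q : Z.graph.Walk a e} {h : Z.graph.Adj a b}
    (hpq : Z.Flip p q) (hp : StartsWith p h) : StartsWith q h := by
  obtain ⟨r, hr⟩ := hp
  exact ⟨r, hpq.symm.trans hr⟩

/-- A path is reduced if no path that is flip equivalent to it has a backtrack. By recursion on the
path, this says that no suffix can be flipped to start by undoing the edge before it. -/
def Reduced : ∀ {a e : V}, Z.graph.Walk a e → Prop
  | _, _, .nil => True
  | _, _, .cons h p => Reduced p ∧ ¬ StartsWith p h.symm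

theorem Sq.startsWith_cons_iff (hZ : Z.IsNonposCurved) {a b c d e : V} (s : Z.Sq a b c d)
    (h₁ : Z.graph.Adj b a) (h₂ : Z.graph.Adj b c) (h₄ : Z.graph.Adj c d)
    (p : Z.graph.Walk c e) : StartsWith (.cons h₂ p) h₁ ↔ StartsWith p h₄ := by
  constructor
  · rintro ⟨r, hr⟩
    obtain ⟨x, sx, k₂, k₄, t, hp, -⟩ := hr.exists_square hZ s.rotate.ne
    obtain rfl : x = d := Sq.unique hZ sx s.rotate
    exact ⟨t, hp⟩
  · rintro ⟨r, hr⟩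
    have hda := s.rotate.rotate.rotate.adj
    exact ⟨.cons hda.symm r, (hr.cons h₂).trans
      (.square s.rotate h₂ h₄ h₁ hda.symm r)⟩

theorem Reduced.square (hZ : Z.IsNonposCurved) {a b c d e : V} (s : Z.Sq a b c d)
    {h₁ : Z.graph.Adj a b} {h₂ : Z.graph.Adj b c} (h₃ : Z.graph.Adj a d)
    (h₄ : Z.graph.Adj d c) {p : Z.graph.Walk c e}
    (hp : Reduced (.cons h₁ (.cons h₂ p))) : Reduced (.cons h₃ (.cons h₄ p)) := by
  obtain ⟨⟨h0, hb⟩, ha⟩ := hp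
  refine ⟨⟨h0, ?_⟩, ?_⟩
  · rwa [Sq.startsWith_cons_iff hZ s h₁.symm h₂ h₄.symm] at ha
  · rwa [Sq.startsWith_cons_iff hZ s.reflect h₃.symm h₄ h₂.symm]

theorem Flip.reduced_iff (hZ : Z.IsNonposCurved) {a b : V} {p q : Z.graph.Walk a b}
    (h : Z.Flip p q) : Reduced p ↔ Reduced q := by
  induction h with
  | refl p => exact Iff.rfl
  | symm _ ih => exact ih.symm
  | trans _ _ ih₁ ih₂ => exact ih₁.trans ih₂
  | cons h hpq ih =>
    exact and_congr ih (not_congr ⟨StartsWith.congr hpq, StartsWith.congr hpq.symm⟩)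
  | square s h₁ h₂ h₃ h₄ p => exact ⟨.square hZ s h₃ h₄, .square hZ s.reflect h₁ h₂⟩

open Classical in
/-- Prepend an edge to a path, cancelling it if the path is flip equivalent to one starting with
the inverse edge. It is well defined up to flip equivalence. -/
noncomputable def prepend {a b e : V} (h : Z.graph.Adj a b) (p : Z.graph.Walk b e) :
    Z.graph.Walk a e :=
  if hp : StartsWith p h.symm then hp.choose else .cons h p

theorem flip_prepend_of_flip_cons (hZ : Z.IsNonposCurved) {a b e : V} {h : Z.graph.Adj a b}
    {p : Z.graph.Walk b e} {r : Z.graph.Walk a e} (hr : Z.Flip p (.cons h.symm r)) :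
    Z.Flip (prepend h p) r := by
  have hp : StartsWith p h.symm := ⟨r, hr⟩
  rw [prepend, dif_pos hp]
  exact (hp.choose_spec.symm.trans hr).of_cons hZ

theorem prepend_of_not_startsWith {a b e : V} {h : Z.graph.Adj a b}
    {p : Z.graph.Walk b e} (hp : ¬ StartsWith p h.symm) : prepend h p = .cons h p :=
  dif_neg hp

theorem Flip.prepend_congr (hZ : Z.IsNonposCurved) {a b e : V} (h : Z.graph.Adj a b)
    {p q : Z.graph.Walk b e} (hpq : Z.Flip p q) :
    Z.Flip (prepend h p) (prepend h q) := by
  by_cases hp : StartsWith p h.symm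
  · obtain ⟨r, hr⟩ := hp
    exact (flip_prepend_of_flip_cons hZ hr).trans
      (flip_prepend_of_flip_cons hZ (hpq.symm.trans hr)).symm
  · rw [prepend_of_not_startsWith hp, prepend_of_not_startsWith fun hq => hp (hq.congr hpq.symm)]
    exact hpq.cons h

theorem Reduced.reduced_prepend (hZ : Z.IsNonposCurved) {a b e : V} (h : Z.graph.Adj a b)
    {p : Z.graph.Walk b e} (hp : Reduced p) : Reduced (prepend h p) := by
  by_cases hs : StartsWith p h.symm
  · obtain ⟨r, hr⟩ := hs
    exact ((flip_prepend_of_flip_cons hZ hr).reduced_iff hZ).2 ((hr.reduced_iff hZ).1 hp).1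
  · rw [prepend_of_not_startsWith hs]
    exact ⟨hp, hs⟩

theorem Reduced.flip_prepend_prepend (hZ : Z.IsNonposCurved) {a b e : V} (h : Z.graph.Adj a b)
    (h' : Z.graph.Adj b a) {p : Z.graph.Walk a e} (hp : Reduced p) :
    Z.Flip (prepend h (prepend h' p)) p := by
  by_cases hs : StartsWith p h'.symm
  · obtain ⟨r, hr⟩ := hs
    have hred := (hr.reduced_iff hZ).1 hp
    have h1 := flip_prepend_of_flip_cons (h := h') hZ hr
    refine (h1.prepend_congr hZ h).trans ?_
    rw [prepend_of_not_startsWith hred.2]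
    exact hr.symm
  · rw [prepend_of_not_startsWith hs]
    exact flip_prepend_of_flip_cons hZ (.refl _)

theorem flip_prepend_square_of_startsWith (hZ : Z.IsNonposCurved) {a b c d e : V} (s : Z.Sq a b c d)
    (h₁ : Z.graph.Adj a b) (h₂ : Z.graph.Adj b c) (h₃ : Z.graph.Adj a d)
    (h₄ : Z.graph.Adj d c) {p : Z.graph.Walk c e}
    (hb : StartsWith p h₂.symm) (hd : ¬ StartsWith p h₄.symm) :
    Z.Flip (prepend h₁ (prepend h₂ p)) (prepend h₃ (prepend h₄ p)) := by
  obtain ⟨r, hr⟩ := hb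
  have hb' : ¬ StartsWith r h₁.symm := by
    rw [← Sq.startsWith_cons_iff hZ s.rotate.rotate.rotate.reflect h₄.symm h₂.symm h₁.symm]
    exact fun h => hd (h.congr hr.symm)
  refine ((flip_prepend_of_flip_cons hZ hr).prepend_congr hZ h₁).trans ?_
  rw [prepend_of_not_startsWith hb', prepend_of_not_startsWith hd]
  refine (flip_prepend_of_flip_cons hZ ((hr.cons h₄).trans ?_)).symm
  exact .square s.rotate.rotate.rotate.reflect h₄ h₂.symm h₃.symm h₁ r

theorem flip_prepend_square (hZ : Z.IsNonposCurved) {a b c d e : V} (s : Z.Sq a b c d)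
    (h₁ : Z.graph.Adj a b) (h₂ : Z.graph.Adj b c) (h₃ : Z.graph.Adj a d)
    (h₄ : Z.graph.Adj d c) {p : Z.graph.Walk c e} :
    Z.Flip (prepend h₁ (prepend h₂ p)) (prepend h₃ (prepend h₄ p)) := by
  by_cases hb : StartsWith p h₂.symm
  · by_cases hd : StartsWith p h₄.symm
    · obtain ⟨r, hr⟩ := hb
      obtain ⟨r', hr'⟩ := hd
      obtain ⟨x, sx, k₁, k₃, t, ht, ht'⟩ := (hr.symm.trans hr').exists_square hZ s.ne
      obtain rfl : x = a := Sq.unique hZ sx s.rotate.rotate.reflect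
      have hbt : Z.Flip (prepend h₁ (prepend h₂ p)) t :=
        ((flip_prepend_of_flip_cons hZ hr).prepend_congr hZ h₁).trans
          (flip_prepend_of_flip_cons hZ ht)
      have hdt : Z.Flip (prepend h₃ (prepend h₄ p)) t :=
        ((flip_prepend_of_flip_cons hZ hr').prepend_congr hZ h₃).trans
          (flip_prepend_of_flip_cons hZ ht')
      exact hbt.trans hdt.symm
    · exact flip_prepend_square_of_startsWith hZ s h₁ h₂ h₃ h₄ hb hd
  · by_cases hd : StartsWith p h₄.symm
    · exact (flip_prepend_square_of_startsWith hZ s.reflect h₃ h₄ h₁ h₂ hd hb).symm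
    · rw [prepend_of_not_startsWith hb, prepend_of_not_startsWith hd,
        prepend_of_not_startsWith, prepend_of_not_startsWith]
      · exact .square s h₁ h₂ h₃ h₄ p
      · rwa [Sq.startsWith_cons_iff hZ s.reflect h₃.symm h₄ h₂.symm]
      · rwa [Sq.startsWith_cons_iff hZ s h₁.symm h₂ h₄.symm]

/-- The reduced form of a path, obtained by prepending its edges one at a time. Its flip class
depends only on the homotopy class of the path. -/
noncomputable def reduction : ∀ {a e : V}, Z.graph.Walk a e → Z.graph.Walk a e
  | _, _, .nil => .nil
  | _, _, .cons h p => prepend h (reduction p)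

theorem reduced_reduction (hZ : Z.IsNonposCurved) {a e : V} (p : Z.graph.Walk a e) :
    Reduced (reduction p) := by
  induction p with
  | nil => trivial
  | cons h p ih => exact ih.reduced_prepend hZ h

theorem PathHomotopic.flip_reduction (hZ : Z.IsNonposCurved) {a e : V} {p q : Z.graph.Walk a e}
    (h : Z.PathHomotopic p q) : Z.Flip (reduction p) (reduction q) := by
  induction h with
  | refl p => exact .refl _
  | symm _ ih => exact ih.symm
  | trans _ _ ih₁ ih₂ => exact ih₁.trans ih₂
  | cons h _ ih => exact ih.prepend_congr hZ h
  | backtrack h h' p => exact (reduced_reduction hZ p).flip_prepend_prepend hZ h h'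
  | square φ hφ h₁ h₂ h₃ h₄ p =>
    exact flip_prepend_square hZ ⟨φ, hφ, rfl, rfl, rfl, rfl⟩ h₁ h₂ h₃ h₄

theorem Reduced.flip_reduction {a e : V} {p : Z.graph.Walk a e}
    (hp : Reduced p) : Z.Flip (reduction p) p := by
  induction p with
  | nil => exact .refl _
  | cons h p ih =>
    have := ih hp.1
    change Z.Flip (prepend h (reduction p)) _
    rw [prepend_of_not_startsWith fun hs => hp.2 (hs.congr this)]
    exact this.cons h

/-! ### The graph metric -/

theorem PathHomotopic.append_left {a b c : V} (p : Z.graph.Walk a b) {q r : Z.graph.Walk b c}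
    (h : Z.PathHomotopic q r) : Z.PathHomotopic (p.append q) (p.append r) := by
  induction p with
  | nil => exact h
  | cons k p ih => exact .cons k (ih h)

theorem PathHomotopic.append_right {a b c : V} {p q : Z.graph.Walk a b}
    (h : Z.PathHomotopic p q) (r : Z.graph.Walk b c) :
    Z.PathHomotopic (p.append r) (q.append r) := by
  induction h with
  | refl p => exact .refl _
  | symm _ ih => exact (ih r).symm
  | trans _ _ ih₁ ih₂ => exact (ih₁ r).trans (ih₂ r)
  | cons h _ ih => exact .cons h (ih r)
  | backtrack h h' p => exact .backtrack h h' _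
  | square φ hφ h₁ h₂ h₃ h₄ p => exact .square φ hφ h₁ h₂ h₃ h₄ _

theorem PathHomotopic.reverse_append_self {a b : V} (p : Z.graph.Walk a b) :
    Z.PathHomotopic (p.reverse.append p) .nil := by
  induction p with
  | nil => exact .refl _
  | cons h p ih =>
    rw [SimpleGraph.Walk.reverse_cons, ← SimpleGraph.Walk.append_assoc]
    exact (PathHomotopic.append_left _ (.backtrack _ _ _)).trans ih

theorem IsCAT0.pathHomotopic (hZ : Z.IsCAT0) {a b : V} (p q : Z.graph.Walk a b) :
    Z.PathHomotopic p q := by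
  have hcancel := (PathHomotopic.reverse_append_self q).append_left p
  rw [SimpleGraph.Walk.append_nil, SimpleGraph.Walk.append_assoc] at hcancel
  exact hcancel.symm.trans ((hZ.simplyConnected a (p.append q.reverse)).append_right q)

theorem Reduced.flip (hZ : Z.IsCAT0) {a b : V} {p q : Z.graph.Walk a b} (hp : Reduced p)
    (hq : Reduced q) : Z.Flip p q :=
  (hp.flip_reduction.symm.trans ((hZ.pathHomotopic p q).flip_reduction hZ.isNonposCurved)).trans
    hq.flip_reduction

theorem reduced_of_length_eq_dist {a b : V} {p : Z.graph.Walk a b}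
    (h : p.length = Z.graph.dist a b) : Reduced p := by
  induction p with
  | nil => trivial
  | @cons a c b k p ih =>
    rw [SimpleGraph.Walk.length_cons] at h
    refine ⟨ih (le_antisymm ?_ (SimpleGraph.dist_le p)), ?_⟩
    · obtain ⟨q, hq⟩ := p.reachable.exists_walk_length_eq_dist
      have := SimpleGraph.dist_le (SimpleGraph.Walk.cons k q)
      rw [SimpleGraph.Walk.length_cons] at this
      omega
    · rintro ⟨r, hr⟩
      have h1 := hr.length_eq
      have h2 := SimpleGraph.dist_le r
      rw [SimpleGraph.Walk.length_cons] at h1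
      omega

theorem PathHomotopic.even_length_iff {a b : V} {p q : Z.graph.Walk a b}
    (h : Z.PathHomotopic p q) : Even p.length ↔ Even q.length := by
  induction h with
  | refl => rfl
  | symm _ ih => exact ih.symm
  | trans _ _ ih₁ ih₂ => exact ih₁.trans ih₂
  | cons _ _ ih => simp only [SimpleGraph.Walk.length_cons, Nat.even_add_one, ih]
  | backtrack | square => simp only [SimpleGraph.Walk.length_cons, Nat.even_add_one, not_not]

/- The graph is bipartite, because homotopies preserve the parity of the length. -/
theorem IsCAT0.dist_eq_add_one_or (hZ : Z.IsCAT0) {a b : V} (h : Z.graph.Adj a b) (v : V) :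
    Z.graph.dist v a = Z.graph.dist v b + 1 ∨ Z.graph.dist v b = Z.graph.dist v a + 1 := by
  obtain ⟨p, hp⟩ := (hZ.connected v a).exists_walk_length_eq_dist
  obtain ⟨q, hq⟩ := (hZ.connected v b).exists_walk_length_eq_dist
  have hparity := (hZ.pathHomotopic (p.concat h) q).even_length_iff
  rw [SimpleGraph.Walk.length_concat, hp, hq, Nat.even_add_one] at hparity
  have hne : Z.graph.dist v a ≠ Z.graph.dist v b := fun heq => by
    rw [heq] at hparity
    exact not_iff_self hparity
  have hb := SimpleGraph.dist_le (p.concat h)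
  have ha := SimpleGraph.dist_le (q.concat h.symm)
  rw [SimpleGraph.Walk.length_concat] at ha hb
  omega

/- The quadrangle condition of median graphs. -/
theorem IsCAT0.exists_sq_of_dist (hZ : Z.IsCAT0) {v a b d : V} (hab : Z.graph.Adj a b)
    (had : Z.graph.Adj a d) (hbd : b ≠ d) (hb : Z.graph.dist v a = Z.graph.dist v b + 1)
    (hd : Z.graph.dist v a = Z.graph.dist v d + 1) :
    ∃ c, Z.Sq a b c d ∧ Z.graph.dist v b = Z.graph.dist v c + 1 := by
  simp only [SimpleGraph.dist_comm (u := v)] at hb hd ⊢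
  obtain ⟨p, hp⟩ := (hZ.connected b v).exists_walk_length_eq_dist
  obtain ⟨q, hq⟩ := (hZ.connected d v).exists_walk_length_eq_dist
  have hp' : Reduced (.cons hab p) := reduced_of_length_eq_dist (by
    rw [SimpleGraph.Walk.length_cons, hp, hb])
  have hq' : Reduced (.cons had q) := reduced_of_length_eq_dist (by
    rw [SimpleGraph.Walk.length_cons, hq, hd])
  obtain ⟨c, s, hbc, -, r, hr, -⟩ := (hp'.flip hZ hq').exists_square hZ.isNonposCurved hbd
  refine ⟨c, s, ?_⟩
  have hlen := hr.length_eq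
  have hcv := SimpleGraph.dist_le r
  have hbv := hZ.dist_eq_add_one_or hbc v
  rw [SimpleGraph.Walk.length_cons] at hlen
  simp only [SimpleGraph.dist_comm (u := v)] at hbv
  omega

/-! ### Halfspaces -/

theorem IsCAT0.exists_adj_dist (hZ : Z.IsCAT0) {a b : V} (h : a ≠ b) :
    ∃ c, Z.graph.Adj a c ∧ Z.graph.dist b a = Z.graph.dist b c + 1 := by
  obtain ⟨p, hp⟩ := (hZ.connected a b).exists_walk_length_eq_dist
  cases p with
  | nil => exact absurd rfl h
  | @cons _ c _ hac p =>
    refine ⟨c, hac, ?_⟩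
    have hle := SimpleGraph.dist_le p
    have hdist := hZ.dist_eq_add_one_or hac b
    rw [SimpleGraph.Walk.length_cons] at hp
    rw [SimpleGraph.dist_comm (v := b)] at hle hp
    omega

variable (Z) in
/-- The vertices closer to `a` than to `b`; for an edge `ab` this is the halfspace of its hyperplane
containing `a` (`side_eq_closer`). -/
def closer (a b : V) : Set V := {v | Z.graph.dist v a < Z.graph.dist v b}

theorem mem_closer_iff {a b v : V} :
    v ∈ Z.closer a b ↔ Z.graph.dist v a < Z.graph.dist v b := Iff.rfl

theorem left_mem_closer (hZ : Z.IsCAT0) {a b : V} (h : Z.graph.Adj a b) : a ∈ Z.closer a b := by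
  rw [mem_closer_iff, SimpleGraph.dist_self]
  exact hZ.connected.pos_dist_of_ne h.ne

theorem right_notMem_closer (a b : V) : b ∉ Z.closer a b := by
  rw [mem_closer_iff, SimpleGraph.dist_self]
  exact Nat.not_lt_zero _

theorem Sq.closer_subset (hZ : Z.IsCAT0) {a b c d : V} (s : Z.Sq a b c d) :
    Z.closer a b ⊆ Z.closer d c := by
  intro v hv
  rw [mem_closer_iff] at hv ⊢
  by_contra hcon
  have hbc := hZ.dist_eq_add_one_or s.rotate.adj v
  have hcd := hZ.dist_eq_add_one_or s.rotate.rotate.adj v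
  have hda := hZ.dist_eq_add_one_or s.rotate.rotate.rotate.adj v
  obtain ⟨x, sx, hx⟩ := hZ.exists_sq_of_dist (v := v) s.adj.symm s.rotate.adj
    s.reflect.rotate.ne.symm (by omega) (by omega)
  obtain rfl : x = d := Sq.unique hZ.isNonposCurved sx s.rotate.reflect
  omega

theorem Sq.closer_eq (hZ : Z.IsCAT0) {a b c d : V} (s : Z.Sq a b c d) :
    Z.closer a b = Z.closer d c :=
  (s.closer_subset hZ).antisymm (s.rotate.rotate.rotate.reflect.closer_subset hZ)

theorem Sq.parallel {a b c d : V} (s : Z.Sq a b c d) (h : Z.graph.Adj a b)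
    (h' : Z.graph.Adj d c) : Z.parallelSetoid ⟨s(a, b), h⟩ ⟨s(d, c), h'⟩ := by
  obtain ⟨φ, hφ, rfl, rfl, rfl, rfl⟩ := s
  exact .rel _ _ ⟨⟨φ, hφ⟩, rfl, rfl⟩

variable (Z) in
/-- The two sets into which an edge divides the vertices, according to which endpoint is closer. -/
def closerPair (e : Sym2 V) : Sym2 (Set V) :=
  Sym2.lift ⟨fun a b => s(Z.closer a b, Z.closer b a), fun _ _ => Sym2.eq_swap⟩ e

theorem closerPair_eq_of_parallel (hZ : Z.IsCAT0) {e f : Z.Edge} (h : Z.parallelSetoid e f) :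
    Z.closerPair e.1 = Z.closerPair f.1 := by
  change Relation.EqvGen _ _ _ at h
  induction h with
  | rel e f h =>
    obtain ⟨⟨φ, hφ⟩, rfl, rfl⟩ := h
    have s : Z.Sq _ _ _ _ := ⟨φ, hφ, rfl, rfl, rfl, rfl⟩
    exact congrArg₂ (fun x y => s(x, y)) (s.closer_eq hZ) (s.rotate.reflect.closer_eq hZ)
  | refl e => rfl
  | symm e f _ ih => exact ih.symm
  | trans e f k _ _ ih₁ ih₂ => exact ih₁.trans ih₂

theorem exists_sq_toward (hZ : Z.IsCAT0) {a b c d : V} (hab : Z.graph.Adj a b)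
    (hcd : Z.graph.Adj c d) (hc : c ∈ Z.closer a b) (hd : d ∉ Z.closer a b) (hac : a ≠ c) :
    ∃ c' d', Z.Sq c d d' c' ∧ c' ∈ Z.closer a b ∧ d' ∉ Z.closer a b ∧
      Z.graph.dist a c = Z.graph.dist a c' + 1 := by
  obtain ⟨c', hcc', hc'⟩ := hZ.exists_adj_dist hac.symm
  have habc := hZ.dist_eq_add_one_or hab c
  have habd := hZ.dist_eq_add_one_or hab d
  have habc' := hZ.dist_eq_add_one_or hab c'
  have hcda := hZ.dist_eq_add_one_or hcd a
  have hcdb := hZ.dist_eq_add_one_or hcd b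
  have hccb := hZ.dist_eq_add_one_or hcc' b
  simp only [mem_closer_iff, fun x => SimpleGraph.dist_comm (G := Z.graph) (u := x) (v := a),
    fun x => SimpleGraph.dist_comm (G := Z.graph) (u := x) (v := b)] at *
  obtain ⟨d', s, hd'⟩ := hZ.exists_sq_of_dist (v := b) hcd hcc' (by rintro rfl; omega) (by omega)
    (by omega)
  have hd'a := hZ.dist_eq_add_one_or s.rotate.adj a
  have hd'c'a := hZ.dist_eq_add_one_or s.rotate.rotate.adj a
  exact ⟨c', d', s, by omega, by omega, hc'⟩

theorem parallel_of_closer (hZ : Z.IsCAT0) {a b c d : V} (hab : Z.graph.Adj a b)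
    (hcd : Z.graph.Adj c d) (hc : c ∈ Z.closer a b) (hd : d ∉ Z.closer a b) :
    Z.parallelSetoid ⟨s(c, d), hcd⟩ ⟨s(a, b), hab⟩ := by
  induction hn : Z.graph.dist a c generalizing c d with
  | zero =>
    obtain rfl : a = c := hZ.connected.dist_eq_zero_iff.1 hn
    obtain rfl : d = b := by
      rw [mem_closer_iff, SimpleGraph.dist_eq_one_iff_adj.2 hcd.symm] at hd
      have hdist := hZ.dist_eq_add_one_or hab d
      rw [SimpleGraph.dist_eq_one_iff_adj.2 hcd.symm] at hdist
      exact hZ.connected.dist_eq_zero_iff.1 (by omega)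
    exact Z.parallelSetoid.refl _
  | succ n ih =>
    have hac : a ≠ c := by
      rintro rfl
      simp at hn
    obtain ⟨c', d', s, hc', hd', hdist⟩ := exists_sq_toward hZ hab hcd hc hd hac
    have hcd' := s.rotate.rotate.adj.symm
    exact Z.parallelSetoid.trans (s.parallel hcd hcd') (ih hcd' hc' hd' (by omega))

theorem mem_dual_iff {a b : V} (h : Z.graph.Adj a b) (H : Z.Hyperplane) :
    s(a, b) ∈ H.dual ↔ Quotient.mk Z.parallelSetoid ⟨s(a, b), h⟩ = H :=
  ⟨fun ⟨_, h⟩ => h, fun h' => ⟨h, h'⟩⟩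

theorem Hyperplane.exists_dual (H : Z.Hyperplane) : ∃ a b, s(a, b) ∈ H.dual := by
  induction H using Quotient.inductionOn with
  | _ e =>
    obtain ⟨e, he⟩ := e
    induction e with
    | _ a b => exact ⟨a, b, he, rfl⟩

theorem adj_of_mem_dual {H : Z.Hyperplane} {a b : V} (h : s(a, b) ∈ H.dual) : Z.graph.Adj a b :=
  h.1

theorem exists_hyperplane {a b : V} (h : Z.graph.Adj a b) : ∃ H : Z.Hyperplane, s(a, b) ∈ H.dual :=
  ⟨Quotient.mk _ ⟨s(a, b), h⟩, h, rfl⟩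

theorem eq_of_mem_dual {H K : Z.Hyperplane} {e : Sym2 V} (h : e ∈ H.dual) (h' : e ∈ K.dual) :
    H = K := by
  obtain ⟨_, rfl⟩ := h
  obtain ⟨_, rfl⟩ := h'
  rfl

theorem mem_dual_iff_closer (hZ : Z.IsCAT0) {H : Z.Hyperplane} {a b c d : V}
    (hab : s(a, b) ∈ H.dual) (hcd : Z.graph.Adj c d) :
    s(c, d) ∈ H.dual ↔ (c ∈ Z.closer a b ↔ d ∉ Z.closer a b) := by
  have hadj := adj_of_mem_dual hab
  rw [mem_dual_iff hadj] at hab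
  constructor
  · intro h
    rw [mem_dual_iff hcd] at h
    have hpair : s(Z.closer a b, Z.closer b a) = s(Z.closer c d, Z.closer d c) :=
      closerPair_eq_of_parallel hZ (Quotient.exact (hab.trans h.symm))
    have hc := left_mem_closer hZ hcd
    have hd := left_mem_closer hZ hcd.symm
    have hc' := right_notMem_closer (Z := Z) d c
    have hd' := right_notMem_closer (Z := Z) c d
    obtain ⟨hcloser, -⟩ | ⟨hcloser, -⟩ := Sym2.eq_iff.1 hpair <;> rw [hcloser] <;> tauto
  · intro h
    by_cases hc : c ∈ Z.closer a b
    · rw [mem_dual_iff hcd, ← hab]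
      exact Quotient.sound (parallel_of_closer hZ hadj hcd hc (h.1 hc))
    · rw [Sym2.eq_swap, mem_dual_iff hcd.symm, ← hab]
      exact Quotient.sound (parallel_of_closer hZ hadj hcd.symm (by tauto) hc)

theorem Hyperplane.side_eq_of_mem {H : Z.Hyperplane} {a b : V} (h : b ∈ H.side a) :
    H.side a = H.side b := by
  ext c
  exact ⟨fun h' => SimpleGraph.Reachable.trans (SimpleGraph.Reachable.symm h) h',
    fun h' => SimpleGraph.Reachable.trans h h'⟩

theorem Hyperplane.self_mem_side (H : Z.Hyperplane) (a : V) : a ∈ H.side a :=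
  SimpleGraph.Reachable.refl _

theorem Hyperplane.mem_side_iff {H : Z.Hyperplane} {a b : V} :
    b ∈ H.side a ↔ H.side b = H.side a :=
  ⟨fun h => (side_eq_of_mem h).symm, fun h => h ▸ H.self_mem_side b⟩

theorem side_subset_closer (hZ : Z.IsCAT0) {H : Z.Hyperplane} {a b : V} (hab : s(a, b) ∈ H.dual) :
    H.side a ⊆ Z.closer a b := by
  have closer_of_walk : ∀ {x y : V} (_ : (Z.graph.deleteEdges H.dual).Walk x y),
      x ∈ Z.closer a b → y ∈ Z.closer a b := by
    intro x y p
    induction p with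
    | nil => exact id
    | cons h p ih =>
      intro hx
      rw [SimpleGraph.deleteEdges_adj, mem_dual_iff_closer hZ hab h.1] at h
      exact ih (by tauto)
  rintro v ⟨p⟩
  exact closer_of_walk p (left_mem_closer hZ (adj_of_mem_dual hab))

theorem exists_adj_mem_closer (hZ : Z.IsCAT0) {a b v : V} (hab : Z.graph.Adj a b)
    (hv : v ∈ Z.closer a b) (hav : a ≠ v) :
    ∃ w ∈ Z.closer a b, Z.graph.Adj v w ∧ Z.graph.dist a v = Z.graph.dist a w + 1 := by
  obtain ⟨w, hvw, hw⟩ := hZ.exists_adj_dist hav.symm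
  refine ⟨w, ?_, hvw, hw⟩
  have hvwb := hZ.dist_eq_add_one_or hvw b
  have habw := hZ.dist_eq_add_one_or hab w
  have habv := hZ.dist_eq_add_one_or hab v
  simp only [mem_closer_iff, fun x => SimpleGraph.dist_comm (G := Z.graph) (u := x) (v := a),
    fun x => SimpleGraph.dist_comm (G := Z.graph) (u := x) (v := b)] at *
  omega

theorem closer_subset_side (hZ : Z.IsCAT0) {H : Z.Hyperplane} {a b : V} (hab : s(a, b) ∈ H.dual) :
    Z.closer a b ⊆ H.side a := by
  intro v hv
  induction hn : Z.graph.dist a v generalizing v with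
  | zero =>
    obtain rfl : a = v := hZ.connected.dist_eq_zero_iff.1 hn
    exact H.self_mem_side _
  | succ n ih =>
    have hav : a ≠ v := by
      rintro rfl
      simp at hn
    obtain ⟨w, hw, hvw, hdist⟩ := exists_adj_mem_closer hZ (adj_of_mem_dual hab) hv hav
    refine SimpleGraph.Reachable.trans (ih hw (by omega)) (SimpleGraph.Adj.reachable ?_)
    rw [SimpleGraph.deleteEdges_adj, mem_dual_iff_closer hZ hab hvw.symm]
    exact ⟨hvw.symm, by tauto⟩

theorem side_eq_closer (hZ : Z.IsCAT0) {H : Z.Hyperplane} {a b : V} (hab : s(a, b) ∈ H.dual) :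
    H.side a = Z.closer a b :=
  (side_subset_closer hZ hab).antisymm (closer_subset_side hZ hab)

theorem side_eq_iff_dist (hZ : Z.IsCAT0) {H : Z.Hyperplane} {a b : V} (hab : s(a, b) ∈ H.dual)
    (v : V) : H.side v = H.side a ↔ Z.graph.dist v a < Z.graph.dist v b := by
  rw [← Hyperplane.mem_side_iff, side_eq_closer hZ hab, mem_closer_iff]

theorem side_trichotomy (hZ : Z.IsCAT0) (H : Z.Hyperplane) (x y z : V) :
    H.side x = H.side y ∨ H.side x = H.side z ∨ H.side y = H.side z := by
  obtain ⟨a, b, hab⟩ := H.exists_dual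
  have side_eq_or : ∀ v, H.side v = H.side a ∨ H.side v = H.side b := by
    intro v
    have h := hZ.dist_eq_add_one_or (adj_of_mem_dual hab) v
    rw [side_eq_iff_dist hZ hab, side_eq_iff_dist hZ (Sym2.eq_swap ▸ hab)]
    omega
  rcases side_eq_or x with hx | hx <;> rcases side_eq_or y with hy | hy <;>
    rcases side_eq_or z with hz | hz <;> simp [hx, hy, hz]

theorem mem_dual_iff_side (hZ : Z.IsCAT0) {H : Z.Hyperplane} {c d : V}
    (hcd : Z.graph.Adj c d) : s(c, d) ∈ H.dual ↔ H.side c ≠ H.side d := by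
  constructor
  · intro h he
    have := (side_eq_iff_dist hZ h d).1 he.symm
    rw [SimpleGraph.dist_self] at this
    omega
  · intro h
    by_contra hn
    refine h (Hyperplane.mem_side_iff.1 (SimpleGraph.Adj.reachable ?_))
    rw [SimpleGraph.deleteEdges_adj, Sym2.eq_swap]
    exact ⟨hcd.symm, hn⟩

theorem side_ne_of_mem_dual (hZ : Z.IsCAT0) {H : Z.Hyperplane} {c d : V}
    (h : s(c, d) ∈ H.dual) : H.side c ≠ H.side d :=
  (mem_dual_iff_side hZ (adj_of_mem_dual h)).1 h

theorem side_eq_of_mem_dual (hZ : Z.IsCAT0) {H K : Z.Hyperplane} {c d : V}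
    (h : s(c, d) ∈ H.dual) (hne : K ≠ H) : K.side c = K.side d := by
  by_contra hcon
  exact hne (eq_of_mem_dual ((mem_dual_iff_side hZ (adj_of_mem_dual h)).2 hcon) h)

theorem side_eq_of_ne (hZ : Z.IsCAT0) {H : Z.Hyperplane} {a b c : V} (h₁ : H.side b ≠ H.side a)
    (h₂ : H.side c ≠ H.side a) : H.side b = H.side c := by
  rcases side_trichotomy hZ H a b c with h | h | h
  · exact absurd h.symm h₁
  · exact absurd h.symm h₂
  · exact h

/-! ### Convexity of halfspaces -/

theorem side_eq_of_adj_of_dist (hZ : Z.IsCAT0) {H : Z.Hyperplane} {a b c : V}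
    (hac : Z.graph.Adj a c) (hd : Z.graph.dist b a = Z.graph.dist b c + 1)
    (h : H.side a = H.side b) : H.side c = H.side b := by
  rw [← h]
  by_contra hcon
  have hdual := (mem_dual_iff_side hZ hac).2 (Ne.symm hcon)
  have := (side_eq_iff_dist hZ hdual b).1 h.symm
  omega

theorem side_eq_of_mem_dual_of_dist (hZ : Z.IsCAT0) {H : Z.Hyperplane} {a b c : V}
    (h : s(a, c) ∈ H.dual) (hd : Z.graph.dist b a = Z.graph.dist b c + 1) :
    H.side b = H.side c := by
  rw [side_eq_iff_dist hZ (Sym2.eq_swap ▸ h)]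
  omega

theorem side_eq_of_dist_add (hZ : Z.IsCAT0) {H : Z.Hyperplane} {a b g : V}
    (hg : Z.graph.dist a b = Z.graph.dist a g + Z.graph.dist g b) (h : H.side a = H.side b) :
    H.side g = H.side b := by
  induction hn : Z.graph.dist a g generalizing a with
  | zero =>
    obtain rfl : a = g := hZ.connected.dist_eq_zero_iff.1 hn
    exact h
  | succ n ih =>
    have hag : a ≠ g := by
      rintro rfl
      simp at hn
    obtain ⟨c, hac, hc⟩ := hZ.exists_adj_dist hag
    have htri := hZ.connected.dist_triangle (u := c) (v := g) (w := b)
    have hacb := hZ.dist_eq_add_one_or hac b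
    rw [SimpleGraph.dist_comm (u := g) (v := a), SimpleGraph.dist_comm (u := g) (v := c)] at hc
    rw [SimpleGraph.dist_comm (u := b) (v := a), SimpleGraph.dist_comm (u := b) (v := c)] at hacb
    refine ih (by omega) (side_eq_of_adj_of_dist hZ hac ?_ h) (by omega)
    rw [SimpleGraph.dist_comm (u := b) (v := a), SimpleGraph.dist_comm (u := b) (v := c)]
    omega

theorem side_eq_or_of_dist_add (hZ : Z.IsCAT0) (H : Z.Hyperplane) {a b g : V}
    (hg : Z.graph.dist a b = Z.graph.dist a g + Z.graph.dist g b) :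
    H.side g = H.side a ∨ H.side g = H.side b := by
  rcases side_trichotomy hZ H g a b with h | h | h
  · exact .inl h
  · exact .inr h
  · exact .inr (side_eq_of_dist_add hZ hg h)

theorem exists_separating (hZ : Z.IsCAT0) {a b : V} (h : a ≠ b) :
    ∃ H : Z.Hyperplane, H.side a ≠ H.side b := by
  obtain ⟨c, hac, hc⟩ := hZ.exists_adj_dist h
  obtain ⟨H, hH⟩ := exists_hyperplane hac
  exact ⟨H, (side_eq_of_mem_dual_of_dist hZ hH hc) ▸ side_ne_of_mem_dual hZ hH⟩

theorem eq_of_side_eq (hZ : Z.IsCAT0) {a b : V} (h : ∀ H : Z.Hyperplane, H.side a = H.side b) :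
    a = b := by
  by_contra hne
  obtain ⟨H, hH⟩ := exists_separating hZ hne
  exact hH (h H)

theorem exists_sq_of_side_ne (hZ : Z.IsCAT0) {H K : Z.Hyperplane} {a b d v : V}
    (hb : s(a, b) ∈ H.dual) (hd : s(a, d) ∈ K.dual) (hbd : b ≠ d) (h₁ : H.side v ≠ H.side a)
    (h₂ : K.side v ≠ K.side a) : ∃ c, Z.Sq a b c d := by
  have hdist_b := hZ.dist_eq_add_one_or (adj_of_mem_dual hb) v
  have hdist_d := hZ.dist_eq_add_one_or (adj_of_mem_dual hd) v
  rw [Ne, side_eq_iff_dist hZ hb] at h₁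
  rw [Ne, side_eq_iff_dist hZ hd] at h₂
  obtain ⟨c, hc, -⟩ := hZ.exists_sq_of_dist (v := v) (adj_of_mem_dual hb) (adj_of_mem_dual hd) hbd
    (by omega) (by omega)
  exact ⟨c, hc⟩

theorem eq_of_mem_dual_of_mem_dual (hZ : Z.IsCAT0) {H : Z.Hyperplane} {a b c : V}
    (hb : s(a, b) ∈ H.dual) (hc : s(a, c) ∈ H.dual) : b = c := by
  have hside : H.side b = H.side c :=
    side_eq_of_ne hZ (side_ne_of_mem_dual hZ hb).symm (side_ne_of_mem_dual hZ hc).symm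
  rw [side_eq_iff_dist hZ (Sym2.eq_swap ▸ hc),
    SimpleGraph.dist_eq_one_iff_adj.2 (adj_of_mem_dual hb).symm] at hside
  exact hZ.connected.dist_eq_zero_iff.1 (by omega)

theorem exists_adj_of_dist_ne_add (hZ : Z.IsCAT0) {x y z : V}
    (h : Z.graph.dist x z ≠ Z.graph.dist x y + Z.graph.dist y z) :
    ∃ w, Z.graph.Adj y w ∧ Z.graph.dist x y = Z.graph.dist x w + 1 ∧
      Z.graph.dist z y = Z.graph.dist z w + 1 := by
  rw [SimpleGraph.dist_comm (u := y)] at h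
  induction hn : Z.graph.dist z y generalizing y with
  | zero =>
    obtain rfl : z = y := hZ.connected.dist_eq_zero_iff.1 hn
    simp at h
  | succ n ih =>
    have hyz : y ≠ z := by
      rintro rfl
      simp at hn
    obtain ⟨y₁, hy, hy₁⟩ := hZ.exists_adj_dist hyz
    rcases hZ.dist_eq_add_one_or hy x with hx | hx
    · exact ⟨y₁, hy, hx, by omega⟩
    · obtain ⟨w₁, hw, hxw₁, hzw₁⟩ := ih (y := y₁) (by omega) (by omega)
      obtain ⟨w, s, hxw⟩ :=
        hZ.exists_sq_of_dist (v := x) hy.symm hw (by rintro rfl; omega) hx hxw₁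
      have hyw := hZ.dist_eq_add_one_or s.rotate.adj z
      have hww₁ := hZ.dist_eq_add_one_or s.rotate.rotate.adj z
      exact ⟨w, s.rotate.adj, hxw, by omega⟩

theorem exists_gate (hZ : Z.IsCAT0) (H : Z.Hyperplane) (x b : V) :
    ∃ g, H.side g = H.side b ∧ ∀ z, H.side z = H.side b →
      Z.graph.dist x z = Z.graph.dist x g + Z.graph.dist g z := by
  classical
  have hex : ∃ n, ∃ g, H.side g = H.side b ∧ Z.graph.dist x g = n := ⟨_, b, rfl, rfl⟩
  obtain ⟨g, hg, hmin⟩ := Nat.find_spec hex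
  refine ⟨g, hg, fun z hz => ?_⟩
  by_contra hcon
  obtain ⟨w, hw, hxw, hzw⟩ := exists_adj_of_dist_ne_add hZ hcon
  have hside := side_eq_of_adj_of_dist hZ hw hzw (hg.trans hz.symm)
  exact Nat.find_min hex (m := Z.graph.dist x w) (by omega) ⟨w, hside.trans hz, rfl⟩

/-! ### Carriers -/

theorem Sq.mem_dual_iff {a b c d : V} (s : Z.Sq a b c d) (H : Z.Hyperplane) :
    s(a, b) ∈ H.dual ↔ s(d, c) ∈ H.dual := by
  rw [CubeComplex.mem_dual_iff s.adj, CubeComplex.mem_dual_iff s.rotate.rotate.adj.symm,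
    Quotient.sound (s.parallel s.adj s.rotate.rotate.adj.symm)]

theorem IsCube.adj {n : ℕ} {φ : (Fin n → Bool) → V} (hφ : Z.IsCube n φ) (ε : Fin n → Bool)
    (i : Fin n) : Z.graph.Adj (φ ε) (φ (flipAt ε i)) :=
  Z.adj_update hφ ε i

theorem IsCube.mem_dual {n : ℕ} {φ : (Fin n → Bool) → V} (hφ : Z.IsCube n φ) {H : Z.Hyperplane}
    {i : Fin n} {ε : Fin n → Bool} (h : s(φ ε, φ (flipAt ε i)) ∈ H.dual) (δ : Fin n → Bool) :
    s(φ δ, φ (flipAt δ i)) ∈ H.dual := by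
  refine forall_of_flipAt (p := fun δ => s(φ δ, φ (flipAt δ i)) ∈ H.dual) Finset.univ
    (fun δ j _ hδ => ?_) ε δ (by simp) h
  by_cases hij : i = j
  · subst hij
    rw [flipAt_flipAt, Sym2.eq_swap]
    exact hδ
  · rw [(hφ.sq δ hij).mem_dual_iff, flipAt_comm δ hij] at hδ
    exact hδ

theorem mem_carrier_iff {H : Z.Hyperplane} {a : V} :
    a ∈ H.carrier ↔ ∃ b, s(a, b) ∈ H.dual := by
  constructor
  · rintro ⟨n, φ, hφ, ⟨δ, rfl⟩, ε, i, h⟩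
    exact ⟨_, hφ.mem_dual h δ⟩
  · rintro ⟨b, h⟩
    obtain ⟨φ, hφ, rfl, rfl⟩ := adj_of_mem_dual h
    refine ⟨1, φ, hφ, ⟨_, rfl⟩, fun _ => false, 0, ?_⟩
    convert h using 3
    refine funext fun i => ?_
    obtain rfl : i = 0 := Subsingleton.elim _ _
    simp

theorem mem_carrier_of_adj_of_dist (hZ : Z.IsCAT0) {H : Z.Hyperplane} {a b c : V}
    (ha : a ∈ H.carrier) (hb : b ∈ H.carrier) (hac : Z.graph.Adj a c)
    (hd : Z.graph.dist b a = Z.graph.dist b c + 1) : c ∈ H.carrier := by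
  obtain ⟨a', ha'⟩ := mem_carrier_iff.1 ha
  obtain ⟨b', hb'⟩ := mem_carrier_iff.1 hb
  by_cases hca : a' = c
  · subst hca
    exact mem_carrier_iff.2 ⟨a, Sym2.eq_swap ▸ ha'⟩
  obtain ⟨L, hL⟩ := exists_hyperplane hac
  have hLH : L ≠ H := by
    rintro rfl
    exact hca (eq_of_mem_dual_of_mem_dual hZ ha' hL)
  have hLb : L.side b ≠ L.side a := by
    rw [side_eq_of_mem_dual_of_dist hZ hL hd]
    exact (side_ne_of_mem_dual hZ hL).symm
  obtain ⟨v, hv, hv'⟩ : ∃ v, L.side v ≠ L.side a ∧ H.side v ≠ H.side a := by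
    by_cases h : H.side b = H.side a
    · refine ⟨b', ?_, ?_⟩
      · rwa [← side_eq_of_mem_dual hZ hb' hLH]
      · rw [← h]
        exact (side_ne_of_mem_dual hZ hb').symm
    · exact ⟨b, hLb, h⟩
  obtain ⟨d, s⟩ := exists_sq_of_side_ne hZ ha' hL hca hv' hv
  exact mem_carrier_iff.2 ⟨d, (s.mem_dual_iff H).1 ha'⟩

theorem dist_add_of_mem_carrier (hZ : Z.IsCAT0) {H : Z.Hyperplane} {a b : V}
    (ha : a ∈ H.carrier) (hmin : ∀ z ∈ H.carrier, Z.graph.dist b a ≤ Z.graph.dist b z) {z : V}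
    (hz : z ∈ H.carrier) : Z.graph.dist b z = Z.graph.dist b a + Z.graph.dist a z := by
  by_contra hcon
  obtain ⟨w, hw, hbw, hzw⟩ := exists_adj_of_dist_ne_add hZ hcon
  have := hmin w (mem_carrier_of_adj_of_dist hZ ha hz hw hzw)
  omega

theorem carrier_subset_side (hZ : Z.IsCAT0) {H K : Z.Hyperplane} {a b : V}
    (ha : a ∈ H.carrier) (hmin : ∀ z ∈ H.carrier, Z.graph.dist b a ≤ Z.graph.dist b z)
    (hK : K.side a ≠ K.side b) : H.carrier ⊆ K.side a := by
  intro z hz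
  rw [Hyperplane.mem_side_iff]
  exact ((side_eq_or_of_dist_add hZ K (dist_add_of_mem_carrier hZ ha hmin hz)).resolve_left hK).symm

theorem exists_dual_between (hZ : Z.IsCAT0) {L : Z.Hyperplane} {a b : V}
    (h : L.side a ≠ L.side b) : ∃ p q, s(p, q) ∈ L.dual ∧
      ∀ K : Z.Hyperplane, K.side a = K.side b → K.side p = K.side b := by
  induction hn : Z.graph.dist b a generalizing a with
  | zero =>
    obtain rfl : b = a := hZ.connected.dist_eq_zero_iff.1 hn
    exact absurd rfl h
  | succ n ih =>
    obtain ⟨c, hac, hc⟩ := hZ.exists_adj_dist (a := a) (b := b) (by rintro rfl; exact h rfl)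
    by_cases hL : L.side a = L.side c
    · obtain ⟨p, q, hpq, hK⟩ := ih (a := c) (hL ▸ h) (by omega)
      exact ⟨p, q, hpq, fun K hab => hK K (side_eq_of_adj_of_dist hZ hac hc hab)⟩
    · exact ⟨a, c, (mem_dual_iff_side hZ hac).2 hL, fun K hab => hab⟩

theorem exists_bridge (hZ : Z.IsCAT0) (H H' : Z.Hyperplane) :
    ∃ a a' b b', s(a, a') ∈ H.dual ∧ s(b, b') ∈ H'.dual ∧
      ∀ K : Z.Hyperplane, K ∉ Z.Sep H.carrier H'.carrier → K.side a = K.side b := by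
  classical
  have hex : ∃ n, ∃ a ∈ H.carrier, ∃ b ∈ H'.carrier, Z.graph.dist a b = n := by
    obtain ⟨a, a', ha⟩ := H.exists_dual
    obtain ⟨b, b', hb⟩ := H'.exists_dual
    exact ⟨_, a, mem_carrier_iff.2 ⟨_, ha⟩, b, mem_carrier_iff.2 ⟨_, hb⟩, rfl⟩
  obtain ⟨a, ha, b, hb, hab⟩ := Nat.find_spec hex
  have hmin : ∀ x ∈ H.carrier, ∀ y ∈ H'.carrier, Z.graph.dist a b ≤ Z.graph.dist x y := by
    intro x hx y hy
    rw [hab]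
    exact Nat.find_min' hex ⟨x, hx, y, hy, rfl⟩
  obtain ⟨a', ha'⟩ := mem_carrier_iff.1 ha
  obtain ⟨b', hb'⟩ := mem_carrier_iff.1 hb
  refine ⟨a, a', b, b', ha', hb', fun K hK => ?_⟩
  by_contra hne
  refine hK ⟨K.side a, ⟨a, rfl⟩, K.side b, ⟨b, rfl⟩, hne, ?_, ?_⟩
  · refine carrier_subset_side hZ ha (b := b) (fun z hz => ?_) hne
    rw [SimpleGraph.dist_comm (u := b), SimpleGraph.dist_comm (u := b)]
    exact hmin z hz b hb
  · exact carrier_subset_side hZ hb (b := a) (fun z hz => hmin a ha z hz) (Ne.symm hne)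

/-! ### Cubes and halfspaces -/

theorem IsCube.exists_wall (hZ : Z.IsCAT0) {n : ℕ} {φ : (Fin n → Bool) → V}
    (hφ : Z.IsCube n φ) :
    ∃ σ : Fin n ↪ Z.Hyperplane, ∀ i ε, s(φ ε, φ (flipAt ε i)) ∈ (σ i).dual := by
  choose σ hσ using fun i => exists_hyperplane (hφ.adj (cubeOrigin n) i)
  refine ⟨⟨σ, fun i j hij => ?_⟩, fun i => hφ.mem_dual (hσ i)⟩
  by_contra hne
  exact (hφ.sq (cubeOrigin n) hne).ne (eq_of_mem_dual_of_mem_dual hZ (hij ▸ hσ i) (hσ j))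

/-- The hyperplanes `σ` coordinatise `φ : {0,1}ⁿ → V`: the halfspace of `σ i` containing `φ ε`
records exactly the `i`-th coordinate of `ε`, and no other hyperplane separates the values of `φ`.
This is what `IsFaceMap` says about the halfspaces containing the values of `φ`. -/
structure Coordinatises {n : ℕ} (σ : Fin n ↪ Z.Hyperplane) (φ : (Fin n → Bool) → V) : Prop where
  side_eq_iff : ∀ i ε δ, (σ i).side (φ ε) = (σ i).side (φ δ) ↔ ε i = δ i
  side_eq : ∀ H, H ∉ Set.range σ → ∀ ε δ, H.side (φ ε) = H.side (φ δ)

theorem isFaceMap_side_iff {n : ℕ} {φ : (Fin n → Bool) → V} :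
    (IsFaceMap fun ε (H : Z.Hyperplane) => H.side (φ ε)) ↔
      ∃ σ : Fin n ↪ Z.Hyperplane, Coordinatises σ φ :=
  ⟨fun ⟨σ, h, h'⟩ => ⟨σ, h, h'⟩, fun ⟨σ, h, h'⟩ => ⟨σ, h, h'⟩⟩

theorem coordinatises_of_mem_dual (hZ : Z.IsCAT0) {n : ℕ} {φ : (Fin n → Bool) → V}
    {σ : Fin n ↪ Z.Hyperplane} (hσ : ∀ i ε, s(φ ε, φ (flipAt ε i)) ∈ (σ i).dual) :
    Coordinatises σ φ := by
  have hside : ∀ (H : Z.Hyperplane) i ε, H ≠ σ i → H.side (φ ε) = H.side (φ (flipAt ε i)) :=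
    fun H i ε hne => side_eq_of_mem_dual hZ (hσ i ε) hne
  have heq : ∀ i ε δ, ε i = δ i → (σ i).side (φ ε) = (σ i).side (φ δ) := by
    intro i ε δ h
    refine forall_of_flipAt (p := fun δ => (σ i).side (φ ε) = (σ i).side (φ δ))
      (Finset.univ.erase i) (fun δ j hj hδ => ?_) ε δ (fun j hj => ?_) rfl
    · exact hδ.trans (hside _ j δ fun hij => (Finset.ne_of_mem_erase hj) (σ.injective hij).symm)
    · obtain rfl : j = i := by simpa using hj
      exact h
  refine ⟨fun i ε δ => ⟨fun h => ?_, heq i ε δ⟩, fun H hH ε δ => ?_⟩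
  · by_contra hne
    refine side_ne_of_mem_dual hZ (hσ i ε) (h.trans (heq i δ _ ?_))
    rw [flipAt, Function.update_self]
    exact Bool.eq_not_of_ne (Ne.symm hne)
  · exact forall_of_flipAt (p := fun δ => H.side (φ ε) = H.side (φ δ)) Finset.univ
      (fun δ j _ hδ => hδ.trans (hside _ j δ fun h => hH ⟨j, h.symm⟩)) ε δ (by simp) rfl

theorem mem_dual_of_forall_side_eq (hZ : Z.IsCAT0) {H : Z.Hyperplane} {a b : V}
    (hne : H.side a ≠ H.side b) (heq : ∀ K, K ≠ H → K.side a = K.side b) :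
    s(a, b) ∈ H.dual := by
  obtain ⟨c, hac, hc⟩ := hZ.exists_adj_dist (a := a) (b := b) fun hab => hne (congrArg _ hab)
  obtain ⟨L, hL⟩ := exists_hyperplane hac
  have hbc := side_eq_of_mem_dual_of_dist hZ hL hc
  obtain rfl : L = H := by
    by_contra hLH
    exact side_ne_of_mem_dual hZ hL ((heq L hLH).trans hbc)
  obtain rfl : c = b := by
    refine eq_of_side_eq hZ fun K => ?_
    by_cases hK : K = L
    · rw [hK, hbc]
    · rw [← heq K hK, side_eq_of_mem_dual hZ hL hK]
  exact hL

theorem Coordinatises.mem_dual (hZ : Z.IsCAT0) {n : ℕ} {σ : Fin n ↪ Z.Hyperplane}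
    {φ : (Fin n → Bool) → V} (h : Coordinatises σ φ) (ε : Fin n → Bool) (i : Fin n) :
    s(φ ε, φ (flipAt ε i)) ∈ (σ i).dual := by
  refine mem_dual_of_forall_side_eq hZ ?_ fun K hK => ?_
  · rw [Ne, h.side_eq_iff i]
    simp [flipAt]
  · by_cases hr : K ∈ Set.range σ
    · obtain ⟨j, rfl⟩ := hr
      have hji : j ≠ i := fun hji => hK (congrArg σ hji)
      rw [h.side_eq_iff j, flipAt, Function.update_of_ne hji]
    · exact h.side_eq K hr _ _

theorem Coordinatises.injective_flipAt {n : ℕ} {σ : Fin n ↪ Z.Hyperplane}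
    {φ : (Fin n → Bool) → V} (h : Coordinatises σ φ) (ε : Fin n → Bool) :
    Function.Injective fun i => φ (flipAt ε i) := by
  intro i j hij
  by_contra hne
  have hcoord := (h.side_eq_iff i (flipAt ε i) (flipAt ε j)).1 (congrArg _ hij)
  rw [flipAt, flipAt, Function.update_self, Function.update_of_ne hne] at hcoord
  simp at hcoord

theorem Coordinatises.exists_sq (hZ : Z.IsCAT0) {n : ℕ} {σ : Fin n ↪ Z.Hyperplane}
    {φ : (Fin n → Bool) → V} (h : Coordinatises σ φ) (ε : Fin n → Bool) {i j : Fin n}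
    (hij : i ≠ j) : ∃ c, Z.Sq (φ ε) (φ (flipAt ε i)) c (φ (flipAt ε j)) :=
  exists_sq_of_side_ne hZ (h.mem_dual hZ ε i) (h.mem_dual hZ ε j) ((h.injective_flipAt ε).ne hij)
    (v := φ (flipAt (flipAt ε i) j))
    (by rw [Ne, h.side_eq_iff i]; simp [flipAt, Function.update_of_ne hij])
    (by rw [Ne, h.side_eq_iff j]; simp [flipAt, Function.update_of_ne hij.symm])

theorem Coordinatises.eq (hZ : Z.IsCAT0) {n : ℕ} {σ : Fin n ↪ Z.Hyperplane}
    {φ ψ : (Fin n → Bool) → V} (h : Coordinatises σ φ) (k : Coordinatises σ ψ)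
    {o : Fin n → Bool} (ho : φ o = ψ o) : φ = ψ := by
  funext ε
  refine eq_of_side_eq hZ fun H => ?_
  by_cases hr : H ∈ Set.range σ
  · obtain ⟨i, rfl⟩ := hr
    by_cases hε : ε i = o i
    · rw [(h.side_eq_iff i ε o).2 hε, ho, (k.side_eq_iff i ε o).2 hε]
    · refine side_eq_of_ne hZ (a := φ o) (fun he => hε ((h.side_eq_iff i _ _).1 he)) ?_
      rw [ho]
      exact fun he => hε ((k.side_eq_iff i _ _).1 he)
  · rw [h.side_eq H hr ε o, ho, k.side_eq H hr ε o]

theorem cubeUnit_eq_flipAt {n : ℕ} (i : Fin n) : cubeUnit i = flipAt (cubeOrigin n) i := by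
  funext j
  by_cases hj : j = i
  · subst hj
    simp [cubeUnit, flipAt, cubeOrigin]
  · simp [cubeUnit, flipAt, cubeOrigin, hj]

theorem Coordinatises.isCube (hZ : Z.IsCAT0) {n : ℕ} {σ : Fin n ↪ Z.Hyperplane}
    {φ : (Fin n → Bool) → V} (h : Coordinatises σ φ) : Z.IsCube n φ := by
  set o := cubeOrigin n
  obtain ⟨ψ, hψ, hψo, hψunit⟩ := hZ.link_flag n (φ o) (fun i => φ (flipAt o i))
    (h.injective_flipAt o) (fun i => adj_of_mem_dual (h.mem_dual hZ o i)) fun i j hij => by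
      obtain ⟨c, s⟩ := h.exists_sq hZ o hij
      obtain ⟨χ, hχ, hχo, hχi, hχj, -⟩ := s.exists_corner
      exact ⟨χ, hχ, hχo, hχi, hχj⟩
  obtain ⟨τ, hτ⟩ := hψ.exists_wall hZ
  obtain rfl : τ = σ := by
    ext i
    have hmem := hτ i o
    rw [hψo, ← cubeUnit_eq_flipAt, hψunit] at hmem
    exact eq_of_mem_dual hmem (h.mem_dual hZ o i)
  exact h.eq hZ (coordinatises_of_mem_dual hZ hτ) hψo.symm ▸ hψ

theorem isCube_iff_isFaceMap (hZ : Z.IsCAT0) {n : ℕ} {φ : (Fin n → Bool) → V} :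
    Z.IsCube n φ ↔ IsFaceMap fun ε (H : Z.Hyperplane) => H.side (φ ε) := by
  rw [isFaceMap_side_iff]
  refine ⟨fun hφ => ?_, fun ⟨σ, h⟩ => h.isCube hZ⟩
  obtain ⟨σ, hσ⟩ := hφ.exists_wall hZ
  exact ⟨σ, coordinatises_of_mem_dual hZ hσ⟩

/- The Helly property of halfspaces: replace `a` by its gates in the halfspaces it misses. -/
theorem exists_common_vertex (hZ : Z.IsCAT0) (𝓚 : Set Z.Hyperplane) (x : Z.Hyperplane → Set V)
    (hpair : ∀ H ∈ 𝓚, ∀ K ∈ 𝓚, ∃ v, H.side v = x H ∧ K.side v = x K) (a : V)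
    (hfin : {H | H ∈ 𝓚 ∧ H.side a ≠ x H}.Finite) : ∃ v, ∀ H ∈ 𝓚, H.side v = x H := by
  induction hn : {H | H ∈ 𝓚 ∧ H.side a ≠ x H}.ncard using Nat.strong_induction_on
    generalizing a with
  | _ n ih =>
    by_cases hall : ∀ H ∈ 𝓚, H.side a = x H
    · exact ⟨a, hall⟩
    push Not at hall
    obtain ⟨H, hH, hne⟩ := hall
    obtain ⟨b, hb, -⟩ := hpair H hH H hH
    obtain ⟨g, hg, hgate⟩ := exists_gate hZ H a b
    have hss : {K | K ∈ 𝓚 ∧ K.side g ≠ x K} ⊂ {K | K ∈ 𝓚 ∧ K.side a ≠ x K} := by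
      refine ⟨fun K hK => ⟨hK.1, fun hKa => hK.2 ?_⟩, fun hsub => ?_⟩
      · obtain ⟨v, hv, hv'⟩ := hpair H hH K hK.1
        rw [side_eq_of_dist_add hZ (hgate v (hv.trans hb.symm)) (hKa.trans hv'.symm), hv']
      · exact (hsub ⟨hH, hne⟩ : H ∈ {K | K ∈ 𝓚 ∧ K.side g ≠ x K}).2 (hg.trans hb)
    exact ih _ (hn ▸ Set.ncard_lt_ncard hss hfin) g (hfin.subset hss.1) rfl

end CAT0

/-! ### Wall structures and probability measures on the vertices -/

/-- A system of partitions of `V` into at most two sides: `side v K` is the side of the wall `K`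
that contains `v`. -/
def IsTwoSided {V W P : Type*} (side : V → W → P) : Prop :=
  ∀ K a b c, side a K = side b K ∨ side a K = side c K ∨ side b K = side c K

/-- A cube complex is dual to a system of walls if its vertices are the consistent choices of sides
and its cubes are determined by the walls. Both a CAT(0) cube complex with its hyperplanes and its
collapses with the retained hyperplanes are of this form. -/
structure IsWallStructure {V W P : Type*} (Z : CubeComplex V) (side : V → W → P) : Prop where
  isCube_iff : ∀ {n : ℕ} {φ : (Fin n → Bool) → V},
    Z.IsCube n φ ↔ IsFaceMap fun ε => side (φ ε)
  ext : ∀ {a b : V}, (∀ K, side a K = side b K) → a = b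
  finite : ∀ a b : V, {K | side a K ≠ side b K}.Finite
  twoSided : IsTwoSided side
  exists_vertex : ∀ (x : W → P) (a : V), {K | side a K ≠ x K}.Finite →
    (∀ K L, ∃ v, side v K = x K ∧ side v L = x L) → ∃ v, ∀ K, side v K = x K
  exists_edge : ∀ K, ∃ a b, side a K ≠ side b K ∧ ∀ L, L ≠ K → side a L = side b L

section CubeWeight

variable {V : Type*} {n : ℕ}

/-- The weight, at the point of the cube with coordinates `x`, of the face on which the `i`-th
coordinate is `b`. -/
def cubeWeight (x : Fin n → unitInterval) (i : Fin n) (b : Bool) : ℝ :=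
  if b then (x i : ℝ) else 1 - (x i : ℝ)

theorem cubeWeight_nonneg (x : Fin n → unitInterval) (i : Fin n) (b : Bool) :
    0 ≤ cubeWeight x i b := by
  unfold cubeWeight
  split
  · exact (x i).2.1
  · exact sub_nonneg.2 (x i).2.2

theorem sum_cubeWeight (x : Fin n → unitInterval) (i : Fin n) : ∑ b, cubeWeight x i b = 1 := by
  simp [cubeWeight]

theorem cubePoint_eq (φ : (Fin n → Bool) → V) (x : Fin n → unitInterval) :
    cubePoint φ x = ∑ ε : Fin n → Bool, Finsupp.single (φ ε) (∏ i, cubeWeight x i (ε i)) := rfl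

theorem sum_prod_cubeWeight (x : Fin n → unitInterval) :
    ∑ ε : Fin n → Bool, ∏ i, cubeWeight x i (ε i) = 1 := by
  rw [← Fintype.piFinset_univ, ← Finset.prod_univ_sum]
  exact Finset.prod_eq_one fun i _ => sum_cubeWeight x i

theorem sum_filter_prod_cubeWeight (x : Fin n → unitInterval) (i : Fin n) (b : Bool) :
    ∑ ε : Fin n → Bool, (if ε i = b then ∏ j, cubeWeight x j (ε j) else 0) = cubeWeight x i b := by
  classical
  have hface : Finset.univ.filter (fun ε : Fin n → Bool => ε i = b) =
      Fintype.piFinset fun j => if j = i then {b} else Finset.univ := by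
    ext ε
    simp only [Finset.mem_filter, Finset.mem_univ, true_and, Fintype.mem_piFinset]
    refine ⟨fun h j => ?_, fun h => by simpa using h i⟩
    split_ifs with hj
    · subst hj
      simpa using h
    · exact Finset.mem_univ _
  rw [← Finset.sum_filter, hface, ← Finset.prod_univ_sum, Finset.prod_eq_single i]
  · simp
  · intro j _ hj
    rw [if_neg hj]
    exact sum_cubeWeight x j
  · simp

theorem cubePoint_apply {φ : (Fin n → Bool) → V} (hφ : Function.Injective φ)
    (x : Fin n → unitInterval) (δ : Fin n → Bool) :
    cubePoint φ x (φ δ) = ∏ i, cubeWeight x i (δ i) := by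
  classical
  rw [cubePoint_eq, Finsupp.finsetSum_apply, Finset.sum_eq_single δ]
  · simp
  · intro ε _ hε
    rw [Finsupp.single_apply, if_neg fun h => hε (hφ h)]
  · simp

theorem cubePoint_apply_of_notMem (φ : (Fin n → Bool) → V) (x : Fin n → unitInterval)
    {u : V} (hu : u ∉ Set.range φ) : cubePoint φ x u = 0 := by
  classical
  rw [cubePoint_eq, Finsupp.finsetSum_apply]
  refine Finset.sum_eq_zero fun ε _ => ?_
  rw [Finsupp.single_apply, if_neg fun h => hu ⟨ε, h⟩]

end CubeWeight

/-- `p` is a finitely supported probability measure. -/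
def IsProb {V : Type*} (p : V →₀ ℝ) : Prop := (∀ v, 0 ≤ p v) ∧ p.sum (fun _ r => r) = 1

section IsProb

variable {V : Type*} {p : V →₀ ℝ}

theorem isProb_cubePoint {n : ℕ} (φ : (Fin n → Bool) → V) (x : Fin n → unitInterval) :
    IsProb (cubePoint φ x) := by
  classical
  constructor
  · intro v
    rw [cubePoint_eq, Finsupp.finsetSum_apply]
    refine Finset.sum_nonneg fun ε _ => ?_
    rw [Finsupp.single_apply]
    split_ifs
    · exact Finset.prod_nonneg fun i _ => cubeWeight_nonneg x i _
    · exact le_rfl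
  · rw [cubePoint_eq, ← Finsupp.sum_finsetSum_index (fun _ => rfl) (fun _ _ _ => rfl)]
    simpa using sum_prod_cubeWeight x

theorem IsProb.convexComb {q : V →₀ ℝ} (hp : IsProb p) (hq : IsProb q) {t : ℝ} (h0 : 0 ≤ t)
    (h1 : t ≤ 1) : IsProb ((1 - t) • p + t • q) := by
  refine ⟨fun v => ?_, ?_⟩
  · simp only [Finsupp.coe_add, Finsupp.coe_smul, Pi.add_apply, Pi.smul_apply, smul_eq_mul]
    exact add_nonneg (mul_nonneg (sub_nonneg.2 h1) (hp.1 v)) (mul_nonneg h0 (hq.1 v))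
  · rw [Finsupp.sum_add_index' (fun _ => rfl) (fun _ _ _ => rfl), Finsupp.sum_smul_index (by simp),
      Finsupp.sum_smul_index (by simp), ← Finsupp.mul_sum, ← Finsupp.mul_sum, hp.2, hq.2]
    ring

theorem IsProb.mapDomain {V' : Type*} (hp : IsProb p) (f : V → V') : IsProb (p.mapDomain f) := by
  classical
  refine ⟨fun v => ?_, ?_⟩
  · rw [Finsupp.mapDomain, Finsupp.sum_apply]
    refine Finset.sum_nonneg fun w _ => ?_
    dsimp only
    rw [Finsupp.single_apply]
    split_ifs
    · exact hp.1 w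
    · exact le_rfl
  · rw [Finsupp.sum_mapDomain_index (fun _ => rfl) (fun _ _ _ => rfl)]
    exact hp.2

end IsProb

/-! ### The coordinates of the retraction -/

section Mass

variable {V W P : Type*}

/-- The side of the wall `K` containing `u`, as a set of vertices. -/
def sideSet (side : V → W → P) (u : V) (K : W) : Set V := {x | side x K = side u K}

open Classical in
/-- The mass given by `p` to the side of `K` containing `u`: if `p` is a point of a cube dual to
`K`, this is its coordinate in the direction of `K`. -/
noncomputable def mass (side : V → W → P) (p : V →₀ ℝ) (u : V) (K : W) : ℝ :=
  p.sum fun v r => if side v K = side u K then r else 0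

/-- The variance of the side of `K` under `p`. It vanishes unless `p` gives positive mass to both
sides of the wall. -/
noncomputable def spread (side : V → W → P) (p : V →₀ ℝ) (u : V) (K : W) : ℝ :=
  mass side p u K * (1 - mass side p u K)

open Classical in
/-- The total spread of the walls other than `K` that do not cut `A`. -/
noncomputable def spreadBeyond (side : V → W → P) (p : V →₀ ℝ) (u : V) (A : Set V) (K : W) : ℝ :=
  ∑ᶠ L, if L ≠ K ∧ ∀ x ∈ A, ∀ y ∈ A, side x L = side y L then spread side p u L else 0

/-- The coordinate, in the direction of `K`, of the retraction of `p` to the cube complex dual to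
the walls. It lowers the mass of a side of `K` according to the spread of the walls which do not
cut this side, and raises it according to the spread of those which do not cut the opposite side.
The correction is strong enough for disjoint sides of two walls not both to keep positive
coordinates, so that the walls with coordinates in `(0, 1)` are pairwise transverse. It vanishes if
the support of `p` lies in a cube. -/
noncomputable def retractMass (side : V → W → P) (p : V →₀ ℝ) (u : V) (K : W) : ℝ :=
  max 0 (min 1 (mass side p u K +
    spreadBeyond side p u (sideSet side u K)ᶜ K / (1 - mass side p u K) -
    spreadBeyond side p u (sideSet side u K) K / mass side p u K))

variable {side : V → W → P} {p : V →₀ ℝ} {u v : V} {K : W}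

theorem mass_eq_sum [DecidableEq P] {F : Finset V} (hF : p.support ⊆ F) (u : V) (K : W) :
    mass side p u K = ∑ v ∈ F, if side v K = side u K then p v else 0 := by
  rw [mass, Finsupp.sum_of_support_subset _ hF _ (by simp)]
  refine Finset.sum_congr rfl fun v _ => ?_
  congr

theorem mass_congr (h : side u K = side v K) : mass side p u K = mass side p v K := by
  rw [mass, mass, h]

theorem mass_nonneg (hp : IsProb p) (u : V) (K : W) : 0 ≤ mass side p u K := by
  classical
  rw [mass_eq_sum subset_rfl]
  refine Finset.sum_nonneg fun v _ => ?_
  split_ifs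
  · exact hp.1 v
  · exact le_rfl

theorem mass_mono (hp : IsProb p) {L : W} (h : sideSet side u K ⊆ sideSet side v L) :
    mass side p u K ≤ mass side p v L := by
  classical
  rw [mass_eq_sum subset_rfl, mass_eq_sum subset_rfl]
  refine Finset.sum_le_sum fun x _ => ?_
  by_cases hx : side x K = side u K
  · rw [if_pos hx, if_pos (show side x L = side v L from h hx)]
  · rw [if_neg hx]
    split_ifs
    · exact hp.1 x
    · exact le_rfl

theorem mass_add_mass (hp : IsProb p) (hside : IsTwoSided side) (h : side u K ≠ side v K) :
    mass side p u K + mass side p v K = 1 := by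
  classical
  rw [← hp.2, mass_eq_sum subset_rfl, mass_eq_sum subset_rfl, ← Finset.sum_add_distrib,
    Finsupp.sum]
  refine Finset.sum_congr rfl fun x _ => ?_
  rcases hside K x u v with hx | hx | hx
  · rw [if_pos hx, if_neg (fun h' => h (hx.symm.trans h')), add_zero]
  · rw [if_pos hx, if_neg (fun h' => h (h'.symm.trans hx)), zero_add]
  · exact absurd hx h

theorem mass_le_one (hp : IsProb p) (u : V) (K : W) : mass side p u K ≤ 1 := by
  classical
  rw [← hp.2, mass_eq_sum subset_rfl, Finsupp.sum]
  refine Finset.sum_le_sum fun x _ => ?_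
  split_ifs
  · exact le_rfl
  · exact hp.1 x

theorem mass_eq_one (hp : IsProb p) (h : ∀ x ∈ p.support, side x K = side u K) :
    mass side p u K = 1 := by
  classical
  rw [← hp.2, mass_eq_sum subset_rfl, Finsupp.sum]
  exact Finset.sum_congr rfl fun x hx => if_pos (h x hx)

theorem mass_eq_zero_iff (hp : IsProb p) :
    mass side p u K = 0 ↔ ∀ x ∈ p.support, side x K ≠ side u K := by
  classical
  rw [mass_eq_sum subset_rfl, Finset.sum_eq_zero_iff_of_nonneg fun x _ => by
    split_ifs
    · exact hp.1 x
    · exact le_rfl]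
  simp +contextual [imp_not_comm]

theorem spread_nonneg (hp : IsProb p) (u : V) (K : W) : 0 ≤ spread side p u K :=
  mul_nonneg (mass_nonneg hp u K) (sub_nonneg.2 (mass_le_one hp u K))

theorem spread_eq (hp : IsProb p) (hside : IsTwoSided side) (u v : V) (K : W) :
    spread side p u K = spread side p v K := by
  by_cases h : side u K = side v K
  · rw [spread, spread, mass_congr h]
  · rw [spread, spread, ← mass_add_mass hp hside h]
    ring

theorem exists_side_ne_of_spread_ne_zero (hp : IsProb p) (h : spread side p u K ≠ 0) :
    ∃ x ∈ p.support, ∃ y ∈ p.support, side x K ≠ side y K := by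
  rw [spread, mul_ne_zero_iff, Ne, mass_eq_zero_iff hp] at h
  push Not at h
  obtain ⟨⟨x, hx, hxu⟩, hne⟩ := h
  by_contra! hcon
  refine hne (sub_eq_zero.2 (mass_eq_one hp fun y hy => ?_).symm)
  rw [← hxu, hcon x hx y hy]

theorem spreadBeyond_eq_sum [DecidableEq W] (hp : IsProb p) {F : Set V} (hF : ↑p.support ⊆ F)
    {T : Finset W} (hT : ∀ K, ∀ x ∈ F, ∀ y ∈ F, side x K ≠ side y K → K ∈ T)
    (u : V) (A : Set V) (K : W) [DecidablePred fun L => ∀ x ∈ A, ∀ y ∈ A, side x L = side y L] :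
    spreadBeyond side p u A K = ∑ L ∈ T, if L ≠ K ∧ ∀ x ∈ A, ∀ y ∈ A, side x L = side y L then
      spread side p u L else 0 := by
  rw [spreadBeyond, finsum_eq_sum_of_support_subset (s := T)]
  · refine Finset.sum_congr rfl fun L _ => ?_
    congr
  · intro L hL
    have hspread : spread side p u L ≠ 0 := fun h => by simp [h] at hL
    obtain ⟨x, hx, y, hy, hxy⟩ := exists_side_ne_of_spread_ne_zero hp hspread
    exact hT L x (hF hx) y (hF hy) hxy

theorem spreadBeyond_nonneg (hp : IsProb p) (u : V) (A : Set V) (K : W) :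
    0 ≤ spreadBeyond side p u A K := by
  refine finsum_nonneg fun L => ?_
  split_ifs
  · exact spread_nonneg hp u L
  · exact le_rfl

theorem spreadBeyond_congr (hp : IsProb p) (hside : IsTwoSided side) (u v : V) (A : Set V)
    (K : W) : spreadBeyond side p u A K = spreadBeyond side p v A K := by
  unfold spreadBeyond
  simp_rw [spread_eq hp hside u v]

theorem spreadBeyond_eq_zero (hp : IsProb p) {A : Set V} (hA : ↑p.support ⊆ A) (u : V) (K : W) :
    spreadBeyond side p u A K = 0 := by
  refine finsum_eq_zero_of_forall_eq_zero fun L => ?_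
  split_ifs with hL
  · by_contra hne
    obtain ⟨x, hx, y, hy, hxy⟩ := exists_side_ne_of_spread_ne_zero hp hne
    exact hxy (hL.2 x (hA hx) y (hA hy))
  · rfl

theorem compl_sideSet (hside : IsTwoSided side) (h : side u K ≠ side v K) :
    (sideSet side u K)ᶜ = sideSet side v K := by
  ext x
  simp only [sideSet, Set.mem_compl_iff, Set.mem_ofPred_eq]
  rcases hside K x u v with hx | hx | hx
  · exact ⟨fun h' => absurd hx h', fun h' => absurd (hx.symm.trans h') h⟩
  · exact ⟨fun _ => hx, fun _ h' => h (h'.symm.trans hx)⟩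
  · exact absurd hx h

theorem retractMass_congr (hp : IsProb p) (hside : IsTwoSided side) (h : side u K = side v K) :
    retractMass side p u K = retractMass side p v K := by
  have hset : sideSet side u K = sideSet side v K := by
    unfold sideSet
    rw [h]
  rw [retractMass, retractMass, hset, mass_congr h, spreadBeyond_congr hp hside u v,
    spreadBeyond_congr hp hside u v]

theorem retractMass_nonneg (u : V) (K : W) : 0 ≤ retractMass side p u K := le_max_left _ _

theorem max_zero_min_one_sub (x : ℝ) : max 0 (min 1 (1 - x)) = 1 - max 0 (min 1 x) := by
  rcases le_total x 0 with h | h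
  · rw [min_eq_left (by linarith), min_eq_right (by linarith), max_eq_left h]
    norm_num
  · rcases le_total x 1 with h' | h'
    · rw [min_eq_right (by linarith), min_eq_right h', max_eq_right h, max_eq_right (by linarith)]
    · rw [min_eq_right (by linarith), min_eq_left h', max_eq_left (by linarith)]
      norm_num

theorem retractMass_add_retractMass (hp : IsProb p) (hside : IsTwoSided side)
    (h : side u K ≠ side v K) : retractMass side p u K + retractMass side p v K = 1 := by
  have hmass : mass side p v K = 1 - mass side p u K := by
    linarith [mass_add_mass hp hside h]
  rw [retractMass, retractMass, compl_sideSet hside h, compl_sideSet hside h.symm, hmass,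
    spreadBeyond_congr hp hside v u, spreadBeyond_congr hp hside v u, ← eq_sub_iff_add_eq',
    ← max_zero_min_one_sub]
  congr 2
  ring

theorem retractMass_pos_iff : 0 < retractMass side p u K ↔ 0 < mass side p u K +
    spreadBeyond side p u (sideSet side u K)ᶜ K / (1 - mass side p u K) -
    spreadBeyond side p u (sideSet side u K) K / mass side p u K := by
  simp [retractMass]

theorem mass_pos_of_retractMass_pos (hp : IsProb p) (h : 0 < retractMass side p u K) :
    0 < mass side p u K := by
  refine (mass_nonneg hp u K).lt_of_ne' fun hmass => ?_
  have hsupp : ↑p.support ⊆ (sideSet side u K)ᶜ := fun x hx => (mass_eq_zero_iff hp).1 hmass x hx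
  rw [retractMass_pos_iff, hmass, spreadBeyond_eq_zero hp hsupp] at h
  simp at h

theorem exists_finset_separating (hfin : ∀ a b : V, {K | side a K ≠ side b K}.Finite) {F : Set V}
    (hF : F.Finite) : ∃ T : Finset W, ∀ K, K ∈ T ↔ ∃ x ∈ F, ∃ y ∈ F, side x K ≠ side y K := by
  have hsep : {K | ∃ x ∈ F, ∃ y ∈ F, side x K ≠ side y K}.Finite := by
    have hunion : {K | ∃ x ∈ F, ∃ y ∈ F, side x K ≠ side y K} =
        ⋃ x ∈ F, ⋃ y ∈ F, {K | side x K ≠ side y K} := by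
      ext
      simp
    rw [hunion]
    exact hF.biUnion fun x _ => hF.biUnion fun y _ => hfin x y
  exact ⟨hsep.toFinset, fun K => hsep.mem_toFinset⟩

variable {Z : CubeComplex V}

theorem IsWallStructure.exists_side_ne (hS : IsWallStructure Z side) (u : V) (K : W) :
    ∃ v, side u K ≠ side v K := by
  obtain ⟨a, b, hab, -⟩ := hS.exists_edge K
  by_contra! h
  exact hab ((h a).symm.trans (h b))

theorem IsWallStructure.eq_of_sideSet_eq (hS : IsWallStructure Z side) {L : W}
    (h : sideSet side u K = sideSet side v L) : K = L := by
  obtain ⟨a, b, hab, heq⟩ := hS.exists_edge L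
  by_contra hne
  have hiff : side a L = side v L ↔ side b L = side v L := by
    change a ∈ sideSet side v L ↔ b ∈ sideSet side v L
    rw [← h]
    change side a K = side u K ↔ side b K = side u K
    rw [heq K hne]
  rcases hS.twoSided L a b v with h' | h' | h'
  · exact hab h'
  · exact hab (h'.trans (hiff.1 h').symm)
  · exact hab ((hiff.2 h').trans h'.symm)

theorem IsWallStructure.spreadBeyond_add_le (hS : IsWallStructure Z side) (hp : IsProb p)
    {L : W} (hKL : K ≠ L) (z : V) (h : sideSet side u L ⊆ sideSet side v K) :
    spreadBeyond side p z (sideSet side v K) K + spread side p z K ≤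
      spreadBeyond side p z (sideSet side u L) L := by
  classical
  obtain ⟨T, hT⟩ := exists_finset_separating hS.finite p.support.finite_toSet
  have hT' : ∀ M, ∀ x ∈ (p.support : Set V), ∀ y ∈ (p.support : Set V),
      side x M ≠ side y M → M ∈ insert K T :=
    fun M x hx y hy hxy => Finset.mem_insert_of_mem ((hT M).2 ⟨x, hx, y, hy, hxy⟩)
  have hK : spread side p z K = ∑ M ∈ insert K T, if M = K then spread side p z M else 0 := by
    rw [Finset.sum_ite_eq', if_pos (Finset.mem_insert_self _ _)]
  rw [spreadBeyond_eq_sum hp subset_rfl hT', spreadBeyond_eq_sum hp subset_rfl hT', hK,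
    ← Finset.sum_add_distrib]
  refine Finset.sum_le_sum fun M _ => ?_
  by_cases hMK : M = K
  · subst hMK
    rw [if_neg (by simp), if_pos rfl, zero_add, if_pos]
    exact ⟨hKL, fun x hx y hy => (h hx).trans (h hy).symm⟩
  · rw [if_neg hMK, add_zero]
    split_ifs with hM hM'
    · exact le_rfl
    · refine absurd ⟨?_, fun x hx y hy => hM.2 x (h hx) y (h hy)⟩ hM'
      rintro rfl
      have huv : u ∈ sideSet side v K := h rfl
      exact hMK (hS.eq_of_sideSet_eq (h.antisymm fun x hx => hM.2 x hx u huv))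
    · exact spread_nonneg hp z M
    · exact le_rfl

/- Here `a`, `b` are the masses of disjoint sides of two walls, `S`, `R` the spreads of the walls
not cutting these sides and `S'`, `R'` those of the walls not cutting their complements. -/
theorem not_retract_pos_and_pos {a b S S' R R' : ℝ} (ha : 0 < a) (hb : 0 < b) (hab : a + b ≤ 1)
    (hS' : 0 ≤ S') (hR' : 0 ≤ R') (hS : R' + b * (1 - b) ≤ S) (hR : S' + a * (1 - a) ≤ R) :
    ¬(0 < a + S' / (1 - a) - S / a ∧ 0 < b + R' / (1 - b) - R / b) := by
  rintro ⟨hposa, hposb⟩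
  have ha1 : 0 < 1 - a := by linarith
  have hb1 : 0 < 1 - b := by linarith
  have clear_denominators : ∀ {c s s' : ℝ}, 0 < c → 0 < 1 - c → 0 < c + s' / (1 - c) - s / c →
      (1 - c) * s < c * (s' + c * (1 - c)) := by
    intro c s s' hc hc1 hpos
    have hmul := mul_pos hpos (mul_pos hc hc1)
    have heq : (c + s' / (1 - c) - s / c) * (c * (1 - c)) =
        c * (s' + c * (1 - c)) - (1 - c) * s := by
      field_simp
      ring
    linarith
  have hcycle : b * (R' + b * (1 - b)) < b * (R' + b * (1 - b)) :=
    calc b * (R' + b * (1 - b)) ≤ (1 - a) * S :=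
          mul_le_mul (by linarith) hS (by positivity) ha1.le
      _ < a * (S' + a * (1 - a)) := clear_denominators ha ha1 hposa
      _ ≤ (1 - b) * R := mul_le_mul (by linarith) hR (by positivity) hb1.le
      _ < b * (R' + b * (1 - b)) := clear_denominators hb hb1 hposb
  exact hcycle.false

theorem IsWallStructure.exists_of_retractMass_pos (hS : IsWallStructure Z side) (hp : IsProb p)
    {L : W} (hKL : K ≠ L) (hu : 0 < retractMass side p u L) (hv : 0 < retractMass side p v K) :
    ∃ x, side x L = side u L ∧ side x K = side v K := by
  by_contra! hdisj
  obtain ⟨w, hw⟩ := hS.exists_side_ne v K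
  obtain ⟨t, ht⟩ := hS.exists_side_ne u L
  have hKw := compl_sideSet hS.twoSided hw
  have hLt := compl_sideSet hS.twoSided ht
  have hsubK : sideSet side u L ⊆ sideSet side w K := hKw ▸ fun x hx => hdisj x hx
  have hsubL : sideSet side v K ⊆ sideSet side t L := hLt ▸ fun x hx hx' => hdisj x hx' hx
  have hmass : mass side p u L + mass side p v K ≤ 1 := by
    rw [← mass_add_mass hp hS.twoSided hw.symm]
    gcongr
    exact mass_mono hp hsubK
  have hspreadL := hS.spreadBeyond_add_le hp hKL v hsubK
  have hspreadK := hS.spreadBeyond_add_le hp hKL.symm u hsubL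
  rw [spreadBeyond_congr hp hS.twoSided v u _ L, ← hKw] at hspreadL
  rw [spreadBeyond_congr hp hS.twoSided u v _ K, ← hLt] at hspreadK
  exact not_retract_pos_and_pos (mass_pos_of_retractMass_pos hp hu)
    (mass_pos_of_retractMass_pos hp hv) hmass (spreadBeyond_nonneg hp u _ L)
    (spreadBeyond_nonneg hp v _ K) hspreadL hspreadK
    ⟨retractMass_pos_iff.1 hu, retractMass_pos_iff.1 hv⟩

end Mass

section Retract

variable {V W P : Type*} {side : V → W → P} {Z : CubeComplex V} {p : V →₀ ℝ}

/-- A consistent choice of a probability measure on the two sides of each wall; `m u K` is the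
measure of the side of `K` containing `u`. Such choices are the coordinates of the points of the
cube complex dual to the walls. -/
structure IsConsistentMass (side : V → W → P) (m : V → W → ℝ) : Prop where
  congr : ∀ {u v : V} {K : W}, side u K = side v K → m u K = m v K
  nonneg : ∀ u K, 0 ≤ m u K
  add_eq_one : ∀ {u v : V} {K : W}, side u K ≠ side v K → m u K + m v K = 1
  finite : ∀ u, {K | m u K ≠ 1}.Finite
  exists_mem_inter : ∀ {u v : V} {K L : W}, K ≠ L → 0 < m u L → 0 < m v K →
    ∃ x, side x L = side u L ∧ side x K = side v K

theorem finprod_eq_zero_of_eq_zero {ι M : Type*} [CommMonoidWithZero M] {f : ι → M}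
    (hf : {i | f i ≠ 1}.Finite) {i : ι} (hi : f i = 0) : ∏ᶠ j, f j = 0 := by
  classical
  rw [finprod_eq_prod_of_mulSupport_subset (s := insert i hf.toFinset) f fun j hj => by
    simpa using Or.inr hj]
  exact Finset.prod_eq_zero (Finset.mem_insert_self _ _) hi

theorem IsWallStructure.mem_range_of_side_eq (hS : IsWallStructure Z side) {n : ℕ}
    {φ : (Fin n → Bool) → V} {σ : Fin n ↪ W}
    (hσ : ∀ i ε δ, side (φ ε) (σ i) = side (φ δ) (σ i) ↔ ε i = δ i)
    (hσ' : ∀ K, K ∉ Set.range σ → ∀ ε δ, side (φ ε) K = side (φ δ) K) {u : V}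
    (hu : ∀ K, K ∉ Set.range σ → side u K = side (φ fun _ => true) K) : u ∈ Set.range φ := by
  classical
  set o : Fin n → Bool := fun _ => true
  set ε : Fin n → Bool := fun i => decide (side u (σ i) = side (φ o) (σ i))
  refine ⟨ε, hS.ext fun K => ?_⟩
  by_cases hK : K ∈ Set.range σ
  · obtain ⟨i, rfl⟩ := hK
    by_cases hi : side u (σ i) = side (φ o) (σ i)
    · rw [hi, hσ]
      exact decide_eq_true hi
    · rcases hS.twoSided (σ i) (φ ε) u (φ o) with h | h | h
      · exact h
      · exact absurd ((hσ i ε o).1 h) (by simpa [ε, o] using hi)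
      · exact absurd h hi
  · rw [hu K hK, hσ' K hK]

theorem IsConsistentMass.cubePoint_eq_finprod (hS : IsWallStructure Z side) {m : V → W → ℝ}
    (hm : IsConsistentMass side m) {n : ℕ} {φ : (Fin n → Bool) → V} (hφ : Z.IsCube n φ)
    {σ : Fin n ↪ W} (hσ : ∀ i ε δ, side (φ ε) (σ i) = side (φ δ) (σ i) ↔ ε i = δ i)
    (hσ' : ∀ K, K ∉ Set.range σ → ∀ ε δ, side (φ ε) K = side (φ δ) K) {t : Fin n → unitInterval}
    (ht : ∀ i ε, m (φ ε) (σ i) = cubeWeight t i (ε i))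
    (hm' : ∀ K, K ∉ Set.range σ → ∀ ε, m (φ ε) K = 1) (u : V) :
    cubePoint φ t u = ∏ᶠ K, m u K := by
  by_cases hu : u ∈ Set.range φ
  · obtain ⟨δ, rfl⟩ := hu
    have hsub : Function.mulSupport (m (φ δ)) ⊆ (Finset.univ.map σ : Finset W) := fun K hK => by
      by_contra hKσ
      exact hK (hm' K (by simpa using hKσ) δ)
    rw [cubePoint_apply (Z.injective hφ), finprod_eq_prod_of_mulSupport_subset _ hsub,
      Finset.prod_map]
    exact Finset.prod_congr rfl fun i _ => (ht i δ).symm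
  · obtain ⟨K, hKσ, hK⟩ : ∃ K, K ∉ Set.range σ ∧ side u K ≠ side (φ fun _ => true) K := by
      by_contra! h
      exact hu (hS.mem_range_of_side_eq hσ hσ' h)
    have hzero : m u K = 0 := by linarith [hm.add_eq_one hK, hm' K hKσ fun _ => true]
    rw [cubePoint_apply_of_notMem _ _ hu, finprod_eq_zero_of_eq_zero (hm.finite u) hzero]

theorem IsConsistentMass.exists_side_eq (hS : IsWallStructure Z side) {m : V → W → ℝ}
    (hm : IsConsistentMass side m) (x : W → V) (a : V)
    (hfin : {K | side a K ≠ side (x K) K}.Finite) (hpos : ∀ K, 0 < m (x K) K) :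
    ∃ v, ∀ K, side v K = side (x K) K := by
  refine hS.exists_vertex _ a hfin fun K L => ?_
  by_cases hKL : K = L
  · subst hKL
    exact ⟨_, rfl, rfl⟩
  · exact hm.exists_mem_inter (Ne.symm hKL) (hpos K) (hpos L)

theorem IsConsistentMass.exists_forall_pos (hS : IsWallStructure Z side) {m : V → W → ℝ}
    (hm : IsConsistentMass side m) (a : V) : ∃ o, ∀ K, 0 < m o K := by
  have hpos : ∀ K, ∃ x, 0 < m x K ∧ (m a K = 1 → x = a) := fun K => by
    rcases (hm.nonneg a K).eq_or_lt with hzero | hpos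
    · obtain ⟨b, hb⟩ := hS.exists_side_ne a K
      exact ⟨b, by linarith [hm.add_eq_one hb], fun hone => by linarith⟩
    · exact ⟨a, hpos, fun _ => rfl⟩
  choose x hx hxa using hpos
  obtain ⟨o, ho⟩ := hm.exists_side_eq hS x a
    ((hm.finite a).subset fun K hK hone => hK (by rw [hxa K hone])) hx
  exact ⟨o, fun K => by rw [hm.congr (ho K)]; exact hx K⟩

theorem IsConsistentMass.exists_cube (hS : IsWallStructure Z side) {m : V → W → ℝ}
    (hm : IsConsistentMass side m) (a : V) :
    ∃ (n : ℕ) (φ : (Fin n → Bool) → V) (σ : Fin n ↪ W),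
      (∀ i ε δ, side (φ ε) (σ i) = side (φ δ) (σ i) ↔ ε i = δ i) ∧
      (∀ K, K ∉ Set.range σ → ∀ ε δ, side (φ ε) K = side (φ δ) K) ∧
      (∀ i ε, 0 < m (φ ε) (σ i)) ∧ ∀ K, K ∉ Set.range σ → ∀ ε, m (φ ε) K = 1 := by
  classical
  obtain ⟨o, ho⟩ := hm.exists_forall_pos hS a
  choose b hb using hS.exists_side_ne o
  obtain ⟨n, σ, hσ⟩ := (hm.finite o).fin_embedding
  have hne : ∀ i, m o (σ i) ≠ 1 := fun i => hσ.le ⟨i, rfl⟩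
  let x : (Fin n → Bool) → W → V := fun ε K => if ∃ i, σ i = K ∧ ε i = true then b K else o
  have hxσ : ∀ ε i, x ε (σ i) = if ε i = true then b (σ i) else o := fun ε i => by
    simp [x, σ.injective.eq_iff]
  have hxo : ∀ ε K, K ∉ Set.range σ → x ε K = o := fun ε K hK =>
    if_neg fun ⟨i, hi, _⟩ => hK ⟨i, hi⟩
  have hpos : ∀ ε i, 0 < m (x ε (σ i)) (σ i) := fun ε i => by
    rw [hxσ]
    split_ifs
    · refine (hm.nonneg _ _).lt_of_ne' fun h => hne i ?_
      linarith [hm.add_eq_one (hb (σ i))]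
    · exact ho _
  have hvertex : ∀ ε, ∃ v, ∀ K, side v K = side (x ε K) K := fun ε => by
    refine hm.exists_side_eq hS (x ε) o ((Set.finite_range σ).subset fun K hK => ?_) fun K => ?_
    · by_contra hKσ
      exact hK (by rw [hxo ε K hKσ])
    · by_cases hK : K ∈ Set.range σ
      · obtain ⟨i, rfl⟩ := hK
        exact hpos ε i
      · rw [hxo ε K hK]
        exact ho K
  choose φ hφ using hvertex
  refine ⟨n, φ, σ, fun i ε δ => ?_, fun K hK ε δ => ?_, fun i ε => ?_, fun K hK ε => ?_⟩
  · rw [hφ, hφ, hxσ, hxσ]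
    have := hb (σ i)
    cases ε i <;> cases δ i <;> simp [this, this.symm]
  · rw [hφ, hφ, hxo ε K hK, hxo δ K hK]
  · rw [hm.congr (hφ ε _)]
    exact hpos ε i
  · rw [hm.congr (hφ ε K), hxo ε K hK]
    exact not_not.1 fun h => hK (hσ.ge h)

theorem IsConsistentMass.exists_cubePoint (hS : IsWallStructure Z side) {m : V → W → ℝ}
    (hm : IsConsistentMass side m) (a : V) :
    ∃ (n : ℕ) (φ : (Fin n → Bool) → V) (t : Fin n → unitInterval), Z.IsCube n φ ∧
      (∀ i, 0 < (t i : ℝ) ∧ (t i : ℝ) < 1) ∧ ∀ u, cubePoint φ t u = ∏ᶠ K, m u K := by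
  obtain ⟨n, φ, σ, hσ, hσ', hpos, hone⟩ := hm.exists_cube hS a
  set o : Fin n → Bool := fun _ => true
  have hadd : ∀ i ε, ε i = false → m (φ ε) (σ i) + m (φ o) (σ i) = 1 := fun i ε hε =>
    hm.add_eq_one fun h => by simp [(hσ i ε o).1 h, o] at hε
  have hlt : ∀ i, m (φ o) (σ i) < 1 := fun i => by
    linarith [hadd i (fun _ => false) rfl, hpos i fun _ => false]
  let t : Fin n → unitInterval := fun i => ⟨m (φ o) (σ i), (hpos i o).le, (hlt i).le⟩
  have hcube : Z.IsCube n φ := hS.isCube_iff.2 ⟨σ, hσ, hσ'⟩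
  refine ⟨n, φ, t, hcube, fun i => ⟨hpos i o, hlt i⟩,
    hm.cubePoint_eq_finprod hS hcube hσ hσ' (fun i ε => ?_) hone⟩
  unfold cubeWeight
  split_ifs with hε
  · exact hm.congr ((hσ i ε o).2 hε)
  · exact eq_sub_of_add_eq (hadd i ε (by simpa using hε))

theorem IsWallStructure.finite_mass_ne_one (hS : IsWallStructure Z side) (hp : IsProb p) (u : V) :
    {K | mass side p u K ≠ 1}.Finite := by
  classical
  obtain ⟨T, hT⟩ := exists_finset_separating hS.finite (insert u p.support).finite_toSet
  refine T.finite_toSet.subset fun K hK => ?_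
  by_contra hKT
  refine hK (mass_eq_one hp fun x hx => ?_)
  by_contra hne
  exact hKT ((hT K).2 ⟨x, by simp [hx], u, by simp, hne⟩)

theorem retractMass_eq_zero (hp : IsProb p) {u : V} {K : W} (h : mass side p u K = 0) :
    retractMass side p u K = 0 :=
  (retractMass_nonneg u K).antisymm' <| not_lt.1 fun hpos =>
    (mass_pos_of_retractMass_pos hp hpos).ne' h

theorem IsWallStructure.retractMass_eq_one (hS : IsWallStructure Z side) (hp : IsProb p) {u : V}
    {K : W} (h : mass side p u K = 1) : retractMass side p u K = 1 := by
  obtain ⟨v, hv⟩ := hS.exists_side_ne u K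
  have hzero : mass side p v K = 0 := by linarith [mass_add_mass hp hS.twoSided hv]
  linarith [retractMass_add_retractMass hp hS.twoSided hv, retractMass_eq_zero hp hzero]

theorem IsWallStructure.isConsistentMass_retractMass (hS : IsWallStructure Z side)
    (hp : IsProb p) : IsConsistentMass side (retractMass side p) where
  congr := retractMass_congr hp hS.twoSided
  nonneg := retractMass_nonneg
  add_eq_one := retractMass_add_retractMass hp hS.twoSided
  finite u := (hS.finite_mass_ne_one hp u).subset fun _ hK h => hK (hS.retractMass_eq_one hp h)
  exists_mem_inter := hS.exists_of_retractMass_pos hp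

theorem IsProb.support_nonempty (hp : IsProb p) : p.support.Nonempty := by
  rw [Finsupp.support_nonempty_iff]
  rintro rfl
  simpa using hp.2

theorem IsWallStructure.exists_retract (hS : IsWallStructure Z side) (hp : IsProb p) :
    ∃ (n : ℕ) (φ : (Fin n → Bool) → V) (t : Fin n → unitInterval), Z.IsCube n φ ∧
      (∀ i, 0 < (t i : ℝ) ∧ (t i : ℝ) < 1) ∧
        ∀ u, cubePoint φ t u = ∏ᶠ K, retractMass side p u K :=
  (hS.isConsistentMass_retractMass hp).exists_cubePoint hS hp.support_nonempty.choose

/-- The retraction onto the cube complex of the simplex spanned by its vertices, that is, of the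
space of finitely supported probability measures on the vertices. -/
noncomputable def IsWallStructure.retract (hS : IsWallStructure Z side) (hp : IsProb p) :
    Z.Realization :=
  ⟨cubePoint (hS.exists_retract hp).choose_spec.choose
    (hS.exists_retract hp).choose_spec.choose_spec.choose, _, _, _,
    (hS.exists_retract hp).choose_spec.choose_spec.choose_spec.1, rfl⟩

theorem IsWallStructure.retract_apply (hS : IsWallStructure Z side) (hp : IsProb p) (u : V) :
    (hS.retract hp).1 u = ∏ᶠ K, retractMass side p u K :=
  (hS.exists_retract hp).choose_spec.choose_spec.choose_spec.2.2 u

/-! ### The retraction fixes the cube complex -/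

theorem Realization.isProb (q : Z.Realization) : IsProb q.1 := by
  obtain ⟨n, φ, x, -, h⟩ := q.2
  rw [h]
  exact isProb_cubePoint φ x

theorem support_cubePoint_subset {n : ℕ} (φ : (Fin n → Bool) → V) (x : Fin n → unitInterval) :
    ↑(cubePoint φ x).support ⊆ Set.range φ := by
  intro v hv
  by_contra h
  exact Finsupp.mem_support_iff.1 hv (cubePoint_apply_of_notMem φ x h)

theorem mass_cubePoint {n : ℕ} {φ : (Fin n → Bool) → V} {σ : Fin n → W}
    (hσ : ∀ i ε δ, side (φ ε) (σ i) = side (φ δ) (σ i) ↔ ε i = δ i) (x : Fin n → unitInterval)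
    (i : Fin n) (δ : Fin n → Bool) :
    mass side (cubePoint φ x) (φ δ) (σ i) = cubeWeight x i (δ i) := by
  classical
  rw [mass, cubePoint_eq, ← Finsupp.sum_finsetSum_index (fun _ => by simp)
    (fun v r s => by split_ifs <;> simp), ← sum_filter_prod_cubeWeight x i (δ i)]
  refine Finset.sum_congr rfl fun ε _ => ?_
  rw [Finsupp.sum_single_index (by simp)]
  simp only [hσ]

theorem exists_face_eq_and_eq {n : ℕ} {ψ : (Fin n → Bool) → W → P} (hψ : IsFaceMap ψ) {K L : W}
    (hKL : K ≠ L) (ε δ : Fin n → Bool) : ∃ η, ψ η L = ψ ε L ∧ ψ η K = ψ δ K := by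
  obtain ⟨σ, hσ, hσ'⟩ := hψ
  by_cases hL : L ∈ Set.range σ
  · obtain ⟨i, rfl⟩ := hL
    refine ⟨Function.update δ i (ε i), (hσ i _ _).2 (by simp), ?_⟩
    by_cases hK : K ∈ Set.range σ
    · obtain ⟨j, rfl⟩ := hK
      have hji : j ≠ i := fun h => hKL (congrArg σ h)
      exact (hσ j _ _).2 (Function.update_of_ne hji _ _)
    · exact hσ' K hK _ _
  · exact ⟨δ, hσ' L hL _ _, rfl⟩

theorem IsWallStructure.isConsistentMass_mass (hS : IsWallStructure Z side)
    (q : Z.Realization) : IsConsistentMass side (mass side q.1) where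
  congr := mass_congr
  nonneg := mass_nonneg q.isProb
  add_eq_one := mass_add_mass q.isProb hS.twoSided
  finite := hS.finite_mass_ne_one q.isProb
  exists_mem_inter {u v K L} hKL hL hK := by
    obtain ⟨n, φ, x, hφ, hq⟩ := q.2
    have hmem : ∀ {w M}, 0 < mass side q.1 w M → ∃ ε, side (φ ε) M = side w M := by
      intro w M hM
      have hne := mt (mass_eq_zero_iff q.isProb).2 hM.ne'
      push Not at hne
      obtain ⟨y, hy, hyw⟩ := hne
      rw [hq] at hy
      obtain ⟨ε, rfl⟩ := support_cubePoint_subset φ x hy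
      exact ⟨ε, hyw⟩
    obtain ⟨ε, hε⟩ := hmem hL
    obtain ⟨δ, hδ⟩ := hmem hK
    obtain ⟨η, hηL, hηK⟩ := exists_face_eq_and_eq (hS.isCube_iff.1 hφ) hKL ε δ
    exact ⟨φ η, hηL.trans hε, hηK.trans hδ⟩

theorem IsWallStructure.finprod_mass (hS : IsWallStructure Z side) (q : Z.Realization) (u : V) :
    ∏ᶠ K, mass side q.1 u K = q.1 u := by
  have hm := hS.isConsistentMass_mass q
  have hprob := q.isProb
  obtain ⟨n, φ, x, hφ, h⟩ := q.2
  rw [h] at hm hprob ⊢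
  obtain ⟨σ, hσ, hσ'⟩ := hS.isCube_iff.1 hφ
  refine (hm.cubePoint_eq_finprod hS hφ hσ hσ' (mass_cubePoint hσ x) (fun K hK ε => ?_) u).symm
  refine mass_eq_one hprob fun v hv => ?_
  obtain ⟨δ, rfl⟩ := support_cubePoint_subset φ x hv
  exact hσ' K hK δ ε

theorem IsWallStructure.spreadBeyond_sideSet_eq_zero (hS : IsWallStructure Z side)
    (q : Z.Realization) {u : V} {K : W} (hK : spread side q.1 u K ≠ 0) (v : V) :
    spreadBeyond side q.1 u (sideSet side v K) K = 0 := by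
  have hm := hS.isConsistentMass_mass q
  have hpos : ∀ {w M}, spread side q.1 u M ≠ 0 → 0 < mass side q.1 w M := fun {w M} hM => by
    rw [spread_eq q.isProb hS.twoSided u w] at hM
    exact (hm.nonneg w M).lt_of_ne' (left_ne_zero_of_mul hM)
  refine finsum_eq_zero_of_forall_eq_zero fun L => ?_
  split_ifs with hL
  · by_contra hLspread
    obtain ⟨w, hw⟩ := hS.exists_side_ne u L
    obtain ⟨x, hxL, hxK⟩ := hm.exists_mem_inter (u := u) (v := v)
      hL.1.symm (hpos hLspread) (hpos hK)
    obtain ⟨y, hyL, hyK⟩ := hm.exists_mem_inter (u := w) (v := v)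
      hL.1.symm (hpos hLspread) (hpos hK)
    exact hw (hxL.symm.trans ((hL.2 x hxK y hyK).trans hyL))
  · rfl

theorem IsWallStructure.retractMass_realization (hS : IsWallStructure Z side) (q : Z.Realization)
    (u : V) (K : W) : retractMass side q.1 u K = mass side q.1 u K := by
  by_cases hK : spread side q.1 u K = 0
  · rcases mul_eq_zero.1 hK with hzero | hone
    · rw [hzero, retractMass_eq_zero q.isProb hzero]
    · rw [sub_eq_zero, eq_comm] at hone
      rw [hone, hS.retractMass_eq_one q.isProb hone]
  · obtain ⟨v, hv⟩ := hS.exists_side_ne u K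
    rw [retractMass, compl_sideSet hS.twoSided hv, hS.spreadBeyond_sideSet_eq_zero q hK,
      hS.spreadBeyond_sideSet_eq_zero q hK]
    simp [mass_nonneg q.isProb, mass_le_one q.isProb]

theorem IsWallStructure.retract_realization (hS : IsWallStructure Z side) (q : Z.Realization)
    (hp : IsProb q.1) : hS.retract hp = q := by
  refine Subtype.ext (Finsupp.ext fun u => ?_)
  rw [hS.retract_apply, ← hS.finprod_mass q]
  simp_rw [hS.retractMass_realization]

theorem mass_mapDomain {V' W' P' : Type*} {side' : V' → W' → P'} (e : V → V') {u : V} {K : W}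
    {u' : V'} {K' : W'} (h : ∀ v, side' (e v) K' = side' u' K' ↔ side v K = side u K) :
    mass side' (p.mapDomain e) u' K' = mass side p u K := by
  classical
  rw [mass, mass, Finsupp.sum_mapDomain_index (by simp) (fun v r s => by split_ifs <;> simp)]
  refine Finsupp.sum_congr fun v _ => ?_
  simp only [h]

theorem retractMass_mapDomain (e : V ≃ V) (f : W ≃ W)
    (h : ∀ u v K, side (e u) (f K) = side (e v) (f K) ↔ side u K = side v K) (u : V) (K : W) :
    retractMass side (p.mapDomain e) (e u) (f K) = retractMass side p u K := by
  have hmass : ∀ L, mass side (p.mapDomain e) (e u) (f L) = mass side p u L := fun L =>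
    mass_mapDomain e fun v => h v u L
  have hspread : ∀ A : Set V, spreadBeyond side (p.mapDomain e) (e u) (e '' A) (f K) =
      spreadBeyond side p u A K := by
    intro A
    unfold spreadBeyond
    rw [← finsum_comp_equiv f]
    refine finsum_congr fun L => ?_
    have hiff : (f L ≠ f K ∧ ∀ x ∈ e '' A, ∀ y ∈ e '' A, side x (f L) = side y (f L)) ↔
        L ≠ K ∧ ∀ x ∈ A, ∀ y ∈ A, side x L = side y L := by
      rw [Ne, f.injective.eq_iff]
      simp only [Set.forall_mem_image, h]
    by_cases hL : L ≠ K ∧ ∀ x ∈ A, ∀ y ∈ A, side x L = side y L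
    · rw [if_pos hL, if_pos (hiff.2 hL), spread, spread, hmass]
    · rw [if_neg hL, if_neg (mt hiff.1 hL)]
  have hset : sideSet side (e u) (f K) = e '' sideSet side u K := by
    ext x
    obtain ⟨x, rfl⟩ := e.surjective x
    rw [e.injective.mem_set_image]
    exact h x u K
  rw [retractMass, retractMass, hmass, hset, ← Set.image_compl_eq e.bijective, hspread, hspread]

end Retract

section Topology

variable {V : Type u} {Z : CubeComplex V}

/-! ### Continuity of the retraction -/

theorem continuous_charMap {n : ℕ} (φ : {φ : (Fin n → Bool) → V // Z.IsCube n φ}) :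
    Continuous (Z.charMap φ) := by
  rw [continuous_iff_coinduced_le]
  exact le_iSup₂_of_le (f := fun (n : ℕ) (φ : {φ : (Fin n → Bool) → V // Z.IsCube n φ}) =>
    TopologicalSpace.coinduced (Z.charMap φ) inferInstance) n φ le_rfl

theorem continuous_of_charMap {X : Type*} [TopologicalSpace X] {f : Z.Realization → X}
    (h : ∀ (n : ℕ) (φ : {φ : (Fin n → Bool) → V // Z.IsCube n φ}), Continuous (f ∘ Z.charMap φ)) :
    Continuous f :=
  continuous_iSup_dom.2 fun n => continuous_iSup_dom.2 fun φ => continuous_coinduced_dom.2 (h n φ)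

theorem exists_charMap_eq (q : Z.Realization) :
    ∃ (n : ℕ) (φ : {φ : (Fin n → Bool) → V // Z.IsCube n φ}) (x : Fin n → unitInterval),
      q = Z.charMap φ x := by
  obtain ⟨n, φ, x, hφ, h⟩ := q.2
  exact ⟨n, ⟨φ, hφ⟩, x, Subtype.ext h⟩

-- The quotient topology on `Z.Realization` is compatible with products by exponentiability of `A`.
theorem continuous_prod_of_charMap {X A : Type*} [TopologicalSpace X] [TopologicalSpace A]
    [LocallyCompactSpace A] {f : Z.Realization × A → X}
    (h : ∀ (n : ℕ) (φ : {φ : (Fin n → Bool) → V // Z.IsCube n φ}),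
      Continuous fun y : (Fin n → unitInterval) × A => f (Z.charMap φ y.1, y.2)) :
    Continuous f := by
  have hf : ∀ q : Z.Realization, Continuous fun t => f (q, t) := by
    intro q
    obtain ⟨n, φ, x, rfl⟩ := exists_charMap_eq q
    exact (h n φ).comp (.prodMk_right x)
  let curried : Z.Realization → C(A, X) := fun q => ⟨fun t => f (q, t), hf q⟩
  have hcurried : Continuous curried := continuous_of_charMap fun n φ =>
    ContinuousMap.continuous_of_continuous_uncurry _ (h n φ)
  exact ContinuousMap.continuous_uncurry_of_continuous ⟨curried, hcurried⟩

theorem continuous_cubePoint_apply {n : ℕ} (φ : (Fin n → Bool) → V) (v : V) :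
    Continuous fun x : Fin n → unitInterval => cubePoint φ x v := by
  classical
  simp only [cubePoint_eq, Finsupp.finsetSum_apply, Finsupp.single_apply]
  refine continuous_finsetSum _ fun ε _ => ?_
  split_ifs
  · refine continuous_finsetProd _ fun i _ => ?_
    unfold cubeWeight
    split_ifs <;> fun_prop
  · fun_prop

theorem continuous_apply (v : V) : Continuous fun q : Z.Realization => q.1 v :=
  continuous_of_charMap fun _ φ => continuous_cubePoint_apply φ.1 v

theorem finite_cubes {F : Set V} (hF : F.Finite) :
    {c : Σ n, {φ : (Fin n → Bool) → V // Z.IsCube n φ} | Set.range c.2.1 ⊆ F}.Finite := by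
  have : Finite F := hF.to_subtype
  let restrict : {c : Σ n, {φ : (Fin n → Bool) → V // Z.IsCube n φ} | Set.range c.2.1 ⊆ F} →
      Σ n, (Fin n → Bool) → F := fun c => ⟨c.1.1, fun ε => ⟨c.1.2.1 ε, c.2 ⟨ε, rfl⟩⟩⟩
  have hdim : ∀ c, (restrict c).1 < Nat.card F + 1 := by
    rintro ⟨⟨n, φ⟩, hc⟩
    have hcard := Nat.card_le_card_of_injective (restrict ⟨⟨n, φ⟩, hc⟩).2
      fun ε δ hεδ => Z.injective φ.2 (congrArg Subtype.val hεδ)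
    rw [Nat.card_fun, Nat.card_eq_fintype_card (α := Bool), Fintype.card_bool,
      Nat.card_eq_fintype_card (α := Fin _), Fintype.card_fin] at hcard
    exact (Nat.lt_two_pow_self.trans_le hcard).trans (Nat.lt_succ_self _)
  refine Set.finite_coe_iff.1 (Finite.of_injective
    (fun c => (⟨⟨_, hdim c⟩, (restrict c).2⟩ : Σ n : Fin (Nat.card F + 1), (Fin n → Bool) → F)) ?_)
  rintro ⟨⟨n, φ, hφ⟩, hc⟩ ⟨⟨m, ψ, hψ⟩, hd⟩ h
  simp only [restrict, Sigma.mk.injEq, Fin.mk.injEq] at h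
  obtain ⟨rfl, h⟩ := h
  obtain rfl : φ = ψ := funext fun ε => congrArg Subtype.val (congrFun (eq_of_heq h) ε)
  rfl

variable {W : Type*} {P : Type*} {side : V → W → P}

theorem IsWallStructure.exists_carrier (hS : IsWallStructure Z side) (q : Z.Realization) :
    ∃ (n : ℕ) (φ : {φ : (Fin n → Bool) → V // Z.IsCube n φ}) (x : Fin n → unitInterval),
      q = Z.charMap φ x ∧ Set.range φ.1 ⊆ q.1.support := by
  obtain ⟨n, φ, t, hφ, ht, h⟩ := hS.exists_retract q.isProb
  have hq : q.1 = cubePoint φ t := by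
    refine Finsupp.ext fun u => ?_
    rw [h, ← hS.finprod_mass q]
    simp_rw [hS.retractMass_realization]
  refine ⟨n, ⟨φ, hφ⟩, t, Subtype.ext hq, ?_⟩
  rintro _ ⟨δ, rfl⟩
  rw [Finset.mem_coe, Finsupp.mem_support_iff, hq, cubePoint_apply (Z.injective hφ)]
  refine Finset.prod_ne_zero_iff.2 fun i _ => ?_
  have := ht i
  unfold cubeWeight
  split_ifs <;> linarith

/- The coordinates embed each closed cube as a compact subset of `V → ℝ`, and only finitely many
cubes are met. -/
theorem IsWallStructure.continuous_of_apply (hS : IsWallStructure Z side) {X : Type*}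
    [TopologicalSpace X] {f : X → Z.Realization} {F : Set V} (hF : F.Finite)
    (hsupp : ∀ x, ↑(f x).1.support ⊆ F) (h : ∀ v, Continuous fun x => (f x).1 v) :
    Continuous f := by
  rw [continuous_iff_isClosed]
  intro C hC
  have hpreimage : f ⁻¹' C = ⋃ c ∈ {c : Σ n, {φ : (Fin n → Bool) → V // Z.IsCube n φ} |
      Set.range c.2.1 ⊆ F}, {x | (fun v => (f x).1 v) ∈
        (fun y (v : V) => cubePoint c.2.1 y v) '' (Z.charMap c.2 ⁻¹' C)} := by
    ext x
    simp only [Set.mem_preimage, Set.mem_iUnion, Set.mem_image, Set.mem_ofPred_eq]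
    constructor
    · intro hx
      obtain ⟨n, φ, y, hy, hr⟩ := hS.exists_carrier (f x)
      exact ⟨⟨n, φ⟩, hr.trans (hsupp x), y, by rwa [← hy], by rw [hy]; rfl⟩
    · rintro ⟨c, -, y, hy, hyx⟩
      have : f x = Z.charMap c.2 y := Subtype.ext (Finsupp.ext fun v => (congrFun hyx v).symm)
      rwa [this]
  rw [hpreimage]
  refine (finite_cubes hF).isClosed_biUnion fun c _ => ?_
  refine IsClosed.preimage (continuous_pi h) (IsCompact.isClosed (IsCompact.image ?_ ?_))
  · exact (hC.preimage (continuous_charMap c.2)).isCompact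
  · exact continuous_pi fun v => continuous_cubePoint_apply c.2.1 v

section Clamp

variable {X : Type*} [TopologicalSpace X] {a r s : X → ℝ} {x₀ : X}

theorem continuousAt_clamp_of_eq_zero (ha : ContinuousAt a x₀) (hr : ContinuousAt r x₀)
    (ha_nonneg : ∀ x, 0 ≤ a x) (ha_le : ∀ x, a x ≤ 1) (hs_nonneg : ∀ x, 0 ≤ s x)
    (hr_nonneg : ∀ x, 0 ≤ r x) (ha₀ : a x₀ = 0) (hr₀ : r x₀ = 0) :
    ContinuousAt (fun x => max 0 (min 1 (a x + r x / (1 - a x) - s x / a x))) x₀ := by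
  have hupper : ContinuousAt (fun x => a x + r x / (1 - a x)) x₀ :=
    ha.add (hr.div (continuousAt_const.sub ha) (by simp [ha₀]))
  have hvalue : max 0 (min 1 (a x₀ + r x₀ / (1 - a x₀) - s x₀ / a x₀)) = 0 := by simp [ha₀, hr₀]
  rw [ContinuousAt, hvalue]
  rw [ContinuousAt, ha₀, hr₀, zero_div, add_zero] at hupper
  refine squeeze_zero (fun x => le_max_left _ _) (fun x => ?_) hupper
  have hr_div : 0 ≤ r x / (1 - a x) := div_nonneg (hr_nonneg x) (sub_nonneg.2 (ha_le x))
  have hs_div : 0 ≤ s x / a x := div_nonneg (hs_nonneg x) (ha_nonneg x)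
  exact max_le (add_nonneg (ha_nonneg x) hr_div) ((min_le_right _ _).trans (by linarith))

theorem continuousAt_clamp_of_eq_one (ha : ContinuousAt a x₀) (hs : ContinuousAt s x₀)
    (ha_le : ∀ x, a x ≤ 1) (hr_nonneg : ∀ x, 0 ≤ r x) (ha₀ : a x₀ = 1) (hs₀ : s x₀ = 0) :
    ContinuousAt (fun x => max 0 (min 1 (a x + r x / (1 - a x) - s x / a x))) x₀ := by
  have hlower : ContinuousAt (fun x => min 1 (a x - s x / a x)) x₀ :=
    continuousAt_const.min (ha.sub (hs.div ha (by simp [ha₀])))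
  have hvalue : max 0 (min 1 (a x₀ + r x₀ / (1 - a x₀) - s x₀ / a x₀)) = 1 := by simp [ha₀, hs₀]
  rw [ContinuousAt, hvalue]
  rw [ContinuousAt, ha₀, hs₀, zero_div, sub_zero, min_self] at hlower
  refine tendsto_of_tendsto_of_tendsto_of_le_of_le hlower tendsto_const_nhds (fun x => ?_)
    (fun x => max_le zero_le_one (min_le_left _ _))
  have hr_div : 0 ≤ r x / (1 - a x) := div_nonneg (hr_nonneg x) (sub_nonneg.2 (ha_le x))
  exact (min_le_min le_rfl (by linarith)).trans (le_max_right _ _)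

theorem continuousAt_clamp (ha : ContinuousAt a x₀) (hs : ContinuousAt s x₀)
    (hr : ContinuousAt r x₀) (ha_nonneg : ∀ x, 0 ≤ a x) (ha_le : ∀ x, a x ≤ 1)
    (hs_nonneg : ∀ x, 0 ≤ s x) (hr_nonneg : ∀ x, 0 ≤ r x) (hr₀ : a x₀ = 0 → r x₀ = 0)
    (hs₀ : a x₀ = 1 → s x₀ = 0) :
    ContinuousAt (fun x => max 0 (min 1 (a x + r x / (1 - a x) - s x / a x))) x₀ := by
  by_cases hzero : a x₀ = 0
  · exact continuousAt_clamp_of_eq_zero ha hr ha_nonneg ha_le hs_nonneg hr_nonneg hzero (hr₀ hzero)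
  by_cases hone : a x₀ = 1
  · exact continuousAt_clamp_of_eq_one ha hs ha_le hr_nonneg hone (hs₀ hone)
  · exact continuousAt_const.max (continuousAt_const.min ((ha.add (hr.div
      (continuousAt_const.sub ha) (sub_ne_zero.2 (Ne.symm hone)))).sub (hs.div ha hzero)))

end Clamp

section Continuity

variable {X : Type*} [TopologicalSpace X] {p : X → V →₀ ℝ} {F : Set V}

theorem continuous_mass (hF : F.Finite) (hsupp : ∀ x, ↑(p x).support ⊆ F)
    (hc : ∀ v, Continuous fun x => p x v) (u : V) (K : W) :
    Continuous fun x => mass side (p x) u K := by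
  classical
  have hsupp' : ∀ x, (p x).support ⊆ hF.toFinset := fun x v hv => hF.mem_toFinset.2 (hsupp x hv)
  simp only [fun x => mass_eq_sum (hsupp' x) (side := side) u K]
  refine continuous_finsetSum _ fun v _ => ?_
  split_ifs
  · exact hc v
  · fun_prop

theorem IsWallStructure.continuous_spreadBeyond (hS : IsWallStructure Z side) (hF : F.Finite)
    (hsupp : ∀ x, ↑(p x).support ⊆ F) (hp : ∀ x, IsProb (p x))
    (hc : ∀ v, Continuous fun x => p x v) (u : V) (A : Set V) (K : W) :
    Continuous fun x => spreadBeyond side (p x) u A K := by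
  classical
  obtain ⟨T, hT⟩ := exists_finset_separating hS.finite hF
  simp only [fun x => spreadBeyond_eq_sum (hp x) (hsupp x) (T := T)
    (fun K a ha b hb h => (hT K).2 ⟨a, ha, b, hb, h⟩) u A K]
  refine continuous_finsetSum _ fun L _ => ?_
  have := continuous_mass (side := side) hF hsupp hc u L
  unfold spread
  split_ifs <;> fun_prop

theorem IsWallStructure.continuous_retractMass (hS : IsWallStructure Z side) (hF : F.Finite)
    (hsupp : ∀ x, ↑(p x).support ⊆ F) (hp : ∀ x, IsProb (p x))
    (hc : ∀ v, Continuous fun x => p x v) (u : V) (K : W) :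
    Continuous fun x => retractMass side (p x) u K := by
  have hspread := fun A => hS.continuous_spreadBeyond hF hsupp hp hc u A K
  refine continuous_iff_continuousAt.2 fun x₀ => continuousAt_clamp
    (continuous_mass hF hsupp hc u K).continuousAt
    (hspread _).continuousAt (hspread _).continuousAt
    (fun x => mass_nonneg (hp x) u K) (fun x => mass_le_one (hp x) u K)
    (fun x => spreadBeyond_nonneg (hp x) u _ K) (fun x => spreadBeyond_nonneg (hp x) u _ K)
    (fun hzero => ?_) (fun hone => ?_)
  · exact spreadBeyond_eq_zero (hp x₀) ((mass_eq_zero_iff (hp x₀)).1 hzero) u K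
  · obtain ⟨v, hv⟩ := hS.exists_side_ne u K
    have hzero : mass side (p x₀) v K = 0 := by
      linarith [mass_add_mass (hp x₀) hS.twoSided hv]
    refine spreadBeyond_eq_zero (hp x₀) ?_ u K
    rw [← compl_compl (sideSet side u K), compl_sideSet hS.twoSided hv]
    exact (mass_eq_zero_iff (hp x₀)).1 hzero

theorem IsWallStructure.finite_setOf_side_eq (hS : IsWallStructure Z side) (x₀ : V)
    (T : Finset W) : {u | ∀ K, K ∉ T → side u K = side x₀ K}.Finite := by
  refine Set.Finite.of_finite_image (f := fun u => {K | K ∈ T ∧ side u K = side x₀ K}) ?_ ?_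
  · refine (T.finite_toSet.powerset).subset ?_
    rintro _ ⟨u, -, rfl⟩
    exact fun K hK => hK.1
  · intro u hu v hv huv
    refine hS.ext fun K => ?_
    by_cases hK : K ∈ T
    · have hiff := Set.ext_iff.1 huv K
      simp only [Set.mem_ofPred_eq, hK, true_and] at hiff
      rcases hS.twoSided K u v x₀ with h | h | h
      · exact h
      · exact h.trans (hiff.1 h).symm
      · exact (hiff.2 h).trans h.symm
    · exact (hu K hK).trans (hv K hK).symm

theorem IsWallStructure.exists_support_retract_subset (hS : IsWallStructure Z side)
    (hF : F.Finite) : ∃ F' : Set V, F'.Finite ∧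
      ∀ (p : V →₀ ℝ) (hp : IsProb p), ↑p.support ⊆ F → ↑(hS.retract hp).1.support ⊆ F' := by
  rcases F.eq_empty_or_nonempty with rfl | ⟨x₀, hx₀⟩
  · exact ⟨∅, Set.finite_empty, fun p hp h =>
      absurd (h hp.support_nonempty.choose_spec) (Set.notMem_empty _)⟩
  obtain ⟨T, hT⟩ := exists_finset_separating hS.finite hF
  refine ⟨_, hS.finite_setOf_side_eq x₀ T, fun p hp hsupp u hu K hK => ?_⟩
  by_contra hne
  have hmass : mass side p x₀ K = 1 := mass_eq_one hp fun v hv => by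
    by_contra h
    exact hK ((hT K).2 ⟨v, hsupp hv, x₀, hx₀, h⟩)
  have hzero : retractMass side p u K = 0 := by
    linarith [retractMass_add_retractMass hp hS.twoSided hne, hS.retractMass_eq_one hp hmass]
  rw [Finset.mem_coe, Finsupp.mem_support_iff, hS.retract_apply] at hu
  exact hu (finprod_eq_zero_of_eq_zero ((hS.isConsistentMass_retractMass hp).finite u) hzero)

theorem IsWallStructure.continuous_retract (hS : IsWallStructure Z side) (hF : F.Finite)
    (hsupp : ∀ x, ↑(p x).support ⊆ F) (hp : ∀ x, IsProb (p x))
    (hc : ∀ v, Continuous fun x => p x v) :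
    Continuous fun x => hS.retract (hp x) := by
  obtain ⟨F', hF', h⟩ := hS.exists_support_retract_subset hF
  refine hS.continuous_of_apply hF' (fun x => h _ (hp x) (hsupp x)) fun u => ?_
  obtain ⟨T, hT⟩ := exists_finset_separating hS.finite (hF.insert u)
  have hprod : ∀ x, (hS.retract (hp x)).1 u = ∏ K ∈ T, retractMass side (p x) u K := by
    intro x
    rw [hS.retract_apply]
    refine finprod_eq_prod_of_mulSupport_subset _ fun K hK => ?_
    by_contra hKT
    refine hK (hS.retractMass_eq_one (hp x) (mass_eq_one (hp x) fun v hv => ?_))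
    by_contra hne
    exact hKT ((hT K).2 ⟨v, .inr (hsupp x hv), u, .inl rfl, hne⟩)
  simp only [hprod]
  exact continuous_finsetProd _ fun K _ => hS.continuous_retractMass hF hsupp hp hc u K

end Continuity

end Topology

section Equivariance

variable {V : Type u} {W : Type*} {P : Type*} {side : V → W → P} {Z : CubeComplex V}
  {p : V →₀ ℝ} {G : Type w} [Group G] [MulAction G V] [CubicalAction G Z]

theorem Realization.coe_smul (g : G) (q : Z.Realization) : (g • q).1 = q.1.mapDomain (g • ·) := rfl

theorem smul_charMap (g : G) {n : ℕ} (φ : {φ : (Fin n → Bool) → V // Z.IsCube n φ})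
    (x : Fin n → unitInterval) :
    g • Z.charMap φ x = Z.charMap ⟨fun ε => g • φ.1 ε, CubicalAction.smul_isCube g φ.2⟩ x :=
  Subtype.ext (mapDomain_cubePoint _ _ _)

instance : ContinuousConstSMul G Z.Realization where
  continuous_const_smul g := continuous_of_charMap fun n φ => by
    simp only [Function.comp_def, smul_charMap]
    exact continuous_charMap _

theorem IsWallStructure.retract_congr (hS : IsWallStructure Z side) {p q : V →₀ ℝ} (hp : IsProb p)
    (hq : IsProb q) (h : p = q) : hS.retract hp = hS.retract hq := by
  subst h
  rfl

theorem IsWallStructure.retract_smul [MulAction G W] (hS : IsWallStructure Z side)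
    (h : ∀ (g : G) u v K, side (g • u) (g • K) = side (g • v) (g • K) ↔ side u K = side v K)
    (hp : IsProb p) (g : G) (hgp : IsProb (p.mapDomain (g • ·))) :
    hS.retract hgp = g • hS.retract hp := by
  refine Subtype.ext (Finsupp.ext fun u => ?_)
  obtain ⟨u, rfl⟩ := MulAction.surjective g u
  rw [hS.retract_apply, Realization.coe_smul, Finsupp.mapDomain_apply (MulAction.injective g),
    hS.retract_apply, ← finprod_comp_equiv (MulAction.toPerm g)]
  exact finprod_congr fun K =>
    retractMass_mapDomain (MulAction.toPerm g) (MulAction.toPerm g) (h g) u K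

end Equivariance

/-! ### The collapse -/

theorem cubePoint_comp {V : Type*} {m n : ℕ} (ψ : (Fin m → Bool) → V) {τ : Fin m → Fin n}
    (hτ : Function.Injective τ) (x : Fin n → unitInterval) :
    cubePoint (fun ε => ψ (ε ∘ τ)) x = cubePoint ψ (x ∘ τ) := by
  classical
  rw [cubePoint_eq, cubePoint_eq, ← Finset.sum_fiberwise Finset.univ fun ε : Fin n → Bool => ε ∘ τ]
  refine Finset.sum_congr rfl fun δ _ => ?_
  have hvertex : ∀ ε ∈ Finset.univ.filter (fun ε : Fin n → Bool => ε ∘ τ = δ),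
      Finsupp.single (ψ (ε ∘ τ)) (∏ i, cubeWeight x i (ε i)) =
        Finsupp.single (ψ δ) (∏ i, cubeWeight x i (ε i)) := by
    intro ε hε
    rw [(Finset.mem_filter.1 hε).2]
  rw [Finset.sum_congr rfl hvertex, ← Finsupp.single_finsetSum]
  congr 1
  have hface : Finset.univ.filter (fun ε : Fin n → Bool => ε ∘ τ = δ) =
      Fintype.piFinset fun i => Finset.univ.filter fun b => ∀ j, τ j = i → b = δ j := by
    ext ε
    simp only [Finset.mem_filter, Finset.mem_univ, true_and, Fintype.mem_piFinset, funext_iff,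
      Function.comp_apply]
    exact ⟨fun h i j hj => hj ▸ h j, fun h j => h _ j rfl⟩
  rw [hface, ← Finset.prod_univ_sum]
  symm
  refine Fintype.prod_of_injective τ hτ _ _ (fun i hi => ?_) fun j => ?_
  · rw [Finset.filter_true_of_mem fun b _ j hj => (hi ⟨j, hj⟩).elim, sum_cubeWeight]
  · have hfixed : Finset.univ.filter (fun b => ∀ k, τ k = τ j → b = δ k) = {δ j} := by
      ext b
      simp only [Finset.mem_filter, Finset.mem_univ, true_and, Finset.mem_singleton]
      exact ⟨fun h => h j rfl, fun h k hk => hτ hk ▸ h⟩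
    rw [hfixed, Finset.sum_singleton]
    rfl

section Collapse

variable {V : Type u} {Z : CubeComplex V}

theorem side_eq_of_mem_halfspaces {H : Z.Hyperplane} {s : Set V} (hs : s ∈ H.halfspaces) {a : V}
    (ha : a ∈ s) : H.side a = s := by
  obtain ⟨b, rfl⟩ := hs
  exact Hyperplane.mem_side_iff.1 ha

theorem isWallStructure_side (hZ : Z.IsCAT0) :
    IsWallStructure Z fun a (H : Z.Hyperplane) => H.side a where
  isCube_iff := isCube_iff_isFaceMap hZ
  ext := eq_of_side_eq hZ
  finite a b := (finite_sides hZ.connected a b).subset fun H hH hb =>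
    hH (Hyperplane.mem_side_iff.1 hb).symm
  twoSided := side_trichotomy hZ
  exists_vertex x a hfin hpair := by
    obtain ⟨v, hv⟩ := exists_common_vertex hZ Set.univ x (fun H _ K _ => hpair H K) a
      (hfin.subset fun H hH => hH.2)
    exact ⟨v, fun K => hv K trivial⟩
  exists_edge K := by
    obtain ⟨a, b, hab⟩ := K.exists_dual
    exact ⟨a, b, side_ne_of_mem_dual hZ hab, fun L hL => side_eq_of_mem_dual hZ hab hL⟩

variable {G : Type w} [Group G] [MulAction G V] [CubicalAction G Z]

theorem smul_side_eq_iff (g : G) (a b : V) (H : Z.Hyperplane) :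
    (g • H).side (g • a) = (g • H).side (g • b) ↔ H.side a = H.side b := by
  rw [← smul_side, ← smul_side]
  exact (MulAction.injective g).eq_iff

theorem smul_choice_eq_iff {𝓗 : SubMulAction G Z.Hyperplane} (g : G) (a b : CollapseVertex 𝓗)
    (K : ↥(𝓗ᶜ)) :
    (g • a).choice (g • K) = (g • b).choice (g • K) ↔ a.choice K = b.choice K := by
  change g • a.choice (g⁻¹ • g • K) = g • b.choice (g⁻¹ • g • K) ↔ _
  rw [inv_smul_smul]
  exact (MulAction.injective g).eq_iff

variable (hZ : Z.IsCAT0) (𝓗 : SubMulAction G Z.Hyperplane)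

include hZ in
theorem isWallStructure_choice :
    IsWallStructure (collapseRange 𝓗) fun a K => a.choice K where
  isCube_iff := Iff.rfl
  ext h := SageevVertex.ext (funext h)
  finite a b := by
    obtain ⟨z⟩ := hZ.connected.nonempty
    refine ((a.finite z).union (b.finite z)).subset fun K hK => ?_
    by_contra h
    rw [Set.mem_union, not_or, Set.mem_ofPred_eq, Set.mem_ofPred_eq, not_not, not_not] at h
    exact hK ((side_eq_of_mem_halfspaces (a.choice_mem K) h.1).symm.trans
      (side_eq_of_mem_halfspaces (b.choice_mem K) h.2))
  twoSided K a b c := by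
    obtain ⟨a', ha⟩ := a.choice_mem K
    obtain ⟨b', hb⟩ := b.choice_mem K
    obtain ⟨c', hc⟩ := c.choice_mem K
    simp only [← ha, ← hb, ← hc]
    exact side_trichotomy hZ K.1 a' b' c'
  exists_vertex x a hfin hpair := by
    refine ⟨⟨x, fun K => ?_, fun K L => ?_, fun b => ?_⟩, fun K => rfl⟩
    · obtain ⟨v, hv, -⟩ := hpair K K
      exact hv ▸ v.choice_mem K
    · obtain ⟨v, hK, hL⟩ := hpair K L
      rw [← hK, ← hL]
      exact v.inter K L
    · refine (hfin.union (a.finite b)).subset fun K hK => ?_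
      by_cases h : a.choice K = x K
      · exact .inr (by rw [Set.mem_ofPred_eq, h]; exact hK)
      · exact .inl h
  exists_edge K := by
    obtain ⟨a, b, hab⟩ := K.1.exists_dual
    exact ⟨collapse hZ 𝓗 a, collapse hZ 𝓗 b, side_ne_of_mem_dual hZ hab, fun L hL =>
      side_eq_of_mem_dual hZ hab fun h => hL (Subtype.ext h)⟩

theorem smul_collapse (g : G) (a : V) : collapse hZ 𝓗 (g • a) = g • collapse hZ 𝓗 a := by
  refine SageevVertex.ext (funext fun K => ?_)
  change K.1.side (g • a) = g • (g⁻¹ • K.1).side a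
  rw [smul_side, smul_inv_smul]

theorem collapse_eq_iff {a b : V} :
    collapse hZ 𝓗 a = collapse hZ 𝓗 b ↔ ∀ H : Z.Hyperplane, H ∉ 𝓗 → H.side a = H.side b :=
  ⟨fun h H hH => congrFun (congrArg SageevVertex.choice h) ⟨H, hH⟩,
    fun h => SageevVertex.ext (funext fun K => h K.1 K.2)⟩

theorem collapse_surjective : Function.Surjective (collapse hZ 𝓗) := by
  classical
  intro y
  obtain ⟨a⟩ := hZ.connected.nonempty
  let x : Z.Hyperplane → Set V := fun H => if h : H ∉ 𝓗 then y.choice ⟨H, h⟩ else ∅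
  have hx : ∀ (H : Z.Hyperplane) (h : H ∉ 𝓗), x H = y.choice ⟨H, h⟩ := fun H h => dif_pos h
  have hpair : ∀ H ∈ {H | H ∉ 𝓗}, ∀ K ∈ {H | H ∉ 𝓗}, ∃ v, H.side v = x H ∧ K.side v = x K := by
    intro H hH K hK
    rw [hx H hH, hx K hK]
    obtain ⟨z, hzH, hzK⟩ := y.inter ⟨H, hH⟩ ⟨K, hK⟩
    exact ⟨z, side_eq_of_mem_halfspaces (y.choice_mem _) hzH,
      side_eq_of_mem_halfspaces (y.choice_mem _) hzK⟩
  have hfin : {H | H ∈ {H | H ∉ 𝓗} ∧ H.side a ≠ x H}.Finite := by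
    refine (Set.Finite.image Subtype.val (y.finite a)).subset ?_
    rintro H ⟨hH, hne⟩
    rw [hx H hH] at hne
    exact ⟨⟨H, hH⟩, fun h => hne (side_eq_of_mem_halfspaces (y.choice_mem _) h), rfl⟩
  obtain ⟨v, hv⟩ := exists_common_vertex hZ {H | H ∉ 𝓗} x hpair a hfin
  exact ⟨v, SageevVertex.ext (funext fun K => (hv K.1 K.2).trans (hx K.1 K.2))⟩

/- The collapse projects a cube onto the face spanned by its directions outside `𝓗`. -/
theorem exists_cube_collapse {n : ℕ} {φ : (Fin n → Bool) → V} (hφ : Z.IsCube n φ) :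
    ∃ (m : ℕ) (ψ : (Fin m → Bool) → CollapseVertex 𝓗) (τ : Fin m → Fin n),
      (collapseRange 𝓗).IsCube m ψ ∧ Function.Injective τ ∧
        ∀ ε, collapse hZ 𝓗 (φ ε) = ψ (ε ∘ τ) := by
  obtain ⟨σ, hσ, hσ'⟩ := (isCube_iff_isFaceMap hZ).1 hφ
  obtain ⟨m, τ, hτ, hrange⟩ := (Set.toFinite {i | σ i ∉ 𝓗}).fin_param
  have hτ_iff : ∀ i, i ∈ Set.range τ ↔ σ i ∉ 𝓗 := fun i => by rw [hrange]; rfl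
  let lift : (Fin m → Bool) → Fin n → Bool := fun δ => Function.extend τ δ fun _ => false
  have hlift : ∀ δ j, lift δ (τ j) = δ j := fun δ j => hτ.extend_apply _ _ j
  refine ⟨m, fun δ => collapse hZ 𝓗 (φ (lift δ)), τ,
    ⟨⟨fun j => ⟨σ (τ j), (hτ_iff _).1 ⟨j, rfl⟩⟩, fun i j hij => ?_⟩, fun j δ δ' => ?_,
      fun K hK δ δ' => ?_⟩, hτ, fun ε => ?_⟩
  · exact hτ (σ.injective (congrArg Subtype.val hij))
  · refine (hσ (τ j) _ _).trans ?_
    rw [hlift, hlift]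
  · refine hσ' K.1 ?_ _ _
    rintro ⟨i, hi⟩
    obtain ⟨j, rfl⟩ := (hτ_iff i).2 (hi ▸ K.2)
    exact hK ⟨j, Subtype.ext hi⟩
  · refine (collapse_eq_iff hZ 𝓗).2 fun H hH => ?_
    by_cases hHσ : H ∈ Set.range σ
    · obtain ⟨i, rfl⟩ := hHσ
      obtain ⟨j, rfl⟩ := (hτ_iff i).2 hH
      rw [hσ, hlift]
      rfl
    · exact hσ' H hHσ _ _

/-- The cellular map extending the collapse of vertices affinely to all cubes. -/
noncomputable def collapseMap (p : Z.Realization) : (collapseRange 𝓗).Realization :=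
  ⟨p.1.mapDomain (collapse hZ 𝓗), by
    obtain ⟨n, φ, x, hφ, hp⟩ := p.2
    obtain ⟨m, ψ, τ, hψ, hτ, h⟩ := exists_cube_collapse hZ 𝓗 hφ
    refine ⟨m, ψ, x ∘ τ, hψ, ?_⟩
    rw [hp, mapDomain_cubePoint, ← cubePoint_comp ψ hτ]
    exact congrArg (cubePoint · x) (funext h)⟩

theorem coe_collapseMap (p : Z.Realization) :
    (collapseMap hZ 𝓗 p).1 = p.1.mapDomain (collapse hZ 𝓗) := rfl

theorem isCollapseImage_iff {p : Z.Realization} {q : (collapseRange 𝓗).Realization} :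
    IsCollapseImage hZ 𝓗 p q ↔ q = collapseMap hZ 𝓗 p :=
  (Subtype.ext_iff (a1 := q) (a2 := collapseMap hZ 𝓗 p)).symm

theorem continuous_collapseMap : Continuous (collapseMap hZ 𝓗) := by
  refine continuous_of_charMap fun n φ => ?_
  have hcoe : ∀ x, ((collapseMap hZ 𝓗 ∘ Z.charMap φ) x).1 = cubePoint (collapse hZ 𝓗 ∘ φ.1) x :=
    fun x => mapDomain_cubePoint _ _ _
  refine (isWallStructure_choice hZ 𝓗).continuous_of_apply
    (Set.finite_range (collapse hZ 𝓗 ∘ φ.1)) (fun x => ?_) fun v => ?_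
  · rw [hcoe]
    exact support_cubePoint_subset _ _
  · simp only [hcoe]
    exact continuous_cubePoint_apply _ _

theorem collapseMap_smul (g : G) (p : Z.Realization) :
    collapseMap hZ 𝓗 (g • p) = g • collapseMap hZ 𝓗 p := by
  refine Subtype.ext ?_
  rw [Realization.coe_smul, coe_collapseMap, coe_collapseMap, Realization.coe_smul,
    ← Finsupp.mapDomain_comp, ← Finsupp.mapDomain_comp]
  congr 1
  exact funext (smul_collapse hZ 𝓗 g)

end Collapse

/-! ### Homotopies of orbit spaces -/

section OrbitSpace

variable {G X Y : Type*} [Group G] [TopologicalSpace X] [TopologicalSpace Y] [MulAction G X]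
  [MulAction G Y]

/-- The map of orbit spaces induced by an equivariant map. -/
def orbitSpaceMap (f : X → Y) (hf : Continuous f) (h : ∀ (g : G) x, f (g • x) = g • f x) :
    C(Quotient (MulAction.orbitRel G X), Quotient (MulAction.orbitRel G Y)) where
  toFun := Quotient.map f (by
    rintro _ b ⟨g, rfl⟩
    exact ⟨g, (h g b).symm⟩)
  continuous_toFun := hf.quotient_map' _

theorem orbitSpaceMap_id :
    orbitSpaceMap id continuous_id (fun (_ : G) (_ : X) => rfl) = ContinuousMap.id _ :=
  ContinuousMap.ext fun q => Quotient.inductionOn q fun _ => rfl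

theorem orbitSpaceMap_comp {Y' : Type*} [TopologicalSpace Y'] [MulAction G Y'] {f : X → Y}
    {f' : Y → Y'} (hf : Continuous f) (hf' : Continuous f')
    (h : ∀ (g : G) x, f (g • x) = g • f x) (h' : ∀ (g : G) y, f' (g • y) = g • f' y) :
    (orbitSpaceMap f' hf' h').comp (orbitSpaceMap f hf h) =
      orbitSpaceMap (f' ∘ f) (hf'.comp hf)
        (fun g x => (congrArg f' (h g x)).trans (h' g (f x))) :=
  ContinuousMap.ext fun q => Quotient.inductionOn q fun _ => rfl

theorem orbitSpaceMap_homotopic [ContinuousConstSMul G X] {f₀ f₁ : X → Y} (hf₀ : Continuous f₀)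
    (h₀ : ∀ (g : G) x, f₀ (g • x) = g • f₀ x) (hf₁ : Continuous f₁)
    (h₁ : ∀ (g : G) x, f₁ (g • x) = g • f₁ x) (F : X × unitInterval → Y) (hF : Continuous F)
    (hF_smul : ∀ (g : G) x t, F (g • x, t) = g • F (x, t)) (hF_zero : ∀ x, F (x, 0) = f₀ x)
    (hF_one : ∀ x, F (x, 1) = f₁ x) :
    (orbitSpaceMap f₀ hf₀ h₀).Homotopic (orbitSpaceMap f₁ hf₁ h₁) := by
  refine ⟨⟨⟨fun p => Quotient.map (fun x => F (x, p.1)) ?_ p.2, ?_⟩,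
    fun q => Quotient.inductionOn q fun x => congrArg _ (hF_zero x),
    fun q => Quotient.inductionOn q fun x => congrArg _ (hF_one x)⟩⟩
  · rintro _ b ⟨g, rfl⟩
    exact ⟨g, (hF_smul g b p.1).symm⟩
  · have hmk : IsOpenQuotientMap (Quotient.mk (MulAction.orbitRel G X)) :=
      MulAction.isOpenQuotientMap_quotientMk
    have hprod := (IsOpenQuotientMap.id (X := unitInterval)).prodMap hmk
    rw [hprod.isQuotientMap.continuous_iff]
    exact continuous_quotient_mk'.comp (hF.comp continuous_swap)

end OrbitSpace

theorem exists_equivariant_of_free {G A B : Type*} [Group G] [MulAction G A] [MulAction G B]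
    (h : ∀ (g : G) (b : B), g • b = b → g = 1) (a : A) :
    ∃ z : B → A, ∀ (g : G) b, z (g • b) = g • z b := by
  let r : B → B := fun b => (Quotient.mk (MulAction.orbitRel G B) b).out
  have hr : ∀ b, ∃ g : G, g • r b = b := fun b =>
    Setoid.symm' _ (Quotient.mk_out (s := MulAction.orbitRel G B) b)
  choose k hk using hr
  refine ⟨fun b => k b • a, fun g b => ?_⟩
  have hr_smul : r (g • b) = r b := congrArg Quotient.out (Quotient.sound ⟨g, rfl⟩)
  have hfix : ((g * k b)⁻¹ * k (g • b)) • r b = r b := by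
    rw [mul_smul, ← hr_smul, hk, hr_smul, inv_smul_eq_iff, mul_smul, hk]
  change k (g • b) • a = g • k b • a
  rw [← inv_mul_eq_one.1 (h _ _ hfix), mul_smul]

/-! ### Equivariant straight line homotopies -/

/-- The image of every finite subcomplex is contained in a finite subcomplex. With weak topologies,
this makes the straight line homotopy to the map continuous. -/
def IsFinitary {V V' : Type*} {Z : CubeComplex V} {Z' : CubeComplex V'}
    (f : Z.Realization → Z'.Realization) : Prop :=
  ∀ F : Set V, F.Finite → ∃ F' : Set V', F'.Finite ∧ ∀ q : Z.Realization, ↑q.1.support ⊆ F →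
    ↑(f q).1.support ⊆ F'

theorem IsFinitary.comp {V V' V'' : Type*} {Z : CubeComplex V} {Z' : CubeComplex V'}
    {Z'' : CubeComplex V''} {f' : Z'.Realization → Z''.Realization}
    {f : Z.Realization → Z'.Realization} (hf' : IsFinitary f') (hf : IsFinitary f) :
    IsFinitary (f' ∘ f) := by
  intro F hF
  obtain ⟨F₁, hF₁, h₁⟩ := hf F hF
  obtain ⟨F₂, hF₂, h₂⟩ := hf' F₁ hF₁
  exact ⟨F₂, hF₂, fun q hq => h₂ _ (h₁ q hq)⟩

section StraightLine

variable {V : Type u} {W : Type*} {P : Type*} {side : V → W → P} {Z : CubeComplex V}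

/-- The straight line homotopy from the identity to `f`: the convex combination of `q` and `f q`,
retracted to the complex. -/
noncomputable def IsWallStructure.straightLine (hS : IsWallStructure Z side)
    (f : Z.Realization → Z.Realization) (q : Z.Realization × unitInterval) : Z.Realization :=
  hS.retract (q.1.isProb.convexComb (f q.1).isProb q.2.2.1 q.2.2.2)

theorem IsWallStructure.straightLine_zero (hS : IsWallStructure Z side)
    (f : Z.Realization → Z.Realization) (q : Z.Realization) : hS.straightLine f (q, 0) = q :=
  (hS.retract_congr _ q.isProb (by simp)).trans (hS.retract_realization q _)

theorem IsWallStructure.straightLine_one (hS : IsWallStructure Z side)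
    (f : Z.Realization → Z.Realization) (q : Z.Realization) : hS.straightLine f (q, 1) = f q :=
  (hS.retract_congr _ (f q).isProb (by simp)).trans (hS.retract_realization (f q) _)

theorem IsWallStructure.straightLine_smul {G : Type*} [Group G] [MulAction G V]
    [CubicalAction G Z] [MulAction G W] (hS : IsWallStructure Z side)
    (h : ∀ (g : G) u v K, side (g • u) (g • K) = side (g • v) (g • K) ↔ side u K = side v K)
    {f : Z.Realization → Z.Realization} (hf : ∀ (g : G) q, f (g • q) = g • f q) (g : G)
    (q : Z.Realization) (t : unitInterval) :
    hS.straightLine f (g • q, t) = g • hS.straightLine f (q, t) := by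
  refine (hS.retract_congr _ (IsProb.mapDomain (q.isProb.convexComb
    (f q).isProb t.2.1 t.2.2) _) ?_).trans (hS.retract_smul h _ g _)
  simp only [hf]
  rw [Realization.coe_smul, Realization.coe_smul, Finsupp.mapDomain_add, Finsupp.mapDomain_smul,
    Finsupp.mapDomain_smul]

theorem IsWallStructure.continuous_straightLine (hS : IsWallStructure Z side)
    {f : Z.Realization → Z.Realization} (hf : Continuous f) (hfin : IsFinitary f) :
    Continuous (hS.straightLine f) := by
  classical
  refine continuous_prod_of_charMap fun n φ => ?_
  obtain ⟨F, hF, h⟩ := hfin (Set.range φ.1) (Set.finite_range _)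
  refine hS.continuous_retract (F := Set.range φ.1 ∪ F) ((Set.finite_range _).union hF)
    (fun x => ?_) _ fun v => ?_
  · refine (Finset.coe_subset.2 Finsupp.support_add).trans ?_
    rw [Finset.coe_union]
    exact Set.union_subset_union
      ((Finset.coe_subset.2 Finsupp.support_smul).trans (support_cubePoint_subset _ _))
      ((Finset.coe_subset.2 Finsupp.support_smul).trans (h _ (support_cubePoint_subset _ _)))
  · simp only [Finsupp.add_apply, Finsupp.smul_apply, smul_eq_mul]
    have hsource : Continuous fun x : (Fin n → unitInterval) × unitInterval =>
        cubePoint φ.1 x.1 v := (continuous_cubePoint_apply φ.1 v).comp continuous_fst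
    have htarget : Continuous fun x : (Fin n → unitInterval) × unitInterval =>
        (f (Z.charMap φ x.1)).1 v :=
      ((continuous_apply v).comp (hf.comp (continuous_charMap φ))).comp continuous_fst
    have htime : Continuous fun x : (Fin n → unitInterval) × unitInterval => (x.2 : ℝ) := by
      fun_prop
    exact ((continuous_const.sub htime).mul hsource).add (htime.mul htarget)

theorem IsWallStructure.orbitSpaceMap_homotopic_id {G : Type w} [Group G] [MulAction G V]
    [CubicalAction G Z] [MulAction G W] (hS : IsWallStructure Z side)
    (h : ∀ (g : G) u v K, side (g • u) (g • K) = side (g • v) (g • K) ↔ side u K = side v K)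
    {f : Z.Realization → Z.Realization} (hf : Continuous f) (hfin : IsFinitary f)
    (hf_smul : ∀ (g : G) q, f (g • q) = g • f q) :
    (orbitSpaceMap f hf hf_smul).Homotopic (ContinuousMap.id _) := by
  rw [← orbitSpaceMap_id]
  exact (orbitSpaceMap_homotopic continuous_id _ hf hf_smul (hS.straightLine f)
    (hS.continuous_straightLine hf hfin) (hS.straightLine_smul h hf_smul)
    (hS.straightLine_zero f) (hS.straightLine_one f)).symm

variable {V' : Type*} {Z' : CubeComplex V'}

/-- The extension to all points of a map on vertices, which need not be cellular. -/
noncomputable def IsWallStructure.extend (hS : IsWallStructure Z side) (z : V' → V)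
    (q : Z'.Realization) : Z.Realization :=
  hS.retract (q.isProb.mapDomain z)

theorem support_mapDomain_subset {p : V' →₀ ℝ} {F : Set V'} (z : V' → V)
    (hF : ↑p.support ⊆ F) : ↑(p.mapDomain z).support ⊆ z '' F := by
  classical
  refine (Finset.coe_subset.2 Finsupp.mapDomain_support).trans ?_
  rw [Finset.coe_image]
  exact Set.image_mono hF

theorem IsWallStructure.isFinitary_extend (hS : IsWallStructure Z side) (z : V' → V) :
    IsFinitary (hS.extend (Z' := Z') z) := by
  intro F hF
  obtain ⟨F', hF', h⟩ := hS.exists_support_retract_subset (hF.image z)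
  exact ⟨F', hF', fun q hq => h _ _ (support_mapDomain_subset z hq)⟩

theorem IsWallStructure.continuous_extend (hS : IsWallStructure Z side) (z : V' → V) :
    Continuous (hS.extend (Z' := Z') z) := by
  refine continuous_of_charMap fun n φ => ?_
  refine hS.continuous_retract ((Set.finite_range φ.1).image z)
    (fun x => support_mapDomain_subset z (support_cubePoint_subset φ.1 x))
    (fun x => (Z'.charMap φ x).isProb.mapDomain z) fun v => ?_
  change Continuous fun x => (cubePoint φ.1 x).mapDomain z v
  simp only [mapDomain_cubePoint]
  exact continuous_cubePoint_apply _ _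

theorem IsWallStructure.extend_smul {G : Type*} [Group G] [MulAction G V] [CubicalAction G Z]
    [MulAction G W] [MulAction G V'] [CubicalAction G Z'] (hS : IsWallStructure Z side)
    (h : ∀ (g : G) u v K, side (g • u) (g • K) = side (g • v) (g • K) ↔ side u K = side v K)
    {z : V' → V} (hz : ∀ (g : G) v, z (g • v) = g • z v) (g : G) (q : Z'.Realization) :
    hS.extend z (g • q) = g • hS.extend z q := by
  refine (hS.retract_congr _ (IsProb.mapDomain (q.isProb.mapDomain z) _) ?_).trans
    (hS.retract_smul h _ g _)
  rw [Realization.coe_smul, ← Finsupp.mapDomain_comp, ← Finsupp.mapDomain_comp]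
  congr 1
  exact funext (hz g)

end StraightLine

section Collapse

variable {G : Type w} [Group G] {V : Type u} [MulAction G V] {Z : CubeComplex V}
  [CubicalAction G Z] (hZ : Z.IsCAT0) (𝓗 : SubMulAction G Z.Hyperplane)

theorem isFinitary_collapseMap : IsFinitary (collapseMap hZ 𝓗) := fun F hF =>
  ⟨collapse hZ 𝓗 '' F, hF.image _, fun _ hq => support_mapDomain_subset _ hq⟩

theorem inducesHomotopyEquiv_of_free
    (h : ∀ (g : G) (y : CollapseVertex 𝓗), g • y = y → g = 1) : InducesHomotopyEquiv hZ 𝓗 := by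
  obtain ⟨a⟩ := hZ.connected.nonempty
  obtain ⟨z, hz⟩ := exists_equivariant_of_free h a
  have hS := isWallStructure_side hZ
  have hc := continuous_collapseMap hZ 𝓗
  have hs := hS.continuous_extend (Z' := collapseRange 𝓗) z
  have hc_smul := collapseMap_smul hZ 𝓗
  have hs_smul := hS.extend_smul (Z' := collapseRange 𝓗) smul_side_eq_iff hz
  refine ⟨⟨orbitSpaceMap _ hc hc_smul, orbitSpaceMap _ hs hs_smul, ?_, ?_⟩,
    fun p => ⟨collapseMap hZ 𝓗 p, rfl, rfl⟩⟩
  · rw [orbitSpaceMap_comp]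
    exact hS.orbitSpaceMap_homotopic_id smul_side_eq_iff (hs.comp hc)
      ((hS.isFinitary_extend z).comp (isFinitary_collapseMap hZ 𝓗)) _
  · rw [orbitSpaceMap_comp]
    exact (isWallStructure_choice hZ 𝓗).orbitSpaceMap_homotopic_id smul_choice_eq_iff (hc.comp hs)
      ((isFinitary_collapseMap hZ 𝓗).comp (hS.isFinitary_extend z)) _

end Collapse

/-! ### Free homotopies of loops and covering maps -/

theorem exists_closed_lift {E B : Type*} [TopologicalSpace E] [TopologicalSpace B]
    {p : E → B} (hp : IsCoveringMap p) (M : C(unitInterval × unitInterval, B))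
    (hM : ∀ s, M (s, 0) = M (s, 1)) (γ : C(unitInterval, E)) (hγ : ∀ t, M (0, t) = p (γ t))
    (hγ_closed : γ 0 = γ 1) :
    ∃ δ : C(unitInterval, E), (∀ t, p (δ t) = M (1, t)) ∧ δ 0 = δ 1 := by
  let L := hp.liftHomotopy M γ hγ
  have hL : ∀ s t, p (L (s, t)) = M (s, t) := fun s t =>
    congrFun (hp.liftHomotopy_lifts M γ hγ) (s, t)
  have hL_zero : ∀ t, L (0, t) = γ t := hp.liftHomotopy_zero M γ hγ
  have hL_ends : (fun s => L (s, 0)) = fun s => L (s, 1) :=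
    hp.eq_of_comp_eq (L.continuous.comp (.prodMk_left 0)) (L.continuous.comp (.prodMk_left 1))
      (funext fun s => (hL s 0).trans ((hM s).trans (hL s 1).symm)) 0
      (by rw [hL_zero, hL_zero, hγ_closed])
  exact ⟨L.comp (.prodMk (.const _ 1) (.id _)), fun t => hL 1 t, congrFun hL_ends 1⟩

theorem eq_of_closed_lift {E B G : Type*} [TopologicalSpace E] [TopologicalSpace B] [Group G]
    [MulAction G E] {p : E → B} (hp : IsQuotientCoveringMap p G) (γ δ : C(unitInterval, E))
    (h : ∀ t, p (δ t) = p (γ t)) (hδ : δ 0 = δ 1) : γ 0 = γ 1 := by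
  have : ContinuousConstSMul G E := ⟨hp.continuous_const_smul⟩
  obtain ⟨g, hg⟩ := hp.apply_eq_iff_mem_orbit.1 (h 0)
  have hgγ : (fun t => g • γ t) = δ :=
    hp.isCoveringMap.eq_of_comp_eq (γ.continuous.const_smul g) δ.continuous
      (funext fun t => (hp.map_smul g).trans (h t).symm) 0 hg
  exact MulAction.injective g ((congrFun hgγ 0).trans (hδ.trans (congrFun hgγ 1).symm))

theorem eq_of_nullhomotopic {G X Y : Type*} [Group G] [TopologicalSpace X] [TopologicalSpace Y]
    [MulAction G X] [MulAction G Y]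
    (hX : IsQuotientCoveringMap (Quotient.mk (MulAction.orbitRel G X)) G) {c : X → Y}
    (h : ContinuousMap.HomotopyEquiv (Quotient (MulAction.orbitRel G X))
      (Quotient (MulAction.orbitRel G Y)))
    (hc : ∀ p, h.toFun (Quotient.mk _ p) = Quotient.mk _ (c p)) (α : C(unitInterval, X))
    (D : C(unitInterval × unitInterval, Y)) {y : Y} (hD_zero : ∀ t, D (0, t) = y)
    (hD_one : ∀ t, D (1, t) = c (α t)) (hD : ∀ s, D (s, 0) = D (s, 1)) {g : G}
    (hg : g • α 0 = α 1) : α 0 = α 1 := by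
  let q : C(X, Quotient (MulAction.orbitRel G X)) := ⟨Quotient.mk _, continuous_quotient_mk'⟩
  let q' : C(Y, Quotient (MulAction.orbitRel G Y)) := ⟨Quotient.mk _, continuous_quotient_mk'⟩
  have hqα : q (α 0) = q (α 1) := (hX.map_smul g).symm.trans (congrArg q hg)
  -- The image of the null-homotopic loop `c ∘ α` under the homotopy inverse lifts to a loop `δ`.
  -- The homotopy from `h.invFun ∘ h.toFun` to the identity deforms `δ` to a loop which, like `α`,
  -- lifts the image of `α` in the orbit space.
  obtain ⟨e, he⟩ := hX.surjective (h.invFun (q' y))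
  obtain ⟨δ, hδ, hδ_closed⟩ := exists_closed_lift hX.isCoveringMap (h.invFun.comp (q'.comp D))
    (fun s => congrArg (h.invFun ∘ q') (hD s)) (.const _ e)
    (fun t => (congrArg (h.invFun ∘ q') (hD_zero t)).trans he.symm) rfl
  obtain ⟨K⟩ := h.left_inv
  have hK_zero : ∀ t, K (0, q (α t)) = q (δ t) := fun t =>
    calc
      K (0, q (α t)) = h.invFun (h.toFun (q (α t))) := K.apply_zero _
      _ = h.invFun (q' (D (1, t))) := by rw [hD_one]; exact congrArg h.invFun (hc _)
      _ = q (δ t) := (hδ t).symm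
  obtain ⟨ε, hε, hε_closed⟩ := exists_closed_lift hX.isCoveringMap
    (K.toContinuousMap.comp (.prodMap (.id _) (q.comp α)))
    (fun s => congrArg (fun x => K (s, x)) hqα) δ hK_zero hδ_closed
  exact eq_of_closed_lift hX α ε (fun t => (hε t).trans (K.apply_one _)) hε_closed

/-! ### Free actions -/

theorem IsProb.exists_pos_forall_mem_support {V : Type*} {p : V →₀ ℝ} (hp : IsProb p) :
    ∃ η > 0, ∀ q : V →₀ ℝ, IsProb q → (∀ v ∈ p.support, p v - η < q v) →
      ∀ v ∈ p.support, ∀ w, p v - η < q w → w ∈ p.support := by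
  classical
  set S := p.support
  obtain ⟨v₀, hv₀, hmin⟩ := S.exists_min_image p hp.support_nonempty
  have hpos : 0 < p v₀ := (hp.1 v₀).lt_of_ne (Finsupp.mem_support_iff.1 hv₀).symm
  have hη : p v₀ / (S.card + 1) * S.card + p v₀ / (S.card + 1) = p v₀ := by field_simp
  refine ⟨p v₀ / (S.card + 1), by positivity, fun q hq hqS v hv w hw => ?_⟩
  set η := p v₀ / (S.card + 1)
  by_contra hwS
  have hmass : q w + ∑ u ∈ S, q u ≤ 1 := by
    rw [← hq.2, ← Finset.sum_insert hwS, Finsupp.sum_of_support_subset q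
      (s := insert w S ∪ q.support) Finset.subset_union_right _ (fun _ _ => rfl)]
    exact Finset.sum_le_sum_of_subset_of_nonneg Finset.subset_union_left fun u _ _ => hq.1 u
  have hS : 1 - S.card * η ≤ ∑ u ∈ S, q u :=
    calc
      1 - S.card * η = ∑ u ∈ S, (p u - η) := by
        rw [Finset.sum_sub_distrib, Finset.sum_const, nsmul_eq_mul]
        exact congrArg (· - _) hp.2.symm
      _ ≤ ∑ u ∈ S, q u := Finset.sum_le_sum fun u hu => (hqS u hu).le
  linarith [hmin v hv]

theorem exists_isProb_mapDomain_eq {G V : Type*} [Group G] [MulAction G V] {S : Finset V}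
    (hS : S.Nonempty) {g : G} (hg : ∀ v ∈ S, g • v ∈ S) :
    ∃ p : V →₀ ℝ, IsProb p ∧ p.mapDomain (g • ·) = p := by
  classical
  refine ⟨∑ v ∈ S, Finsupp.single v (S.card : ℝ)⁻¹, ⟨fun v => ?_, ?_⟩, ?_⟩
  · simp only [Finsupp.finsetSum_apply, Finsupp.single_apply]
    exact Finset.sum_nonneg fun w _ => by split_ifs <;> positivity
  · rw [← Finsupp.sum_finsetSum_index (fun _ => rfl) (fun _ _ _ => rfl)]
    simp [hS.card_ne_zero]
  · have hgS : S.image (g • ·) = S :=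
      Finset.eq_of_subset_of_card_le (Finset.image_subset_iff.2 hg)
        (Finset.card_image_of_injective _ (MulAction.injective g)).ge
    conv_rhs => rw [← hgS, Finset.sum_image (MulAction.injective g).injOn]
    simp only [hgS, Finsupp.mapDomain_finsetSum, Finsupp.mapDomain_single]

section Free

variable {V : Type u} {W P : Type*} {side : V → W → P} {Z : CubeComplex V}
  {G : Type w} [Group G] [MulAction G V] [CubicalAction G Z] [MulAction G W]

theorem IsWallStructure.eq_one_of_smul_mem (hS : IsWallStructure Z side)
    (h : ∀ (g : G) u v K, side (g • u) (g • K) = side (g • v) (g • K) ↔ side u K = side v K)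
    (hfree : ∀ (g : G) (p : Z.Realization), g • p = p → g = 1) {F : Finset V} (hF : F.Nonempty)
    {g : G} (hg : ∀ v ∈ F, g • v ∈ F) : g = 1 := by
  obtain ⟨p, hp, hgp⟩ := exists_isProb_mapDomain_eq hF hg
  refine hfree g (hS.retract hp) ?_
  rw [← hS.retract_smul h hp g (hp.mapDomain _)]
  exact hS.retract_congr _ _ hgp

theorem IsWallStructure.isQuotientCoveringMap (hS : IsWallStructure Z side)
    (h : ∀ (g : G) u v K, side (g • u) (g • K) = side (g • v) (g • K) ↔ side u K = side v K)
    (hfree : ∀ (g : G) (p : Z.Realization), g • p = p → g = 1) :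
    IsQuotientCoveringMap (Quotient.mk (MulAction.orbitRel G Z.Realization)) G where
  toIsQuotientMap := MulAction.isOpenQuotientMap_quotientMk.isQuotientMap
  continuous_const_smul := continuous_const_smul
  apply_eq_iff_mem_orbit := Quotient.eq
  disjoint e := by
    obtain ⟨η, hη, hsupp⟩ := e.isProb.exists_pos_forall_mem_support
    refine ⟨⋂ v ∈ e.1.support, {q | e.1 v - η < q.1 v}, ?_, ?_⟩
    · refine (Filter.biInter_finset_mem _).2 fun v _ => ?_
      exact (isOpen_lt continuous_const (continuous_apply v)).mem_nhds
        (show e.1 v - η < e.1 v by linarith)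
    · rintro g ⟨_, ⟨q, hq, rfl⟩, hgq⟩
      simp only [Set.mem_iInter, Set.mem_ofPred_eq] at hq hgq
      have hcoord : ∀ v, (g • q).1 v = q.1 (g⁻¹ • v) := fun v => by
        conv_lhs => rw [← smul_inv_smul g v]
        exact Finsupp.mapDomain_apply (MulAction.injective g) _ _
      exact inv_eq_one.1 (hS.eq_one_of_smul_mem h hfree e.isProb.support_nonempty fun v hv =>
        hsupp _ q.isProb hq v hv _ (hcoord v ▸ hgq v hv))

end Free

/-! ### Homotopy equivalences force free actions -/

section Contractible

variable {V W P : Type*} {side : V → W → P} {Z : CubeComplex V}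

theorem isFinitary_const {V' : Type*} {Z' : CubeComplex V'} (q : Z.Realization) :
    IsFinitary fun _ : Z'.Realization => q :=
  fun _ _ => ⟨↑q.1.support, Finset.finite_toSet _, fun _ _ => le_rfl⟩

theorem IsWallStructure.exists_path (hS : IsWallStructure Z side) (p q : Z.Realization) :
    ∃ α : C(unitInterval, Z.Realization), α 0 = p ∧ α 1 = q := by
  have hline := hS.continuous_straightLine continuous_const (isFinitary_const q)
  refine ⟨⟨fun t => hS.straightLine (fun _ => q) (p, t), hline.comp (.prodMk_right p)⟩, ?_, ?_⟩
  · rw [ContinuousMap.coe_mk, hS.straightLine_zero]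
  · rw [ContinuousMap.coe_mk, hS.straightLine_one]

theorem IsWallStructure.exists_contraction (hS : IsWallStructure Z side)
    (α : C(unitInterval, Z.Realization)) (h : α 0 = α 1) (q : Z.Realization) :
    ∃ D : C(unitInterval × unitInterval, Z.Realization),
      (∀ t, D (0, t) = q) ∧ (∀ t, D (1, t) = α t) ∧ ∀ s, D (s, 0) = D (s, 1) := by
  have hline := hS.continuous_straightLine continuous_const (isFinitary_const q)
  refine ⟨⟨fun x => hS.straightLine (fun _ => q) (α x.2, unitInterval.symm x.1), hline.comp
    ((α.continuous.comp continuous_snd).prodMk (unitInterval.continuous_symm.comp continuous_fst))⟩,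
    fun t => ?_, fun t => ?_, fun s => ?_⟩
  · simp only [ContinuousMap.coe_mk, unitInterval.symm_zero, hS.straightLine_one]
  · simp only [ContinuousMap.coe_mk, unitInterval.symm_one, hS.straightLine_zero]
  · simp only [ContinuousMap.coe_mk, h]

end Contractible

section Collapse

variable {V : Type u} {Z : CubeComplex V}

/-- A vertex, as a point of the realization. -/
noncomputable def point (Z : CubeComplex V) (v : V) : Z.Realization :=
  ⟨Finsupp.single v 1, 0, fun _ => v, Fin.elim0, Z.vertex v, by simp [cubePoint]⟩

variable {G : Type w} [Group G] [MulAction G V] [CubicalAction G Z]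

theorem smul_point (g : G) (v : V) : g • Z.point v = Z.point (g • v) :=
  Subtype.ext Finsupp.mapDomain_single

variable (hZ : Z.IsCAT0) (𝓗 : SubMulAction G Z.Hyperplane)

theorem collapseMap_point (v : V) :
    collapseMap hZ 𝓗 (Z.point v) = (collapseRange 𝓗).point (collapse hZ 𝓗 v) :=
  Subtype.ext Finsupp.mapDomain_single

theorem free_of_inducesHomotopyEquiv
    (hfree : ∀ (g : G) (p : Z.Realization), g • p = p → g = 1)
    (h : InducesHomotopyEquiv hZ 𝓗) (g : G) (y : CollapseVertex 𝓗) (hy : g • y = y) : g = 1 := by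
  obtain ⟨h, hh⟩ := h
  obtain ⟨z, rfl⟩ := collapse_surjective hZ 𝓗 y
  have hS := isWallStructure_side hZ
  have hc : ∀ p, h.toFun (Quotient.mk _ p) = Quotient.mk _ (collapseMap hZ 𝓗 p) := by
    intro p
    obtain ⟨p', hp', hpp'⟩ := hh p
    rwa [(isCollapseImage_iff hZ 𝓗).1 hp'] at hpp'
  obtain ⟨α, hα_zero, hα_one⟩ := hS.exists_path (Z.point z) (g • Z.point z)
  have hcα : collapseMap hZ 𝓗 (α 0) = collapseMap hZ 𝓗 (α 1) := by
    rw [hα_zero, hα_one, smul_point, collapseMap_point, collapseMap_point, smul_collapse, hy]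
  obtain ⟨D, hD_zero, hD_one, hD⟩ := (isWallStructure_choice hZ 𝓗).exists_contraction
    (.comp ⟨_, continuous_collapseMap hZ 𝓗⟩ α) hcα (collapseMap hZ 𝓗 (α 0))
  have hα_closed : α 0 = α 1 :=
    eq_of_nullhomotopic (hS.isQuotientCoveringMap smul_side_eq_iff hfree) h hc α D hD_zero hD_one
      hD (by rw [hα_zero, hα_one])
  rw [hα_zero, hα_one] at hα_closed
  exact hfree g _ hα_closed.symm

end Collapse

variable {G : Type w} [Group G] {V : Type u} [MulAction G V] {Z : CubeComplex V}
  [CubicalAction G Z] (hZ : Z.IsCAT0) {𝓗 : SubMulAction G Z.Hyperplane}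

/-! ### Fibres of the collapse -/

variable (𝓗) in
/-- The edge `e` is collapsed to the vertex `x`, that is, it belongs to the fibre of `x`. -/
def InFiber (x : CollapseVertex 𝓗) (e : Z.Edge) : Prop := ∀ b ∈ e.1, collapse hZ 𝓗 b = x

theorem inFiber_mk {x : CollapseVertex 𝓗} {a b : V} (hab : Z.graph.Adj a b) :
    InFiber hZ 𝓗 x ⟨s(a, b), hab⟩ ↔ collapse hZ 𝓗 a = x ∧ collapse hZ 𝓗 b = x := by
  simp [InFiber]

variable {hZ}

theorem InFiber.smul {x : CollapseVertex 𝓗} {e : Z.Edge} (h : InFiber hZ 𝓗 x e) (g : G) :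
    InFiber hZ 𝓗 (g • x) (g • e) := by
  intro b hb
  obtain ⟨a, ha, rfl⟩ := Sym2.mem_map.1 hb
  rw [smul_collapse, h a ha]

theorem InFiber.eq {x y : CollapseVertex 𝓗} {e : Z.Edge} (hx : InFiber hZ 𝓗 x e)
    (hy : InFiber hZ 𝓗 y e) : x = y := by
  obtain ⟨e, he⟩ := e
  induction e with
  | _ a b => exact ((inFiber_mk hZ he).1 hx).1.symm.trans ((inFiber_mk hZ he).1 hy).1

theorem InFiber.mem {x : CollapseVertex 𝓗} {e : Z.Edge} (h : InFiber hZ 𝓗 x e)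
    {H : Z.Hyperplane} (heH : e.1 ∈ H.dual) : H ∈ 𝓗 := by
  obtain ⟨e, he⟩ := e
  induction e with
  | _ a b =>
    obtain ⟨ha, hb⟩ := (inFiber_mk hZ he).1 h
    by_contra hH
    exact side_ne_of_mem_dual hZ heH ((collapse_eq_iff hZ 𝓗).1 (ha.trans hb.symm) _ hH)

theorem collapse_eq_of_mem {H : Z.Hyperplane} {a b : V} (hab : s(a, b) ∈ H.dual) (hH : H ∈ 𝓗) :
    collapse hZ 𝓗 a = collapse hZ 𝓗 b :=
  (collapse_eq_iff hZ 𝓗).2 fun _ hK => side_eq_of_mem_dual hZ hab fun h => hK (h ▸ hH)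

theorem inFiber_of_mem_dual {H : Z.Hyperplane} {a b : V} (hab : s(a, b) ∈ H.dual) (hH : H ∈ 𝓗) :
    InFiber hZ 𝓗 (collapse hZ 𝓗 a) ⟨s(a, b), adj_of_mem_dual hab⟩ :=
  (inFiber_mk hZ _).2 ⟨rfl, (collapse_eq_of_mem hab hH).symm⟩

variable (hZ) in
theorem exists_inFiber_of_sep_subset {H K : Z.Hyperplane} (hH : H ∈ 𝓗) (hK : K ∈ 𝓗)
    (hsep : Z.Sep H.carrier K.carrier ⊆ (𝓗 : Set Z.Hyperplane)) :
    ∃ (x : CollapseVertex 𝓗) (e f : Z.Edge), InFiber hZ 𝓗 x e ∧ InFiber hZ 𝓗 x f ∧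
      Quotient.mk _ e = H ∧ Quotient.mk _ f = K := by
  obtain ⟨a, a', b, b', ha, hb, hab⟩ := exists_bridge hZ H K
  have hcollapse : collapse hZ 𝓗 a = collapse hZ 𝓗 b :=
    (collapse_eq_iff hZ 𝓗).2 fun L hL => hab L fun hL' => hL (hsep hL')
  exact ⟨_, _, _, inFiber_of_mem_dual ha hH, hcollapse ▸ inFiber_of_mem_dual hb hK,
    (mem_dual_iff (adj_of_mem_dual ha) H).1 ha, (mem_dual_iff (adj_of_mem_dual hb) K).1 hb⟩

/-! ### Strong collapses have free range -/

theorem IsStronglyCollapsible.smul_eq (h𝓗 : IsStronglyCollapsible 𝓗) {H : Z.Hyperplane}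
    (hH : H ∈ 𝓗) {g : G} {a a' b b' : V} (ha : s(a, a') ∈ H.dual) (hb : s(b, b') ∈ (g • H).dual)
    (hab : collapse hZ 𝓗 a = collapse hZ 𝓗 b) : g • H = H := by
  by_contra hg
  refine h𝓗 H hH g hg fun K ⟨s, hs, t, ht, hst, hHs, hHt⟩ => ?_
  by_contra hK
  refine hst ?_
  rw [← side_eq_of_mem_halfspaces hs (hHs (mem_carrier_iff.2 ⟨_, ha⟩)),
    ← side_eq_of_mem_halfspaces ht (hHt (mem_carrier_iff.2 ⟨_, hb⟩))]
  exact (collapse_eq_iff hZ 𝓗).1 hab K hK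

theorem IsStronglyCollapsible.smul_eq_of_side_ne (h𝓗 : IsStronglyCollapsible 𝓗) {g : G} {z : V}
    (hz : collapse hZ 𝓗 (g • z) = collapse hZ 𝓗 z) {H : Z.Hyperplane}
    (hH : H.side z ≠ H.side (g • z)) : g • H = H := by
  have hz_side := (collapse_eq_iff hZ 𝓗).1 hz
  have hH𝓗 : H ∈ 𝓗 := by
    by_contra h
    exact hH (hz_side H h).symm
  obtain ⟨p, q, hpq, hp⟩ := exists_dual_between hZ hH
  have hpz : collapse hZ 𝓗 p = collapse hZ 𝓗 (g • z) :=
    (collapse_eq_iff hZ 𝓗).2 fun K hK => hp K (hz_side K hK).symm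
  refine h𝓗.smul_eq hH𝓗 hpq (smul_mem_dual g hpq) (hZ := hZ) ?_
  rw [smul_collapse, hpz, hz, ← smul_collapse, hz]

/- Each hyperplane separating `z` from `g • z` is fixed by `g`, so it also separates `g • z` from
`g • g • z` and does not separate `z` from `g • g • z`. -/
theorem IsStronglyCollapsible.smul_smul_eq (h𝓗 : IsStronglyCollapsible 𝓗) {g : G} {z : V}
    (hz : collapse hZ 𝓗 (g • z) = collapse hZ 𝓗 z) : g • g • z = z := by
  refine eq_of_side_eq hZ fun K => ?_
  by_cases hK : K.side z = K.side (g • z)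
  · suffices h : (g⁻¹ • K).side z = (g⁻¹ • K).side (g • z) by
      rw [hK]
      simpa only [smul_inv_smul] using ((smul_side_eq_iff g _ _ (g⁻¹ • K)).2 h).symm
    by_contra h
    have hgK := h𝓗.smul_eq_of_side_ne hz h
    rw [smul_inv_smul] at hgK
    exact h (hgK ▸ hK)
  · have hgK := h𝓗.smul_eq_of_side_ne hz hK
    have hK' : K.side (g • z) ≠ K.side (g • g • z) := fun h =>
      hK ((smul_side_eq_iff g _ _ K).1 (hgK.symm ▸ h))
    rcases side_trichotomy hZ K z (g • z) (g • g • z) with h | h | h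
    · exact absurd h hK
    · exact h.symm
    · exact absurd h hK'

theorem IsStronglyCollapsible.free (h𝓗 : IsStronglyCollapsible 𝓗) (hZ : Z.IsCAT0)
    (hfree : ∀ (g : G) (p : Z.Realization), g • p = p → g = 1) (g : G) (y : CollapseVertex 𝓗)
    (hy : g • y = y) : g = 1 := by
  classical
  obtain ⟨z, rfl⟩ := collapse_surjective hZ 𝓗 y
  have hgz : g • g • z = z := h𝓗.smul_smul_eq ((smul_collapse hZ 𝓗 g z).trans hy)
  refine (isWallStructure_side hZ).eq_one_of_smul_mem smul_side_eq_iff hfree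
    (Finset.insert_nonempty z {g • z}) fun v hv => ?_
  simp only [Finset.mem_insert, Finset.mem_singleton] at hv ⊢
  rcases hv with rfl | rfl
  exacts [.inr rfl, .inl hgz]

/-! ### Parallelism in the quotient -/

theorem QuotientParallel.exists_parallel {a b : Quotient (MulAction.orbitRel G Z.Edge)}
    (h : QuotientParallel G (Set.univ : Set Z.Square) a b) {e f : Z.Edge}
    (he : Quotient.mk _ e = a) (hf : Quotient.mk _ f = b) :
    ∃ g : G, Z.parallelSetoid e (g • f) := by
  change Relation.EqvGen _ _ _ at h
  induction h generalizing e f with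
  | rel a b h =>
    obtain ⟨q, -, rfl, rfl⟩ := h
    obtain ⟨k, rfl⟩ := Quotient.exact he
    obtain ⟨l, rfl⟩ := Quotient.exact hf
    refine ⟨k * l⁻¹, ?_⟩
    change Z.parallelSetoid (k • q.bottom) ((k * l⁻¹) • l • q.top)
    rw [mul_smul, inv_smul_smul]
    exact Z.smul_parallel k (.rel _ _ ⟨q, rfl, rfl⟩)
  | refl a =>
    obtain ⟨k, rfl⟩ := Quotient.exact (he.trans hf.symm)
    exact ⟨k, Z.parallelSetoid.refl' _⟩
  | symm a b _ ih =>
    obtain ⟨g, hg⟩ := ih hf he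
    refine ⟨g⁻¹, Z.parallelSetoid.symm' ?_⟩
    simpa only [inv_smul_smul] using Z.smul_parallel g⁻¹ hg
  | trans a b c _ _ ih₁ ih₂ =>
    obtain ⟨m, rfl⟩ := Quotient.exists_rep b
    obtain ⟨g, hg⟩ := ih₁ he rfl
    obtain ⟨k, hk⟩ := ih₂ rfl hf
    refine ⟨g * k, Z.parallelSetoid.trans' hg ?_⟩
    rw [mul_smul]
    exact Z.smul_parallel g hk

theorem quotientParallel_of_parallel {e f : Z.Edge} (h : Z.parallelSetoid e f) :
    QuotientParallel G (Set.univ : Set Z.Square) (Quotient.mk _ e) (Quotient.mk _ f) := by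
  change Relation.EqvGen _ _ _ at h
  induction h with
  | rel e f h =>
    obtain ⟨q, rfl, rfl⟩ := h
    exact .rel _ _ ⟨q, trivial, rfl, rfl⟩
  | refl e => exact .refl _
  | symm e f _ ih => exact .symm _ _ ih
  | trans e f k _ _ ih₁ ih₂ => exact .trans _ _ _ ih₁ ih₂

theorem exists_sq_of_mem_dual_of_side_eq (hZ : Z.IsCAT0) {H : Z.Hyperplane} {a a' b b' : V}
    (ha : s(a, a') ∈ H.dual) (hb : s(b, b') ∈ H.dual) (hab : H.side a = H.side b) (hne : a ≠ b) :
    ∃ c d, Z.Sq a a' d c ∧ Z.graph.Adj a c ∧ Z.graph.dist b a = Z.graph.dist b c + 1 := by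
  obtain ⟨c, hac, hc⟩ := hZ.exists_adj_dist hne
  obtain ⟨K, hK⟩ := exists_hyperplane hac
  have hcH : H.side a ≠ H.side a' := side_ne_of_mem_dual hZ ha
  have hacH : H.side a = H.side c := hab.trans (side_eq_of_adj_of_dist hZ hac hc hab).symm
  have hKH : K ≠ H := fun h => side_ne_of_mem_dual hZ hK (h ▸ hacH)
  have hb'K : K.side b' ≠ K.side a := by
    rw [← side_eq_of_mem_dual hZ hb hKH, side_eq_of_mem_dual_of_dist hZ hK hc]
    exact (side_ne_of_mem_dual hZ hK).symm
  obtain ⟨d, hd⟩ := exists_sq_of_side_ne hZ ha hK (fun h => hcH (h ▸ hacH))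
    (fun h => side_ne_of_mem_dual hZ hb (hab.symm.trans h.symm)) hb'K
  exact ⟨c, d, hd, hac, hc⟩

theorem quotientParallel_of_sq {x : CollapseVertex 𝓗} {a b c d : V} (h : Z.Sq a b c d)
    (hab : Z.graph.Adj a b) (hdc : Z.graph.Adj d c)
    (hx : ∀ v ∈ ({a, b, c, d} : Set V), collapse hZ 𝓗 v = x) :
    QuotientParallel G (preimageSquares hZ 𝓗 (Quotient.mk _ x))
      (Quotient.mk _ ⟨s(a, b), hab⟩) (Quotient.mk _ ⟨s(d, c), hdc⟩) := by
  obtain ⟨φ, hφ, rfl, rfl, rfl, rfl⟩ := h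
  refine .rel _ _ ⟨⟨φ, hφ⟩, ⟨x, rfl, fun ε => hx _ ?_⟩, rfl, rfl⟩
  have hε : ε = ![ε 0, ε 1] := by
    ext i
    fin_cases i <;> rfl
  rw [hε]
  cases ε 0 <;> cases ε 1 <;> simp

theorem quotientParallel_of_side_eq {x : CollapseVertex 𝓗} {H : Z.Hyperplane} (hH : H ∈ 𝓗)
    {a a' b b' : V} (ha : s(a, a') ∈ H.dual) (hb : s(b, b') ∈ H.dual) (hab : H.side a = H.side b)
    (hax : collapse hZ 𝓗 a = x) (hbx : collapse hZ 𝓗 b = x) :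
    QuotientParallel G (preimageSquares hZ 𝓗 (Quotient.mk _ x))
      (Quotient.mk _ ⟨s(a, a'), adj_of_mem_dual ha⟩)
      (Quotient.mk _ ⟨s(b, b'), adj_of_mem_dual hb⟩) := by
  obtain ⟨n, hn⟩ : ∃ n, Z.graph.dist b a = n := ⟨_, rfl⟩
  induction n generalizing a a' with
  | zero =>
    obtain rfl : b = a := hZ.connected.dist_eq_zero_iff.1 hn
    obtain rfl := eq_of_mem_dual_of_mem_dual hZ ha hb
    exact .refl _
  | succ n ih =>
    have hne : a ≠ b := by
      rintro rfl
      simp at hn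
    obtain ⟨c, d, hd, hac, hc⟩ := exists_sq_of_mem_dual_of_side_eq hZ ha hb hab hne
    have hcd : s(c, d) ∈ H.dual := (hd.mem_dual_iff H).1 ha
    have hcx : collapse hZ 𝓗 c = x := hbx ▸ (collapse_eq_iff hZ 𝓗).2 fun L hL =>
      side_eq_of_adj_of_dist hZ hac hc ((collapse_eq_iff hZ 𝓗).1 (hax.trans hbx.symm) L hL)
    refine .trans _ _ _ (quotientParallel_of_sq hd _ (adj_of_mem_dual hcd) ?_)
      (ih hcd (side_eq_of_adj_of_dist hZ hac hc hab) hcx (by omega))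
    rintro v (rfl | rfl | rfl | rfl)
    exacts [hax, (collapse_eq_of_mem ha hH).symm.trans hax,
      (collapse_eq_of_mem hcd hH).symm.trans hcx, hcx]

theorem InFiber.quotientParallel {x : CollapseVertex 𝓗} {e f : Z.Edge} (he : InFiber hZ 𝓗 x e)
    (hf : InFiber hZ 𝓗 x f) (h : Z.parallelSetoid e f) :
    QuotientParallel G (preimageSquares hZ 𝓗 (Quotient.mk _ x)) (Quotient.mk _ e)
      (Quotient.mk _ f) := by
  obtain ⟨H, heH, hfH⟩ : ∃ H : Z.Hyperplane, e.1 ∈ H.dual ∧ f.1 ∈ H.dual :=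
    ⟨Quotient.mk _ e, ⟨e.2, rfl⟩, f.2, (Quotient.sound h).symm⟩
  have hH : H ∈ 𝓗 := he.mem heH
  obtain ⟨e, he'⟩ := e
  obtain ⟨f, hf'⟩ := f
  induction e with
  | _ a a' =>
  induction f with
  | _ b b' =>
  obtain ⟨ha, -⟩ := (inFiber_mk hZ he').1 he
  obtain ⟨hb, hb'⟩ := (inFiber_mk hZ hf').1 hf
  rcases side_trichotomy hZ H a b b' with hab | hab' | hbb'
  · exact quotientParallel_of_side_eq hH heH hfH hab ha hb
  · simpa only [Sym2.eq_swap (a := b)] using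
      quotientParallel_of_side_eq hH heH (Sym2.eq_swap ▸ hfH : s(b', b) ∈ H.dual) hab' ha hb'
  · exact absurd hbb' (side_ne_of_mem_dual hZ hfH)

theorem IsStronglyCollapsible.parallel (h𝓗 : IsStronglyCollapsible 𝓗) {x : CollapseVertex 𝓗}
    {e f : Z.Edge} (he : InFiber hZ 𝓗 x e) (hf : InFiber hZ 𝓗 x f) {g : G}
    (h : Z.parallelSetoid e (g • f)) : Z.parallelSetoid e f := by
  obtain ⟨H, hfH⟩ : ∃ H : Z.Hyperplane, Quotient.mk _ f = H := ⟨_, rfl⟩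
  have heH : Quotient.mk _ e = g • H := by
    rw [← hfH]
    exact Quotient.sound h
  suffices hgH : g • H = H from
    Quotient.exact (s := Z.parallelSetoid) (heH.trans (hgH.trans hfH.symm))
  have hH : H ∈ 𝓗 := hf.mem ⟨f.2, hfH⟩
  obtain ⟨e, he'⟩ := e
  obtain ⟨f, hf'⟩ := f
  induction e with
  | _ a a' =>
  induction f with
  | _ b b' =>
  exact h𝓗.smul_eq hH ⟨hf', hfH⟩ ⟨he', heH⟩
    (((inFiber_mk hZ hf').1 hf).1.trans ((inFiber_mk hZ he').1 he).1.symm)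

theorem IsStronglyCollapsible.quotientParallel (h𝓗 : IsStronglyCollapsible 𝓗) (hZ : Z.IsCAT0)
    (y : Quotient (MulAction.orbitRel G (CollapseVertex 𝓗)))
    {a b : Quotient (MulAction.orbitRel G Z.Edge)} (ha : a ∈ preimageEdges hZ 𝓗 y)
    (hb : b ∈ preimageEdges hZ 𝓗 y) (h : QuotientParallel G (Set.univ : Set Z.Square) a b) :
    QuotientParallel G (preimageSquares hZ 𝓗 y) a b := by
  obtain ⟨e, rfl, x, rfl, he⟩ := ha
  obtain ⟨f, rfl, x', hx', hf⟩ := hb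
  obtain ⟨k, rfl⟩ := Quotient.exact hx'
  have hf_smul : InFiber hZ 𝓗 x (k⁻¹ • f) := by
    simpa only [inv_smul_smul] using InFiber.smul hf k⁻¹
  have hmk : (Quotient.mk _ f : Quotient (MulAction.orbitRel G Z.Edge)) = Quotient.mk _ (k⁻¹ • f) :=
    Quotient.sound ⟨k, smul_inv_smul k f⟩
  obtain ⟨g, hg⟩ := h.exists_parallel rfl hmk.symm
  rw [hmk]
  exact InFiber.quotientParallel he hf_smul (h𝓗.parallel he hf_smul hg)

variable (hZ) in
/-- Every edge of the orbit `a` in the fibre of `x` is parallel to an edge of the orbit `b` in the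
same fibre: parallelism in the image of the fibre, lifted to `Z`. -/
def FiberParallel (x : CollapseVertex 𝓗) (a b : Quotient (MulAction.orbitRel G Z.Edge)) : Prop :=
  ∀ e : Z.Edge, Quotient.mk _ e = a → InFiber hZ 𝓗 x e →
    ∃ f : Z.Edge, Quotient.mk _ f = b ∧ InFiber hZ 𝓗 x f ∧ Z.parallelSetoid e f

theorem FiberParallel.trans {x : CollapseVertex 𝓗}
    {a b c : Quotient (MulAction.orbitRel G Z.Edge)} (hab : FiberParallel hZ x a b)
    (hbc : FiberParallel hZ x b c) : FiberParallel hZ x a c := by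
  intro e he hex
  obtain ⟨f, hf, hfx, hef⟩ := hab e he hex
  obtain ⟨k, hk, hkx, hfk⟩ := hbc f hf hfx
  exact ⟨k, hk, hkx, Z.parallelSetoid.trans' hef hfk⟩

theorem InFiber.fiberParallel {x y : CollapseVertex 𝓗} {e f : Z.Edge} (he : InFiber hZ 𝓗 y e)
    (hf : InFiber hZ 𝓗 y f) (h : Z.parallelSetoid e f) :
    FiberParallel hZ x (Quotient.mk _ e) (Quotient.mk _ f) := by
  intro e' he' hex
  obtain ⟨k, rfl⟩ := Quotient.exact he'
  exact ⟨k • f, Quotient.sound ⟨k, rfl⟩, (he.smul k).eq hex ▸ hf.smul k, Z.smul_parallel k h⟩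

theorem QuotientParallel.fiberParallel {x : CollapseVertex 𝓗}
    {a b : Quotient (MulAction.orbitRel G Z.Edge)}
    (h : QuotientParallel G (preimageSquares hZ 𝓗 (Quotient.mk _ x)) a b) :
    FiberParallel hZ x a b ∧ FiberParallel hZ x b a := by
  change Relation.EqvGen _ _ _ at h
  induction h with
  | rel a b h =>
    obtain ⟨q, ⟨y, -, hq⟩, rfl, rfl⟩ := h
    have hbottom : InFiber hZ 𝓗 y q.bottom := (inFiber_mk hZ _).2 ⟨hq _, hq _⟩
    have htop : InFiber hZ 𝓗 y q.top := (inFiber_mk hZ _).2 ⟨hq _, hq _⟩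
    have hpar : Z.parallelSetoid q.bottom q.top := .rel _ _ ⟨q, rfl, rfl⟩
    exact ⟨hbottom.fiberParallel htop hpar,
      htop.fiberParallel hbottom (Z.parallelSetoid.symm' hpar)⟩
  | refl a =>
    exact and_self_iff.2 fun e he hex => ⟨e, he, hex, Z.parallelSetoid.refl' _⟩
  | symm a b _ ih => exact ih.symm
  | trans a b c _ _ ih₁ ih₂ => exact ⟨ih₁.1.trans ih₂.1, ih₂.2.trans ih₁.2⟩

theorem isStronglyCollapsible_of_free (hfree : ∀ (g : G) (y : CollapseVertex 𝓗), g • y = y → g = 1)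
    (h : ∀ (y : Quotient (MulAction.orbitRel G (CollapseVertex 𝓗))),
      ∀ a ∈ preimageEdges hZ 𝓗 y, ∀ b ∈ preimageEdges hZ 𝓗 y,
        QuotientParallel G (Set.univ : Set Z.Square) a b →
          QuotientParallel G (preimageSquares hZ 𝓗 y) a b) : IsStronglyCollapsible 𝓗 := by
  intro H hH g hg hsep
  obtain ⟨x, e, f, he, hf, rfl, hfH⟩ :=
    exists_inFiber_of_sep_subset hZ hH (𝓗.smul_mem g hH) hsep
  have hpar : QuotientParallel G (Set.univ : Set Z.Square) (Quotient.mk _ e) (Quotient.mk _ f) := by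
    have hmk : (Quotient.mk _ (g • e) : Quotient (MulAction.orbitRel G Z.Edge)) = Quotient.mk _ e :=
      Quotient.sound ⟨g, rfl⟩
    rw [← hmk]
    exact quotientParallel_of_parallel (Quotient.exact (s := Z.parallelSetoid) hfH.symm)
  obtain ⟨f', hf', hf'x, hef'⟩ :=
    (h _ _ ⟨e, rfl, x, rfl, he⟩ _ ⟨f, rfl, x, rfl, hf⟩ hpar).fiberParallel.1 e rfl he
  obtain ⟨l, rfl⟩ := Quotient.exact hf'
  have hl : l = 1 := hfree l x ((hf.smul l).eq hf'x)
  have hef : Z.parallelSetoid e f := by simpa only [hl, one_smul] using hef'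
  exact hg (hfH.symm.trans (Quotient.sound (s := Z.parallelSetoid) hef).symm)

end CubeComplex

theorem lemma3p7 {V : Type u} {G : Type w} [Group G] [MulAction G V] (Z : CubeComplex V)
    [CubicalAction G Z] (hZ : Z.IsCAT0)
    (hfree : ∀ (g : G) (p : Z.Realization), g • p = p → g = 1)
    (𝓗 : SubMulAction G Z.Hyperplane) :
    CubeComplex.IsStronglyCollapsible 𝓗 ↔
      CubeComplex.InducesHomotopyEquiv hZ 𝓗 ∧
        ∀ (y : Quotient (MulAction.orbitRel G (CubeComplex.CollapseVertex 𝓗))),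
          ∀ a ∈ CubeComplex.preimageEdges hZ 𝓗 y, ∀ b ∈ CubeComplex.preimageEdges hZ 𝓗 y,
            CubeComplex.QuotientParallel G (Set.univ : Set Z.Square) a b →
              CubeComplex.QuotientParallel G (CubeComplex.preimageSquares hZ 𝓗 y) a b := by
  constructor
  · intro hs
    exact ⟨CubeComplex.inducesHomotopyEquiv_of_free hZ 𝓗 (hs.free hZ hfree),
      fun y _ ha _ hb hab => hs.quotientParallel hZ y ha hb hab⟩
  · rintro ⟨hequiv, hparallel⟩
    exact CubeComplex.isStronglyCollapsible_of_free
      (CubeComplex.free_of_inducesHomotopyEquiv hZ 𝓗 hfree hequiv) hparallel
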